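/- Let $F\supseteq\mathbb C$ be a field, let $r,n\ge 1$, let $p$ be a positive divisor of $r$, and put $\zeta=e^{2\pi i/r}$. Let $\mathbb H$ be the rational Cherednik algebra over $F$ of type $G(r,1,n)$ with parameters $\kappa,c_0,d_i\in F$ ($i\in\mathbb Z/r$, $\sum_i d_i=0$): it is generated by commuting $x_1,\dots,x_n$, commuting $y_1,\dots,y_n$ and $t_w$ ($w\in G(r,1,n)$, $t_wt_v=t_{wv}$), with relations $t_wx=(wx)t_w$, $t_wy=(wy)t_w$, $$y_ix_j=x_jy_i+c_0\sum_{l=0}^{r-1}\zeta^{-l}t_{\zeta_i^ls_{ij}\zeta_i^{-l}}\ (i\ne j),\qquad y_ix_i=x_iy_i+\kappa-\sum_{j=0}^{r-1}(d_j-d_{j-1})e_{ij}-c_0\sum_{j\ne i}\sum_{l=0}^{r-1}t_{\zeta_i^ls_{ij}\zeta_i^{-l}},$$ where $\zeta_i$ is the diagonal matrix with $\zeta$ in position $i$ and ones elsewhere, $s_{ij}$ is the transposition matrix, and $e_{ij}=\frac1r\sum_l\zeta^{-lj}t_{\zeta_i^l}$. Assume that $d_i$ depends only on $i$ modulo $r/p$.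 Let $\alpha$ be the automorphism of $\mathbb H$ that fixes $x_i$, $y_i$ and $t_w$ for $w\in S_n$ and sends $t_{\zeta_i}$ to $\zeta^{r/p}t_{\zeta_i}$, and let $\mathbb H_p$ be the subalgebra of $\mathbb H$ fixed by $\alpha$ (for $n\ge3$ this is the rational Cherednik algebra of type $G(r,p,n)$). For an $r$-partition $\lambda=(\lambda^0,\dots,\lambda^{r-1})$ of $n$ let $S^\lambda$ be the irreducible $FG(r,1,n)$-module with Young's orthonormal basis $v_T$, $T\in\mathrm{SYT}(\lambda)$, so that $t_{\zeta_i}v_T=\zeta^{\beta_i}v_T$ if $i$ lies in the component $\lambda^{\beta_i}$ of $T$, and $t_{s_{i,i+1}}v_T=a\,v_T+\sqrt{1-a^2}\,v_{s_iT}$, where $s_iT$ is $T$ with $i,i+1$ exchanged ($v_{s_iT}=0$ if $s_iT$ is not standard), $a=0$ if $\beta_i\neq\beta_{i+1}$, and otherwise $a^{-1}$ is the content (column minus row) of the box of $i+1$ minus that of the box of $i$. Let $M(\lambda)$ be the $\mathbb H$-module induced from $S^\lambda$ with all $y_i$ acting on $S^\lambda$ by $0$; it is graded by the degree in the $x_i$.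 Write $\mathrm{rad}$ for the intersection of all maximal submodules and $L(\lambda)=M(\lambda)/\mathrm{rad}(M(\lambda))$. Let $C$ be the cyclic shift $C(\lambda^0,\dots,\lambda^{r-1})=(\lambda^{r-1},\lambda^0,\dots,\lambda^{r-2})$ of $r$-partitions, and also of standard tableaux. Let $k$ be the smallest positive integer such that the twist $M(\lambda)^{\alpha^k}$ (on which $h\in\mathbb H$ acts as $\alpha^k(h)$) is isomorphic to $M(\lambda)$. Then: (0) $\mathbb H_p$ is generated by the $x_i$, the $y_i$ and the $t_w$ with $w\in G(r,p,n)$. Moreover $k$ divides $p$, $k$ is the smallest positive integer with $C^{kr/p}\lambda=\lambda$, and $x^\mu v_T\mapsto x^\mu v_{C^{kr/p}T}$ defines an $\mathbb H_p$-module automorphism $C^{kr/p}$ of $M(\lambda)$. If $M(\lambda,q)$ denotes its $\zeta^{qkr/p}$-eigenspace, then $M(\lambda)=\bigoplus_{q=0}^{p/k-1}M(\lambda,q)$; let $\pi_q$ be the projection onto the $q$th summand. (1) The radical of the $\mathbb H_p$-module $M(\lambda,q)$ is $\pi_q(\mathrm{rad}(M(\lambda)))$. (2) $\mathrm{rad}(M(\lambda))$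 is $C^{kr/p}$-stable, so $C^{kr/p}$ acts on $L(\lambda)$, and $L(\lambda)=\bigoplus_{q=0}^{p/k-1}L(\lambda,q)$, where $L(\lambda,q)$ is the $\zeta^{qkr/p}$-eigenspace on $L(\lambda)$. The quotient map $M(\lambda)\to L(\lambda)$ induces an isomorphism of $\mathbb H_p$-modules $M(\lambda,q)/\mathrm{rad}(M(\lambda,q))\cong L(\lambda,q)$, and if $\kappa\ne0$ then each $L(\lambda,q)$ is an irreducible $\mathbb H_p$-module. (3) With $q$ read modulo $p/k$, the element $t_{\zeta_1}$ maps $M(\lambda,q)$ into $M(\lambda,q-1)$ and induces a vector space isomorphism of $L(\lambda,q)$ onto $L(\lambda,q-1)$. The spaces $L(\lambda)$ and $L(\lambda,q)$ are graded, with finite-dimensional pieces, by the images of the graded pieces of $M(\lambda)$, and $\dim L(\lambda,q)_i=\frac kp\dim L(\lambda)_i$ for all $q$ and $i$. -/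

import Mathlib

open scoped TensorProduct

noncomputable section

/-! ### The reflection groups -/

/-- The group `G(r,1,n)`, as the wreath product of `ℤ/r` by the symmetric group.  The pair `(a, σ)`
stands for the monomial matrix `diag(ζ ^ a 0, …, ζ ^ a (n-1)) * P_σ`, where `ζ = exp (2πi/r)` and
`P_σ` is the permutation matrix with `P_σ y_j = y_{σ j}`. -/
abbrev ReflGroup (r n : ℕ) : Type :=
  (Fin n → Multiplicative (ZMod r)) ⋊[mulAutArrow (G := Equiv.Perm (Fin n)) (A := Fin n)
    (M := Multiplicative (ZMod r))] Equiv.Perm (Fin n)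

namespace ReflGroup

/-- The exponent `a i` of the nonzero entry `ζ ^ a i` in the `i`-th row of `w`. -/
def expo {r n : ℕ} (w : ReflGroup r n) (i : Fin n) : ZMod r := Multiplicative.toAdd (w.left i)

/-- The matrix `ζ_i ^ l`, with `ζ ^ l` in position `i` and ones elsewhere on the diagonal. -/
def diagElt {r n : ℕ} (i : Fin n) (l : ZMod r) : ReflGroup r n :=
  SemidirectProduct.inl (Pi.mulSingle i (Multiplicative.ofAdd l))

/-- The permutation matrix of `σ`. -/
def permElt {r n : ℕ} (σ : Equiv.Perm (Fin n)) : ReflGroup r n := SemidirectProduct.inr σ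

/-- The reflection `ζ_i ^ l s_{ij} ζ_i ^ {-l}`. -/
def refl {r n : ℕ} (i j : Fin n) (l : ZMod r) : ReflGroup r n :=
  diagElt i l * permElt (Equiv.swap i j) * diagElt i (-l)

/-- Exponent of the product of the nonzero entries of `w`. -/
def totalExpo {r n : ℕ} (w : ReflGroup r n) : ZMod r := ∑ i, w.expo i

theorem totalExpo_one {r n : ℕ} : totalExpo (1 : ReflGroup r n) = 0 := by
  simp [totalExpo, expo]

theorem totalExpo_mul {r n : ℕ} (w v : ReflGroup r n) :
    totalExpo (w * v) = totalExpo w + totalExpo v := by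
  simp only [totalExpo, expo, SemidirectProduct.mul_left, Pi.mul_apply, toAdd_mul,
    Finset.sum_add_distrib]
  congr 1
  exact Equiv.sum_comp (w.right⁻¹) (fun i => Multiplicative.toAdd (v.left i))

theorem totalExpo_diagElt {r n : ℕ} (i : Fin n) (l : ZMod r) :
    totalExpo (diagElt i l : ReflGroup r n) = l := by
  classical
  simp only [totalExpo, expo, diagElt, SemidirectProduct.left_inl]
  rw [Finset.sum_eq_single i]
  · simp
  · intro j _ hj
    simp [Pi.mulSingle_eq_of_ne hj]
  · simp

theorem totalExpo_permElt {r n : ℕ} (σ : Equiv.Perm (Fin n)) :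
    totalExpo (permElt σ : ReflGroup r n) = 0 := by
  simp [totalExpo, expo, permElt]

theorem totalExpo_refl {r n : ℕ} (i j : Fin n) (l : ZMod r) :
    totalExpo (refl i j l : ReflGroup r n) = 0 := by
  simp [refl, totalExpo_mul, totalExpo_diagElt, totalExpo_permElt]

/-- `G(r,p,n)`: the elements of `G(r,1,n)` such that the product of the nonzero entries is an
`r/p`-th root of unity. -/
def subgroupP (r p n : ℕ) : Set (ReflGroup r n) :=
  {w | ((r / p : ℕ) : ZMod r) * w.totalExpo = 0}

end ReflGroup

/-- `ζ ^ a` in the field `F ⊇ ℂ`, where `ζ = exp (2πi/r)`. -/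
def zetaPow (F : Type*) [Field F] [Algebra ℂ F] (r : ℕ) [NeZero r] (a : ZMod r) : F :=
  algebraMap ℂ F (ZMod.stdAddChar a)

theorem zetaPow_zero (F : Type*) [Field F] [Algebra ℂ F] (r : ℕ) [NeZero r] :
    zetaPow F r 0 = 1 := by
  simp [zetaPow]

theorem zetaPow_add (F : Type*) [Field F] [Algebra ℂ F] (r : ℕ) [NeZero r] (a b : ZMod r) :
    zetaPow F r (a + b) = zetaPow F r a * zetaPow F r b := by
  simp [zetaPow, AddChar.map_add_eq_mul]

/-! ### The rational Cherednik algebra of type `G(r,1,n)` -/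

/-- Parameters `κ, c₀, d_i` of the algebra; `d` is indexed modulo `r` and has sum zero. -/
structure ChParams (F : Type*) [Field F] (r : ℕ) [NeZero r] where
  /-- the parameter `κ` -/
  kappa : F
  /-- the parameter `c₀` -/
  c0 : F
  /-- the parameters `d_i` -/
  d : ZMod r → F
  sum_d : ∑ i, d i = 0

/-- Generators `x_i`, `y_i`, `t_w` of the rational Cherednik algebra. -/
inductive ChGen (r n : ℕ) : Type
  | x (i : Fin n) : ChGen r n
  | y (i : Fin n) : ChGen r n
  | t (w : ReflGroup r n) : ChGen r n

section Cherednik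

variable {F : Type*} [Field F] [Algebra ℂ F] {r : ℕ} [NeZero r]

/-- The element `∑_j (d_j - d_{j-1}) e_{ij}` where `e_{ij} = r⁻¹ ∑_l ζ^{-lj} t_{ζ_i^l}`, in an
algebra with given elements `t_w`. -/
def dTerm (P : ChParams F r) {n : ℕ} {A : Type*} [Ring A] [Algebra F A] (t : ReflGroup r n → A)
    (i : Fin n) : A :=
  ∑ j : ZMod r, (P.d j - P.d (j - 1)) •
    ((r : F)⁻¹ • ∑ l : ZMod r, zetaPow F r (-(l * j)) • t (ReflGroup.diagElt i l))

/-- Defining relations of the rational Cherednik algebra. -/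
inductive ChRel (P : ChParams F r) (n : ℕ) :
    FreeAlgebra F (ChGen r n) → FreeAlgebra F (ChGen r n) → Prop
  | t_one : ChRel P n (FreeAlgebra.ι F (ChGen.t 1)) 1
  | t_mul (w v : ReflGroup r n) :
      ChRel P n (FreeAlgebra.ι F (ChGen.t (w * v)))
        (FreeAlgebra.ι F (ChGen.t w) * FreeAlgebra.ι F (ChGen.t v))
  | x_comm (i j : Fin n) :
      ChRel P n (FreeAlgebra.ι F (ChGen.x i) * FreeAlgebra.ι F (ChGen.x j))
        (FreeAlgebra.ι F (ChGen.x j) * FreeAlgebra.ι F (ChGen.x i))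
  | y_comm (i j : Fin n) :
      ChRel P n (FreeAlgebra.ι F (ChGen.y i) * FreeAlgebra.ι F (ChGen.y j))
        (FreeAlgebra.ι F (ChGen.y j) * FreeAlgebra.ι F (ChGen.y i))
  /-- `w x_j = ζ ^ (-a_{σ j}) x_{σ j}` in the dual of the reflection representation -/
  | t_x (w : ReflGroup r n) (j : Fin n) :
      ChRel P n (FreeAlgebra.ι F (ChGen.t w) * FreeAlgebra.ι F (ChGen.x j))
        (zetaPow F r (-(w.expo (w.right j))) •
          (FreeAlgebra.ι F (ChGen.x (w.right j)) * FreeAlgebra.ι F (ChGen.t w)))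
  /-- `w y_j = ζ ^ (a_{σ j}) y_{σ j}` in the reflection representation -/
  | t_y (w : ReflGroup r n) (j : Fin n) :
      ChRel P n (FreeAlgebra.ι F (ChGen.t w) * FreeAlgebra.ι F (ChGen.y j))
        (zetaPow F r (w.expo (w.right j)) •
          (FreeAlgebra.ι F (ChGen.y (w.right j)) * FreeAlgebra.ι F (ChGen.t w)))
  | y_x_ne (i j : Fin n) (h : i ≠ j) :
      ChRel P n (FreeAlgebra.ι F (ChGen.y i) * FreeAlgebra.ι F (ChGen.x j))
        (FreeAlgebra.ι F (ChGen.x j) * FreeAlgebra.ι F (ChGen.y i) +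
          P.c0 • ∑ l : ZMod r,
            zetaPow F r (-l) • FreeAlgebra.ι F (ChGen.t (ReflGroup.refl i j l)))
  | y_x_self (i : Fin n) :
      ChRel P n (FreeAlgebra.ι F (ChGen.y i) * FreeAlgebra.ι F (ChGen.x i))
        (FreeAlgebra.ι F (ChGen.x i) * FreeAlgebra.ι F (ChGen.y i) +
          algebraMap F (FreeAlgebra F (ChGen r n)) P.kappa -
          dTerm P (fun w => FreeAlgebra.ι F (ChGen.t w)) i -
          P.c0 • ∑ j ∈ Finset.univ.erase i, ∑ l : ZMod r,
            FreeAlgebra.ι F (ChGen.t (ReflGroup.refl i j l)))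

/-- The rational Cherednik algebra `ℍ` of type `G(r,1,n)`. -/
def Cherednik (P : ChParams F r) (n : ℕ) : Type _ := RingQuot (ChRel P n)

instance (P : ChParams F r) (n : ℕ) : Ring (Cherednik P n) :=
  inferInstanceAs (Ring (RingQuot (ChRel P n)))

instance (P : ChParams F r) (n : ℕ) : Algebra F (Cherednik P n) :=
  inferInstanceAs (Algebra F (RingQuot (ChRel P n)))

namespace Cherednik

/-- The quotient map from the free algebra. -/
def mk (P : ChParams F r) (n : ℕ) : FreeAlgebra F (ChGen r n) →ₐ[F] Cherednik P n :=
  RingQuot.mkAlgHom F (ChRel P n)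

variable {P : ChParams F r} {n : ℕ}

/-- The generator `x_i`. -/
def x (i : Fin n) : Cherednik P n := mk P n (FreeAlgebra.ι F (ChGen.x i))

/-- The generator `y_i`. -/
def y (i : Fin n) : Cherednik P n := mk P n (FreeAlgebra.ι F (ChGen.y i))

/-- The generator `t_w`. -/
def t (w : ReflGroup r n) : Cherednik P n := mk P n (FreeAlgebra.ι F (ChGen.t w))

/-- The monomial `x ^ μ`. -/
def xMon (μ : Fin n → ℕ) : Cherednik P n := (List.ofFn fun i => x (P := P) i ^ μ i).prod

theorem mk_rel {a b : FreeAlgebra F (ChGen r n)} (h : ChRel P n a b) : mk P n a = mk P n b :=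
  RingQuot.mkAlgHom_rel F h

/-- Values of the automorphism `α` on generators: `x_i` and `y_i` are fixed and
`t_w ↦ e ^ (r/p) t_w` where `e` is the product of the nonzero entries of `w`; thus `α t_w = t_w`
for permutation matrices `w`, and `α t_{ζ_i} = ζ ^ (r/p) t_{ζ_i}`. -/
def alphaGen (P : ChParams F r) (n p : ℕ) : ChGen r n → Cherednik P n
  | ChGen.x i => x i
  | ChGen.y i => y i
  | ChGen.t w => zetaPow F r (((r / p : ℕ) : ZMod r) * w.totalExpo) • t w

theorem alpha_dTerm (p : ℕ) (hd : ∀ i : ZMod r, P.d (i + ((r / p : ℕ) : ZMod r)) = P.d i)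
    (i : Fin n) :
    dTerm P (fun w => zetaPow F r (((r / p : ℕ) : ZMod r) * w.totalExpo) • t (P := P) w) i =
      dTerm P (fun w => t (P := P) w) i := by
  unfold dTerm
  rw [← Equiv.sum_comp (Equiv.addRight (((r / p : ℕ) : ZMod r)))
    (fun j : ZMod r => (P.d j - P.d (j - 1)) • ((r : F)⁻¹ • ∑ l : ZMod r, zetaPow F r (-(l * j)) •
      (zetaPow F r (((r / p : ℕ) : ZMod r) * (ReflGroup.diagElt i l).totalExpo) •
        t (P := P) (ReflGroup.diagElt i l))))]
  refine Finset.sum_congr rfl fun j _ => ?_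
  have h2 : P.d (j + ((r / p : ℕ) : ZMod r) - 1) = P.d (j - 1) := by
    rw [← hd (j - 1)]; congr 1; ring
  simp only [Equiv.coe_addRight, hd, h2, ReflGroup.totalExpo_diagElt, smul_smul]
  congr 1
  refine Finset.sum_congr rfl fun l _ => ?_
  rw [← zetaPow_add]
  congr 2
  ring

theorem alphaGen_rel (p : ℕ) (hd : ∀ i : ZMod r, P.d (i + ((r / p : ℕ) : ZMod r)) = P.d i)
    {a b : FreeAlgebra F (ChGen r n)} (h : ChRel P n a b) :
    FreeAlgebra.lift F (alphaGen P n p) a = FreeAlgebra.lift F (alphaGen P n p) b := by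
  have key := mk_rel h
  induction h with
  | t_one =>
    simpa [alphaGen, ReflGroup.totalExpo_one, zetaPow_zero, t] using key
  | t_mul w v =>
    simp only [map_mul] at key
    simp only [map_mul, FreeAlgebra.lift_ι_apply, alphaGen, ReflGroup.totalExpo_mul, mul_add,
      zetaPow_add, smul_mul_smul_comm, t, key]
  | x_comm i j => simpa [alphaGen, x] using key
  | y_comm i j => simpa [alphaGen, y] using key
  | t_x w j =>
    simp only [map_mul, map_smul] at key
    simp only [map_mul, map_smul, FreeAlgebra.lift_ι_apply, alphaGen, smul_mul_assoc,
      mul_smul_comm, t, x, key]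
    rw [smul_comm]
  | t_y w j =>
    simp only [map_mul, map_smul] at key
    simp only [map_mul, map_smul, FreeAlgebra.lift_ι_apply, alphaGen, smul_mul_assoc,
      mul_smul_comm, t, y, key]
    rw [smul_comm]
  | y_x_ne i j h =>
    simp only [map_mul, map_smul, map_add, map_sum] at key
    simp only [map_mul, map_smul, map_add, map_sum, FreeAlgebra.lift_ι_apply, alphaGen,
      ReflGroup.totalExpo_refl, mul_zero, zetaPow_zero, one_smul, t, x, y, key]
  | y_x_self i =>
    have hD := alpha_dTerm (n := n) p hd i
    simp only [dTerm, t] at hD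
    simp only [dTerm, map_mul, map_smul, map_add, map_sub, map_sum, AlgHom.commutes] at key
    simp only [dTerm, map_mul, map_smul, map_add, map_sub, map_sum, AlgHom.commutes,
      FreeAlgebra.lift_ι_apply, alphaGen,
      ReflGroup.totalExpo_refl, mul_zero, zetaPow_zero, one_smul, t, x, y, key, hD]

/-- The automorphism `α` of `ℍ`, defined when `d_i` depends only on `i` modulo `r/p`. -/
def alpha (P : ChParams F r) (n p : ℕ)
    (hd : ∀ i : ZMod r, P.d (i + ((r / p : ℕ) : ZMod r)) = P.d i) :
    Cherednik P n →ₐ[F] Cherednik P n :=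
  RingQuot.liftAlgHom F ⟨FreeAlgebra.lift F (alphaGen P n p), fun _ _ h => alphaGen_rel p hd h⟩

/-- The algebra `ℍ_p`: the subalgebra of `ℍ` fixed by `α`. -/
def fixedAlg (P : ChParams F r) (n p : ℕ)
    (hd : ∀ i : ZMod r, P.d (i + ((r / p : ℕ) : ZMod r)) = P.d i) :
    Subalgebra F (Cherednik P n) :=
  AlgHom.equalizer (alpha P n p hd) (AlgHom.id F (Cherednik P n))

end Cherednik

end Cherednik

/-! ### Multipartitions and standard tableaux -/

/-- `r`-partitions of `n`. -/
structure RPartition (r : ℕ) [NeZero r] (n : ℕ) where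
  /-- the `i`-th partition, `i` read modulo `r` -/
  part : ZMod r → YoungDiagram
  card_eq : ∑ i, (part i).card = n

/-- The cyclic shift `C ^ m` of `r`-partitions: its `i`-th component is `λ^{i-m}`. -/
def RPartition.rotate {r : ℕ} [NeZero r] {n : ℕ} (lam : RPartition r n) (m : ZMod r) :
    RPartition r n where
  part i := lam.part (i - m)
  card_eq := by
    exact (Equiv.sum_comp (Equiv.subRight m) (fun i => (lam.part i).card)).trans lam.card_eq

/-- `T` is a standard Young tableau on `lam`: `T j = (β, row, column)` is the box containing `j`. -/
structure IsSYT {r : ℕ} [NeZero r] {n : ℕ} (lam : RPartition r n)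
    (T : Fin n → ZMod r × ℕ × ℕ) : Prop where
  bij : Set.BijOn T Set.univ {b | b.2 ∈ lam.part b.1}
  row_lt : ∀ i j, (T i).1 = (T j).1 → (T i).2.1 = (T j).2.1 → (T i).2.2 < (T j).2.2 → i < j
  col_lt : ∀ i j, (T i).1 = (T j).1 → (T i).2.2 = (T j).2.2 → (T i).2.1 < (T j).2.1 → i < j

/-- Standard Young tableaux on `lam`. -/
def SYT {r : ℕ} [NeZero r] {n : ℕ} (lam : RPartition r n) : Type :=
  {T : Fin n → ZMod r × ℕ × ℕ // IsSYT lam T}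

namespace SYT

variable {r : ℕ} [NeZero r] {n : ℕ} {lam : RPartition r n}

/-- The index of the component containing `j`. -/
def beta (T : SYT lam) (j : Fin n) : ZMod r := (T.1 j).1

/-- The content (column minus row) of the box containing `j`. -/
def ct (T : SYT lam) (j : Fin n) : ℤ := ((T.1 j).2.2 : ℤ) - ((T.1 j).2.1 : ℤ)

/-- The coefficient of `v_T` in `t_{s} v_T` for `s` the transposition of the adjacent entries
`i, j`. -/
def diagCoeff (T : SYT lam) (i j : Fin n) : ℝ :=
  if T.beta i = T.beta j then 1 / ((T.ct j : ℝ) - (T.ct i : ℝ)) else 0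

open Classical in
/-- The basis symbol of the tableau obtained from `T` by exchanging the entries `i` and `j`, or `0`
if this is not a standard tableau. -/
def swapSymbol (A : Type*) [Semiring A] (T : SYT lam) (i j : Fin n) : SYT lam →₀ A :=
  if h : IsSYT lam (fun a => T.1 (Equiv.swap i j a)) then Finsupp.single ⟨_, h⟩ 1 else 0

/-- The shift `C ^ m` of tableaux, from `SYT(lam)` to `SYT(C ^ m lam)`. -/
def rotate (T : SYT lam) (m : ZMod r) {lam' : RPartition r n} (h : lam.rotate m = lam') :
    SYT lam' :=
  ⟨fun j => ((T.1 j).1 + m, (T.1 j).2), by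
    subst h
    obtain ⟨T, ⟨⟨h1, h2, h3⟩, hr, hc⟩⟩ := T
    refine ⟨⟨?_, ?_, ?_⟩, ?_, ?_⟩
    · intro j hj
      have := h1 hj
      simpa [RPartition.rotate] using this
    · intro i hi j hj hij
      refine h2 hi hj ?_
      simp only [Prod.mk.injEq, add_left_inj] at hij
      exact Prod.ext hij.1 hij.2
    · rintro ⟨b, c⟩ hb
      obtain ⟨j, hj, hj'⟩ := h3 (show (b - m, c) ∈ {b | b.2 ∈ lam.part b.1} from hb)
      exact ⟨j, hj, by simp [hj']⟩
    · intro i j h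
      exact hr i j (by simpa using h)
    · intro i j h
      exact hc i j (by simpa using h)⟩

end SYT

/-! ### The irreducible modules of `G(r,1,n)` -/

section Modules

variable (F : Type*) [Field F] [Algebra ℂ F] {r : ℕ} [NeZero r] {n : ℕ}

/-- The relations of Young's orthonormal form: for all tableaux `T`,
`t_{ζ_i} v_T = ζ ^ β(T(i)) v_T`, and
`t_{s_i} v_T = a v_T + (1 - a ^ 2) ^ (1/2) v_{s_i T}` where
`a = 1 / (ct (T(i+1)) - ct (T(i)))` if `β(T(i)) = β(T(i+1))` and `a = 0` otherwise, and where
`v_{s_i T}` is read as `0` if `s_i T` is not standard. -/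
inductive YoungRel (lam : RPartition r n) :
    (SYT lam →₀ MonoidAlgebra F (ReflGroup r n)) → Prop
  | zeta (T : SYT lam) (i : Fin n) :
      YoungRel lam (Finsupp.single T (MonoidAlgebra.of F _ (ReflGroup.diagElt i 1)) -
        zetaPow F r (T.beta i) • Finsupp.single T 1)
  | swap (T : SYT lam) (i j : Fin n) (h : (i : ℕ) + 1 = j) :
      YoungRel lam
        (Finsupp.single T (MonoidAlgebra.of F _ (ReflGroup.permElt (Equiv.swap i j))) -
          (algebraMap ℂ F ((T.diagCoeff i j : ℝ) : ℂ) • Finsupp.single T 1 +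
            algebraMap ℂ F ((Real.sqrt (1 - T.diagCoeff i j ^ 2) : ℝ) : ℂ) •
              T.swapSymbol (MonoidAlgebra F (ReflGroup r n)) i j))

/-- The irreducible `F G(r,1,n)`-module `S^λ`, generated by vectors `v_T` (`T` a standard tableau on
`λ`) on which `G(r,1,n)` acts by Young's orthonormal form. -/
abbrev SpechtMod (lam : RPartition r n) : Type _ :=
  (SYT lam →₀ MonoidAlgebra F (ReflGroup r n)) ⧸
    Submodule.span (MonoidAlgebra F (ReflGroup r n)) {u | YoungRel F lam u}

/-- The basis vector `v_T` of `S^λ`. -/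
def SpechtMod.v {lam : RPartition r n} (T : SYT lam) : SpechtMod F lam :=
  Submodule.Quotient.mk (Finsupp.single T 1)

variable {F}

/-- The relations `h t_w ⊗ v = h ⊗ w v` and `h y_i ⊗ v = 0` of the induced module. -/
inductive VermaRel (P : ChParams F r) (lam : RPartition r n) :
    (Cherednik P n ⊗[F] SpechtMod F lam) → Prop
  | t (h : Cherednik P n) (w : ReflGroup r n) (v : SpechtMod F lam) :
      VermaRel P lam ((h * Cherednik.t w) ⊗ₜ[F] v - h ⊗ₜ[F] (MonoidAlgebra.of F _ w • v))
  | y (h : Cherednik P n) (i : Fin n) (v : SpechtMod F lam) :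
      VermaRel P lam ((h * Cherednik.y i) ⊗ₜ[F] v)

/-- The Verma module `M(λ)`: the `ℍ`-module induced from `S^λ`, on which all `y_i` act by `0`. -/
abbrev Verma (P : ChParams F r) (lam : RPartition r n) : Type _ :=
  (Cherednik P n ⊗[F] SpechtMod F lam) ⧸
    Submodule.span (Cherednik P n) {u | VermaRel P lam u}

/-- The vector `v_T` in `M(λ)`. -/
def Verma.v (P : ChParams F r) {lam : RPartition r n} (T : SYT lam) : Verma P lam :=
  Submodule.Quotient.mk ((1 : Cherednik P n) ⊗ₜ[F] SpechtMod.v F T)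

/-- The graded piece `M(λ)_i`: the span of the `x ^ μ v_T` with `|μ| = i`. -/
def Verma.deg (P : ChParams F r) (lam : RPartition r n) (i : ℕ) : Submodule F (Verma P lam) :=
  Submodule.span F {m | ∃ (μ : Fin n → ℕ) (T : SYT lam), ∑ j, μ j = i ∧
    m = (Cherednik.xMon μ : Cherednik P n) • Verma.v P T}

/-- The head `L(λ) = M(λ) / rad M(λ)`. -/
abbrev VermaHead (P : ChParams F r) (lam : RPartition r n) : Type _ :=
  Verma P lam ⧸ Module.jacobson (Cherednik P n) (Verma P lam)

/-- The quotient map `M(λ) → L(λ)`. -/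
def VermaHead.mk (P : ChParams F r) (lam : RPartition r n) :
    Verma P lam →ₗ[Cherednik P n] VermaHead P lam :=
  Submodule.mkQ _

/-- The graded piece `L(λ)_i`. -/
def VermaHead.deg (P : ChParams F r) (lam : RPartition r n) (i : ℕ) :
    Submodule F (VermaHead P lam) :=
  (Verma.deg P lam i).map ((VermaHead.mk P lam).restrictScalars F)

end Modules

/-! ### Twists, eigenspaces, projections -/

/-- The twist `M^σ` of a module `M` by an algebra endomorphism `σ`: the same space, on which `a`
acts as `σ a`. -/
def TwistMod {R A : Type*} [CommRing R] [Ring A] [Algebra R A] (_σ : A →ₐ[R] A) (M : Type*) :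
    Type _ := M

instance {R A : Type*} [CommRing R] [Ring A] [Algebra R A] (σ : A →ₐ[R] A) (M : Type*)
    [AddCommGroup M] : AddCommGroup (TwistMod σ M) := inferInstanceAs (AddCommGroup M)

instance {R A : Type*} [CommRing R] [Ring A] [Algebra R A] (σ : A →ₐ[R] A) (M : Type*)
    [AddCommGroup M] [Module A M] : Module A (TwistMod σ M) :=
  Module.compHom M (σ : A →+* A)

/-- The smallest positive integer `k` such that `M(λ)^{α^k} ≅ M(λ)` as `ℍ`-modules. -/
def twistPeriod {F : Type*} [Field F] [Algebra ℂ F] {r : ℕ} [NeZero r] {n : ℕ}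
    (P : ChParams F r) (p : ℕ) (hd : ∀ i : ZMod r, P.d (i + ((r / p : ℕ) : ZMod r)) = P.d i)
    (lam : RPartition r n) : ℕ :=
  sInf {k : ℕ | 0 < k ∧ Nonempty
    (TwistMod (Cherednik.alpha P n p hd ^ k) (Verma P lam) ≃ₗ[Cherednik P n] Verma P lam)}

/-- The eigenspace of an `A`-linear endomorphism for a scalar `c` of the base field. -/
def eigenSub {R A M : Type*} [CommRing R] [Ring A] [Algebra R A] [AddCommGroup M] [Module R M]
    [Module A M] [IsScalarTower R A M] (C : M →ₗ[A] M) (c : R) : Submodule A M where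
  carrier := {m | C m = c • m}
  add_mem' {a b} ha hb := by
    simp only [Set.mem_ofPred_eq] at *
    rw [map_add, ha, hb, smul_add]
  zero_mem' := by simp
  smul_mem' a m hm := by
    simp only [Set.mem_ofPred_eq] at *
    rw [map_smul, hm, ← algebraMap_smul A c m, ← algebraMap_smul A c (a • m), smul_smul, smul_smul,
      Algebra.commutes]

/-- The projection onto the `q`-th summand of an internal direct sum. -/
def summandProj {A M ι : Type*} [Ring A] [AddCommGroup M] [Module A M] [DecidableEq ι]
    {N : ι → Submodule A M} (hN : DirectSum.IsInternal N) (q : ι) : M →ₗ[A] N q :=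
  DirectSum.component A ι (fun q => N q) q ∘ₗ
    (LinearEquiv.ofBijective (DirectSum.coeLinearMap N) hN).symm.toLinearMap

section Clifford

variable {F : Type*} [Field F] [Algebra ℂ F] {r : ℕ} [NeZero r] {n : ℕ}
  (P : ChParams F r) (p : ℕ) (hd : ∀ i : ZMod r, P.d (i + ((r / p : ℕ) : ZMod r)) = P.d i)
  (lam : RPartition r n)

/-- The exponent `k r / p`, modulo `r`. -/
def twistShift : ZMod r := ((twistPeriod P p hd lam * (r / p) : ℕ) : ZMod r)

variable {P p hd lam}

/-- The space `M(λ,q)`: the `ζ ^ (q k r / p)`-eigenspace of an endomorphism `C` of `M(λ)`. -/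
def vermaPart (C : Verma P lam →ₗ[Cherednik.fixedAlg P n p hd] Verma P lam) (q : ℤ) :
    Submodule (Cherednik.fixedAlg P n p hd) (Verma P lam) :=
  eigenSub C (zetaPow F r ((q : ZMod r) * twistShift P p hd lam))

/-- The space `L(λ,q)`: the `ζ ^ (q k r / p)`-eigenspace of an endomorphism `C` of `L(λ)`. -/
def headPart (C : VermaHead P lam →ₗ[Cherednik.fixedAlg P n p hd] VermaHead P lam) (q : ℤ) :
    Submodule (Cherednik.fixedAlg P n p hd) (VermaHead P lam) :=
  eigenSub C (zetaPow F r ((q : ZMod r) * twistShift P p hd lam))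

/-- The graded piece `L(λ,q)_i`. -/
def headPartDeg (C : VermaHead P lam →ₗ[Cherednik.fixedAlg P n p hd] VermaHead P lam) (q : ℤ)
    (i : ℕ) : Submodule F (VermaHead P lam) :=
  (headPart C q).restrictScalars F ⊓ VermaHead.deg P lam i

variable (P p hd lam)

/-- The radical of the `ℍ`-module `M(λ)`, as an `ℍ_p`-submodule. -/
def vermaRad : Submodule (Cherednik.fixedAlg P n p hd) (Verma P lam) :=
  (Module.jacobson (Cherednik P n) (Verma P lam)).restrictScalars (Cherednik.fixedAlg P n p hd)

end Clifford

end

/-! Everything rests on an explicit basis of `M(λ)`. Young's orthonormal form satisfies the Coxeter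
relations and so defines a representation of `G(r,1,n)`. Dunkl operators make `ℍ` act on `F[x]`
tensored with it, and there the vectors `x^μ v_T` become a tensor product basis. Hence they are a
basis of `M(λ)` (`Verma.linearIndependent_monomials`), `M(λ)` is graded, and rotation of tableaux
defines a linear map. Maps out of `M(λ)` come from families of vectors that satisfy Young's
relations and are killed by all `y_i` (`Verma.exists_lift`).

The automorphism `α` multiplies `t_{ζ_i}` by `ζ^{r/p}`, so a twist by `α^k` has the effect of moving
every component label by `kr/p`. If `λ` is fixed by that rotation, rotating tableaux is semilinear
for a power of `α` (`Verma.rotEquiv_smul`); this gives an isomorphism with the twist, and it is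
linear over `ℍ_p`. Conversely, an isomorphism with the twist sends some `v_T` to a vector with
nonzero degree zero part. That part is a simultaneous eigenvector of the `t_{ζ_i}` and the
Jucys-Murphy elements, with the weights of `T` shifted by `kr/p`. Weights determine a tableau and
its shape (`IsSYT.eq_of_content`), so `λ` is fixed by the rotation. Thus `k` is the combinatorial
period, the automorphism `C^{kr/p}` satisfies `C^N = 1` for `N = p/k`, and averaging over its powers
yields the decompositions into eigenspaces.

For the radicals, `ℍ` is generated by `ℍ_p` and `t = t_{ζ_1}`, which normalizes `ℍ_p` and satisfies
`t^r = 1` with `r` invertible. Clifford theory together with Maschke's averaging shows that `M(λ)`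
has the same radical over both algebras (`CyclicExtension.jacobson_eq`), and radicals are compatible
with direct summands. Since `t` commutes with `C^{kr/p}` only up to a root of unity, it carries each
eigenspace onto the next one, so their graded dimensions agree. The grading descends to `L(λ)` for
every `κ`, because the radical is stable under rescaling the degrees (`Verma.degProj_mem_jacobson`).

For irreducibility, the Euler element lies in `ℍ_p` and separates degrees when `κ ≠ 0`, so
submodules of `M(λ,q)` are homogeneous. One with a nonzero vector of degree zero contains some
nonzero `π_q(v_T)`: the weights available in `ℍ_p` separate tableaux up to rotation, and rotated
tableaux have proportional images under `π_q`. Adjacent exchanges then produce all the `π_q(v_U)`,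
hence all of `M(λ,q)` (`eq_vermaPart_of_mem_deg_zero`). Proper submodules therefore vanish in degree
zero, and there is a greatest one. -/

noncomputable section

/-! ### The Coxeter presentation of the symmetric group -/

section CoxeterPresentation

variable {M : Type*} [Monoid M]

/-- The product `s (p-1) * ⋯ * s 1 * s 0`. -/
def descProd (s : ℕ → M) : ℕ → M
  | 0 => 1
  | p + 1 => s p * descProd s p

theorem descProd_comm_of_lt (s : ℕ → M) {N : ℕ}
    (hcomm : ∀ i j, i + 1 < j → j < N → s i * s j = s j * s i) {p i : ℕ} (hpi : p < i) (hi : i < N) :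
    s i * descProd s p = descProd s p * s i := by
  induction p with
  | zero => simp [descProd]
  | succ p ih =>
    rw [descProd, ← mul_assoc, ← hcomm p i (by omega) hi, mul_assoc, ih (by omega), mul_assoc]

/-- The factor `s i` commutes past the left end of the product until it meets `s (i + 1) * s i`. The
braid relation turns it there into `s (i + 1)`, which commutes with all remaining factors. -/
theorem descProd_shift (s : ℕ → M) {N : ℕ}
    (hcomm : ∀ i j, i + 1 < j → j < N → s i * s j = s j * s i)
    (hbraid : ∀ i, i + 1 < N → s i * s (i + 1) * s i = s (i + 1) * s i * s (i + 1))
    {p i : ℕ} (hpi : i + 1 < p) (hp : p ≤ N) :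
    s i * descProd s p = descProd s p * s (i + 1) := by
  induction p with
  | zero => omega
  | succ p ih =>
    rcases Nat.lt_or_ge (i + 1) p with h | h
    · rw [descProd, ← mul_assoc, hcomm i p h (by omega), mul_assoc, ih h (by omega), mul_assoc]
    · obtain rfl : p = i + 1 := by omega
      have h1 : s (i + 1) * descProd s i = descProd s i * s (i + 1) :=
        descProd_comm_of_lt s hcomm (by omega) (by omega)
      rw [descProd, descProd, ← mul_assoc, ← mul_assoc, hbraid i (by omega), mul_assoc, h1]
      simp only [mul_assoc]

/-- The adjacent transposition `(i, i+1)` of `Fin n`, or the identity if `i + 1 ≥ n`. -/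
def adjSwap (n i : ℕ) : Equiv.Perm (Fin n) :=
  if h : i + 1 < n then Equiv.swap ⟨i, by omega⟩ ⟨i + 1, h⟩ else 1

theorem adjSwap_of_lt {n i : ℕ} (h : i + 1 < n) :
    adjSwap n i = Equiv.swap ⟨i, by omega⟩ ⟨i + 1, h⟩ := dif_pos h

theorem adjSwap_sq (n i : ℕ) : adjSwap n i * adjSwap n i = 1 := by
  unfold adjSwap; split_ifs <;> simp

theorem adjSwap_inv (n i : ℕ) : (adjSwap n i)⁻¹ = adjSwap n i :=
  inv_eq_of_mul_eq_one_left (adjSwap_sq n i)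

theorem adjSwap_apply_val (n i : ℕ) (h : i + 1 < n) (a : Fin n) :
    (adjSwap n i a : ℕ) = if (a : ℕ) = i then i + 1 else if (a : ℕ) = i + 1 then i else a := by
  rw [adjSwap_of_lt h, Equiv.swap_apply_def]
  simp only [Fin.ext_iff]
  split_ifs <;> simp_all

theorem adjSwap_comm (n i j : ℕ) (h : i + 1 < j) (hj : j + 1 < n) :
    adjSwap n i * adjSwap n j = adjSwap n j * adjSwap n i := by
  ext a
  simp only [Equiv.Perm.coe_mul, Function.comp_apply, adjSwap_apply_val n i (by omega),
    adjSwap_apply_val n j hj]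
  split_ifs <;> omega

theorem adjSwap_braid (n i : ℕ) (h : i + 2 < n) :
    adjSwap n i * adjSwap n (i + 1) * adjSwap n i =
      adjSwap n (i + 1) * adjSwap n i * adjSwap n (i + 1) := by
  ext a
  simp only [Equiv.Perm.coe_mul, Function.comp_apply, adjSwap_apply_val n i (by omega),
    adjSwap_apply_val n (i + 1) h]
  split_ifs <;> omega

theorem adjSwap_closure (n : ℕ) : Submonoid.closure (Set.range (adjSwap n)) = ⊤ := by
  rcases n with _ | n
  · exact Subsingleton.elim _ _
  · rw [eq_top_iff, ← Equiv.Perm.mclosure_swap_castSucc_succ n]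
    apply Submonoid.closure_mono
    rintro _ ⟨i, rfl⟩
    exact ⟨i, adjSwap_of_lt (by simp)⟩

/-- Induction on permutations by left multiplication with adjacent transpositions. -/
theorem adjSwap_induction {n : ℕ} {Q : Equiv.Perm (Fin n) → Prop} (one : Q 1)
    (mul : ∀ i, i + 1 < n → ∀ σ, Q σ → Q (adjSwap n i * σ)) (σ : Equiv.Perm (Fin n)) : Q σ := by
  have : σ ∈ Submonoid.closure (Set.range (adjSwap n)) := by rw [adjSwap_closure]; trivial
  induction this using Submonoid.closure_induction_left with
  | one => exact one
  | mul_left x hx y _ ih =>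
    obtain ⟨i, rfl⟩ := hx
    by_cases h : i + 1 < n
    · exact mul i h _ ih
    · simpa [adjSwap, h] using ih

/-- The embedding of permutations of `Fin n` as permutations of `Fin (n+1)` fixing `0`. -/
def permSucc (n : ℕ) : Equiv.Perm (Fin n) →* Equiv.Perm (Fin (n + 1)) where
  toFun τ := Equiv.Perm.decomposeFin.symm (0, τ)
  map_one' := by simp; rfl
  map_mul' a b := by
    ext i
    refine Fin.cases ?_ (fun i => ?_) i <;> simp

theorem permSucc_zero (n : ℕ) (τ : Equiv.Perm (Fin n)) : permSucc n τ 0 = 0 := by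
  simp [permSucc]

theorem permSucc_succ (n : ℕ) (τ : Equiv.Perm (Fin n)) (i : Fin n) :
    permSucc n τ i.succ = (τ i).succ := by
  simp [permSucc]

theorem permSucc_adjSwap (n i : ℕ) (h : i + 1 < n) :
    permSucc n (adjSwap n i) = adjSwap (n + 1) (i + 1) := by
  ext a
  rw [adjSwap_apply_val _ _ (by omega)]
  refine Fin.cases ?_ (fun a => ?_) a
  · simp [permSucc_zero]
  · rw [permSucc_succ, Fin.val_succ, adjSwap_apply_val _ _ h, Fin.val_succ]
    split_ifs <;> omega

theorem descProd_adjSwap_zero (n p : ℕ) (hp : p ≤ n) :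
    ((descProd (adjSwap (n + 1)) p) 0 : ℕ) = p := by
  induction p with
  | zero => simp [descProd]
  | succ p ih =>
    rw [descProd, Equiv.Perm.mul_apply, adjSwap_apply_val _ _ (by omega), ih (by omega), if_pos rfl]

/-- Coset decomposition for the stabilizer of `0`: the representative of length `p` sends `0` to
`p`, so `p` is read off from the image of `0`. Injectivity suffices since `(n + 1) * n! = (n + 1)!`.
-/
theorem bijective_descProd_mul_permSucc (n : ℕ) :
    Function.Bijective (fun q : Fin (n + 1) × Equiv.Perm (Fin n) =>
      descProd (adjSwap (n + 1)) q.1 * permSucc n q.2) := by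
  rw [Fintype.bijective_iff_injective_and_card]
  constructor
  · rintro ⟨p, τ⟩ ⟨p', τ'⟩ h
    have h0 : p = p' := by
      have := congrArg (fun σ : Equiv.Perm (Fin (n + 1)) => (σ 0 : ℕ)) h
      simp only [Equiv.Perm.mul_apply, permSucc_zero] at this
      rw [descProd_adjSwap_zero n _ (by omega), descProd_adjSwap_zero n _ (by omega)] at this
      exact Fin.ext this
    subst h0
    have h1 : permSucc n τ = permSucc n τ' := mul_left_cancel h
    refine Prod.ext rfl (Equiv.ext fun i => ?_)
    have := congrArg (fun σ => σ i.succ) h1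
    simpa [permSucc_succ] using this
  · simp [Fintype.card_perm, Nat.factorial_succ]

/-- The multiplication table of the generators on the coset representatives follows from the Coxeter
relations alone. It therefore holds both for the transpositions and for the given elements of `M`,
and the two tables can be compared. -/
theorem adjSwap_mul_descProd_cases {n : ℕ} (s : ℕ → M)
    (hsq : ∀ i, i + 1 < n + 1 → s i * s i = 1)
    (hcomm : ∀ i j, i + 1 < j → j + 1 < n + 1 → s i * s j = s j * s i)
    (hbraid : ∀ i, i + 2 < n + 1 → s i * s (i + 1) * s i = s (i + 1) * s i * s (i + 1))
    {p i : ℕ} (hp : p ≤ n) (hi : i + 1 < n + 1) :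
    (p < i → s i * descProd s p = descProd s p * s i) ∧
    (p = i → s i * descProd s p = descProd s (p + 1)) ∧
    (p = i + 1 → s i * descProd s p = descProd s i) ∧
    (i + 1 < p → s i * descProd s p = descProd s p * s (i + 1)) := by
  have hcomm' : ∀ i j, i + 1 < j → j < n → s i * s j = s j * s i := fun i j h h' =>
    hcomm i j h (by omega)
  refine ⟨fun h => descProd_comm_of_lt s hcomm' h (by omega), ?_, ?_, fun h =>
    descProd_shift s hcomm' (fun i hi => hbraid i (by omega)) h hp⟩
  · rintro rfl; rfl
  · rintro rfl; rw [descProd, ← mul_assoc, hsq i hi, one_mul]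

/-- The Coxeter presentation of the symmetric group. -/
theorem exists_perm_hom_of_coxeter (n : ℕ) (s : ℕ → M)
    (hsq : ∀ i, i + 1 < n → s i * s i = 1)
    (hcomm : ∀ i j, i + 1 < j → j + 1 < n → s i * s j = s j * s i)
    (hbraid : ∀ i, i + 2 < n → s i * s (i + 1) * s i = s (i + 1) * s i * s (i + 1)) :
    ∃ ρ : Equiv.Perm (Fin n) →* M, ∀ i, i + 1 < n → ρ (adjSwap n i) = s i := by
  induction n generalizing s with
  | zero => exact ⟨1, fun i hi => by omega⟩
  | succ n ih =>
    obtain ⟨ρ, hρ⟩ := ih (fun i => s (i + 1)) (fun i hi => hsq _ (by omega))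
      (fun i j h h' => hcomm _ _ (by omega) (by omega)) (fun i hi => hbraid _ (by omega))
    let e := Equiv.ofBijective _ (bijective_descProd_mul_permSucc n)
    -- The homomorphism is defined on the normal form, with `ρ` coming from the induction hypothesis
    -- for the shifted generators. Multiplicativity reduces to left multiplication by one generator,
    -- which is `key`.
    let f : Equiv.Perm (Fin (n + 1)) → M := fun σ => descProd s (e.symm σ).1 * ρ (e.symm σ).2
    have hf : ∀ p ≤ n, ∀ τ, f (descProd (adjSwap (n + 1)) p * permSucc n τ) =
        descProd s p * ρ τ := by
      intro p hp τ
      have : e.symm (descProd (adjSwap (n + 1)) p * permSucc n τ) = (⟨p, by omega⟩, τ) := by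
        rw [Equiv.symm_apply_eq]; rfl
      simp only [f, this]
    have key : ∀ i, i + 1 < n + 1 → ∀ σ, f (adjSwap (n + 1) i * σ) = s i * f σ := by
      intro i hi σ
      obtain ⟨⟨⟨p, hp⟩, τ⟩, rfl⟩ := e.surjective σ
      change f (_ * (descProd _ p * permSucc n τ)) = _ * f (descProd _ p * permSucc n τ)
      have hp : p ≤ n := by omega
      obtain ⟨a1, a2, a3, a4⟩ := adjSwap_mul_descProd_cases (n := n) (adjSwap (n + 1))
        (fun i _ => adjSwap_sq _ i) (fun i j h h' => adjSwap_comm _ i j h h')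
        (fun i h => adjSwap_braid _ i h) hp hi
      obtain ⟨b1, b2, b3, b4⟩ := adjSwap_mul_descProd_cases s hsq hcomm hbraid hp hi
      rw [hf p hp, ← mul_assoc, ← mul_assoc]
      rcases lt_trichotomy p i with h | h | h
      -- Here the transposition passes unchanged to the right of the representative. It fixes `0`,
      -- so it comes from the transposition of index one lower in the smaller group.
      · obtain ⟨j, rfl⟩ : ∃ j, i = j + 1 := ⟨i - 1, by omega⟩
        rw [a1 h, b1 h, mul_assoc, ← permSucc_adjSwap _ _ (by omega), ← map_mul, hf p hp, map_mul,
          hρ j (by omega), mul_assoc]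
      · rw [a2 h, b2 h, hf _ (by omega)]
      · rcases Nat.lt_or_ge (i + 1) p with h' | h'
        · rw [a4 h', b4 h', mul_assoc, ← permSucc_adjSwap _ _ (by omega), ← map_mul, hf p hp,
            map_mul, hρ i (by omega), mul_assoc]
        · have h' : p = i + 1 := by omega
          rw [a3 h', b3 h', hf _ (by omega)]
    have hf1 : f 1 = 1 := by
      have := hf 0 (by omega) 1
      simpa [descProd] using this
    refine ⟨⟨⟨f, hf1⟩, ?_⟩, ?_⟩
    · intro σ τ
      change f (σ * τ) = f σ * f τ
      induction σ using adjSwap_induction with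
      | one => simp [hf1]
      | mul i hi σ ihσ => rw [mul_assoc, key i hi, ihσ, key i hi, ← mul_assoc (s i)]
    · intro i hi
      change f _ = _
      have := key i hi 1
      simpa [hf1] using this

end CoxeterPresentation

/-! ### Combinatorics of standard tableaux -/

section Boxes

variable {r : ℕ}

/-- The content of a box. -/
def boxCt (b : ZMod r × ℕ × ℕ) : ℤ := (b.2.2 : ℤ) - (b.2.1 : ℤ)

/-- The diagonal coefficient of Young's orthonormal form for a pair of boxes. -/
def boxCoeff (b b' : ZMod r × ℕ × ℕ) : ℝ :=
  if b.1 = b'.1 then 1 / ((boxCt b' : ℝ) - (boxCt b : ℝ)) else 0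

theorem boxCoeff_symm (b b' : ZMod r × ℕ × ℕ) : boxCoeff b' b = -boxCoeff b b' := by
  unfold boxCoeff
  by_cases h : b.1 = b'.1
  · rw [if_pos h, if_pos h.symm, ← neg_sub, one_div, one_div, inv_neg]
  · rw [if_neg h, if_neg (Ne.symm h), neg_zero]

theorem boxCoeff_sq_le_one (b b' : ZMod r × ℕ × ℕ) : boxCoeff b b' ^ 2 ≤ 1 := by
  unfold boxCoeff
  split_ifs
  · rw [one_div, inv_pow]
    -- Equal contents are not excluded; the quotient is then `1 / 0 = 0`.
    by_cases h : boxCt b' - boxCt b = 0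
    · have : ((boxCt b' : ℝ) - boxCt b) = 0 := by exact_mod_cast h
      simp [this]
    · apply inv_le_one_of_one_le₀
      have : (1 : ℤ) ≤ (boxCt b' - boxCt b) ^ 2 := by
        have := sq_pos_of_ne_zero h
        omega
      exact_mod_cast this
  · norm_num

/-- For three boxes in one component this is the partial fraction identity `(1/u + 1/v) / (u + v) =
1/(uv)` for successive content differences; otherwise both sides vanish. It is the arithmetic core
of the braid relation. -/
theorem boxCoeff_braid {b₀ b₁ b₂ : ZMod r × ℕ × ℕ}
    (h01 : b₀.1 = b₁.1 → boxCt b₀ ≠ boxCt b₁) (h12 : b₁.1 = b₂.1 → boxCt b₁ ≠ boxCt b₂)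
    (h02 : b₀.1 = b₂.1 → boxCt b₀ ≠ boxCt b₂) :
    boxCoeff b₀ b₂ * (boxCoeff b₀ b₁ + boxCoeff b₁ b₂) = boxCoeff b₀ b₁ * boxCoeff b₁ b₂ := by
  unfold boxCoeff
  by_cases e01 : b₀.1 = b₁.1
  · by_cases e12 : b₁.1 = b₂.1
    · have e02 := e01.trans e12
      have g01 : ((boxCt b₁ : ℝ) - boxCt b₀) ≠ 0 := by
        rw [sub_ne_zero]; exact_mod_cast (h01 e01).symm
      have g12 : ((boxCt b₂ : ℝ) - boxCt b₁) ≠ 0 := by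
        rw [sub_ne_zero]; exact_mod_cast (h12 e12).symm
      have g02 : ((boxCt b₂ : ℝ) - boxCt b₀) ≠ 0 := by
        rw [sub_ne_zero]; exact_mod_cast (h02 e02).symm
      rw [if_pos e01, if_pos e12, if_pos e02]
      field_simp
      ring
    · have e02 : ¬ b₀.1 = b₂.1 := fun h => e12 (e01.symm.trans h)
      simp [e12, e02]
  · by_cases e12 : b₁.1 = b₂.1
    · have e02 : ¬ b₀.1 = b₂.1 := fun h => e01 (h.trans e12.symm)
      simp [e01, e02]
    · simp [e01, e12]

end Boxes

/-! ### Contents of standard tableaux and exchanges of adjacent entries -/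

namespace IsSYT

variable {r : ℕ} [NeZero r] {n : ℕ} {lam lam' : RPartition r n} {T T' : Fin n → ZMod r × ℕ × ℕ}

theorem mem (h : IsSYT lam T) (i : Fin n) : (T i).2 ∈ lam.part (T i).1 :=
  h.bij.mapsTo (Set.mem_univ i)

theorem injective (h : IsSYT lam T) : Function.Injective T := fun _ _ e =>
  h.bij.injOn (Set.mem_univ _) (Set.mem_univ _) e

theorem exists_eq (h : IsSYT lam T) {b : ZMod r × ℕ × ℕ} (hb : b.2 ∈ lam.part b.1) :
    ∃ i, T i = b := by
  obtain ⟨i, _, hi⟩ := h.bij.surjOn hb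
  exact ⟨i, hi⟩

theorem le_of_le (h : IsSYT lam T) {i j : Fin n} (h1 : (T i).1 = (T j).1)
    (h2 : (T i).2.1 ≤ (T j).2.1) (h3 : (T i).2.2 ≤ (T j).2.2) : i ≤ j := by
  -- The corner box in the row of `i` and the column of `j` belongs to the diagram. Its entry `k` is
  -- compared with `i` along the row and with `j` down the column.
  have hm : ((T i).2.1, (T j).2.2) ∈ lam.part (T j).1 :=
    YoungDiagram.up_left_mem _ h2 le_rfl (h.mem j)
  obtain ⟨k, hk⟩ := h.exists_eq (b := ((T j).1, (T i).2.1, (T j).2.2)) hm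
  have hik : i ≤ k := by
    rcases h3.lt_or_eq with h3 | h3
    · exact (h.row_lt i k (by rw [hk, h1]) (by rw [hk]) (by rw [hk]; exact h3)).le
    · exact (h.injective (by rw [hk, ← h1, ← h3])).le
  have hkj : k ≤ j := by
    rcases h2.lt_or_eq with h2 | h2
    · exact (h.col_lt k j (by rw [hk]) (by rw [hk]) (by rw [hk]; exact h2)).le
    · exact (h.injective (by rw [hk, h2])).le
  exact hik.trans hkj

theorem exists_between (h : IsSYT lam T) {i j : Fin n} (h1 : (T i).1 = (T j).1) {a b : ℕ}
    (ha : (T i).2.1 ≤ a) (ha' : a ≤ (T j).2.1) (hb : (T i).2.2 ≤ b) (hb' : b ≤ (T j).2.2) :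
    ∃ k, T k = ((T i).1, a, b) ∧ i ≤ k ∧ k ≤ j := by
  have hm : (a, b) ∈ lam.part (T i).1 := by
    rw [h1]; exact YoungDiagram.up_left_mem _ ha' hb' (h.mem j)
  obtain ⟨k, hk⟩ := h.exists_eq (b := ((T i).1, a, b)) hm
  exact ⟨k, hk, h.le_of_le (by rw [hk]) (by rw [hk]; exact ha) (by rw [hk]; exact hb),
    h.le_of_le (by rw [hk, h1]) (by rw [hk]; exact ha') (by rw [hk]; exact hb')⟩

/-- Two boxes on one diagonal are strictly comparable, so the box to the right of the first and the
box below it both lie in the diagram. Their two distinct entries lie strictly between `i` and `j`.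
-/
theorem add_three_le_of_content_eq (h : IsSYT lam T) {i j : Fin n} (hij : (i : ℕ) < j)
    (h1 : (T i).1 = (T j).1) (hc : boxCt (T i) = boxCt (T j)) : (i : ℕ) + 3 ≤ j := by
  have hne : T i ≠ T j := fun e => by
    have := h.injective e
    omega
  unfold boxCt at hc
  have hlt : (T i).2.1 < (T j).2.1 ∧ (T i).2.2 < (T j).2.2 := by
    by_contra hcon
    have hle : (j : ℕ) ≤ i := by
      apply h.le_of_le h1.symm <;> omega
    omega
  obtain ⟨k, hk, ik, kj⟩ := h.exists_between h1 (a := (T i).2.1) (b := (T i).2.2 + 1) le_rfl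
    (by omega) (by omega) (by omega)
  obtain ⟨l, hl, il, lj⟩ := h.exists_between h1 (a := (T i).2.1 + 1) (b := (T i).2.2) (by omega)
    (by omega) le_rfl (by omega)
  have e1 : i ≠ k := by
    rintro rfl
    have := congrArg (fun b => b.2.2) hk
    simp at this
  have e2 : i ≠ l := by
    rintro rfl
    have := congrArg (fun b => b.2.1) hl
    simp at this
  have e3 : k ≠ l := by
    rintro rfl
    have := congrArg (fun b => b.2.1) (hk.symm.trans hl)
    simp at this
  have e4 : k ≠ j := by
    rintro rfl
    have := congrArg (fun b => b.2.1) hk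
    simp only at this
    omega
  have e5 : l ≠ j := by
    rintro rfl
    have := congrArg (fun b => b.2.2) hl
    simp only at this
    omega
  simp only [ne_eq, Fin.ext_iff, Fin.le_def] at *
  omega

/-- Young's form and its braid relation involve only entries at distance at most two, so all
denominators that occur there are nonzero. -/
theorem content_ne (h : IsSYT lam T) {i j : Fin n} (hij : (i : ℕ) < j) (hj : (j : ℕ) < i + 3)
    (h1 : (T i).1 = (T j).1) : boxCt (T i) ≠ boxCt (T j) := fun hc => by
  have := h.add_three_le_of_content_eq hij h1 hc
  omega

/-- The exchange reverses the order of `i` and `i + 1` only. It can spoil a row or column condition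
only if their boxes lie in one row or column, and they are then neighbours because a box between
them would need an entry strictly between `i` and `i + 1`. -/
theorem swap_isSYT_or (h : IsSYT lam T) {i : ℕ} (hi : i + 1 < n) :
    IsSYT lam (fun a => T (adjSwap n i a)) ∨
    ((T ⟨i, by omega⟩).1 = (T ⟨i + 1, hi⟩).1 ∧
      ((T ⟨i, by omega⟩).2.1 = (T ⟨i + 1, hi⟩).2.1 ∧
        (T ⟨i + 1, hi⟩).2.2 = (T ⟨i, by omega⟩).2.2 + 1 ∨
      (T ⟨i, by omega⟩).2.2 = (T ⟨i + 1, hi⟩).2.2 ∧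
        (T ⟨i + 1, hi⟩).2.1 = (T ⟨i, by omega⟩).2.1 + 1)) := by
  have key : ∀ a b : Fin n, adjSwap n i a < adjSwap n i b → b ≤ a →
      adjSwap n i a = ⟨i, by omega⟩ ∧ adjSwap n i b = ⟨i + 1, hi⟩ := by
    intro a b hab hba
    simp only [Fin.lt_def, Fin.le_def, adjSwap_apply_val n i hi, Fin.ext_iff] at *
    split_ifs at * <;> omega
  by_contra hcon
  rw [not_or] at hcon
  obtain ⟨hns, hna⟩ := hcon
  apply hns
  refine ⟨?_, ?_, ?_⟩
  · exact h.bij.comp (Set.bijOn_univ.mpr (adjSwap n i).bijective)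
  · intro a b h1 h2 h3
    by_contra hab
    obtain ⟨ea, eb⟩ := key a b (h.row_lt _ _ h1 h2 h3) (not_lt.mp hab)
    rw [ea, eb] at h1 h2 h3
    refine hna ⟨h1, Or.inl ⟨h2, ?_⟩⟩
    by_contra hne
    obtain ⟨k, hk, ik, kj⟩ := h.exists_between h1 (a := (T ⟨i, by omega⟩).2.1)
      (b := (T ⟨i, by omega⟩).2.2 + 1) le_rfl (by omega) (by omega) (by omega)
    have : k = ⟨i, by omega⟩ ∨ k = ⟨i + 1, hi⟩ := by
      simp only [Fin.le_def, Fin.ext_iff] at *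
      omega
    rcases this with e | e
    · have := congrArg (fun b => b.2.2) hk
      simp [e] at this
    · have := congrArg (fun b => b.2.2) hk
      rw [e] at this
      exact hne this
  · intro a b h1 h2 h3
    by_contra hab
    obtain ⟨ea, eb⟩ := key a b (h.col_lt _ _ h1 h2 h3) (not_lt.mp hab)
    rw [ea, eb] at h1 h2 h3
    refine hna ⟨h1, Or.inr ⟨h2, ?_⟩⟩
    by_contra hne
    obtain ⟨k, hk, ik, kj⟩ := h.exists_between h1 (a := (T ⟨i, by omega⟩).2.1 + 1)
      (b := (T ⟨i, by omega⟩).2.2) (by omega) (by omega) (by omega) (by omega)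
    have : k = ⟨i, by omega⟩ ∨ k = ⟨i + 1, hi⟩ := by
      simp only [Fin.le_def, Fin.ext_iff] at *
      omega
    rcases this with e | e
    · have := congrArg (fun b => b.2.1) hk
      simp [e] at this
    · have := congrArg (fun b => b.2.1) hk
      rw [e] at this
      exact hne this

theorem boxCoeff_sq_eq_one_of_not_swap (h : IsSYT lam T) {i : ℕ} (hi : i + 1 < n)
    (hs : ¬ IsSYT lam (fun a => T (adjSwap n i a))) :
    boxCoeff (T ⟨i, by omega⟩) (T ⟨i + 1, hi⟩) ^ 2 = 1 := by
  obtain ⟨h1, h2⟩ := (h.swap_isSYT_or hi).resolve_left hs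
  rw [boxCoeff, if_pos h1]
  rcases h2 with ⟨h2, h3⟩ | ⟨h2, h3⟩ <;> simp [boxCt, h2, h3]

/-- If both fillings are standard, neither box is weakly north-west of the other. One box then has a
larger row and a smaller column, so the contents differ by at least two. -/
theorem content_sub_sq_ne_one (h : IsSYT lam T) {i : ℕ} (hi : i + 1 < n)
    (hs : IsSYT lam (fun a => T (adjSwap n i a)))
    (h1 : (T ⟨i, by omega⟩).1 = (T ⟨i + 1, hi⟩).1) :
    (boxCt (T ⟨i + 1, hi⟩) - boxCt (T ⟨i, by omega⟩)) ^ 2 ≠ 1 := by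
  intro hc
  have s0 : adjSwap n i ⟨i, by omega⟩ = ⟨i + 1, hi⟩ := by
    apply Fin.ext; rw [adjSwap_apply_val n i hi]; simp
  have s1 : adjSwap n i ⟨i + 1, hi⟩ = ⟨i, by omega⟩ := by
    apply Fin.ext; rw [adjSwap_apply_val n i hi]; simp
  set b := T ⟨i, by omega⟩ with hb
  set b' := T ⟨i + 1, hi⟩ with hb'
  have n1 : ¬ (b'.2.1 ≤ b.2.1 ∧ b'.2.2 ≤ b.2.2) := fun hh => by
    have := h.le_of_le (i := ⟨i + 1, hi⟩) (j := ⟨i, by omega⟩) h1.symm hh.1 hh.2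
    simp [Fin.le_def] at this
  have n2 : ¬ (b.2.1 ≤ b'.2.1 ∧ b.2.2 ≤ b'.2.2) := fun hh => by
    have := hs.le_of_le (i := ⟨i + 1, hi⟩) (j := ⟨i, by omega⟩) (by simp only [s0, s1]; exact h1)
      (by simp only [s0, s1]; exact hh.1) (by simp only [s0, s1]; exact hh.2)
    simp [Fin.le_def] at this
  unfold boxCt at hc
  rw [pow_two, mul_self_eq_one_iff] at hc
  rcases hc with hc | hc <;> omega

theorem boxCoeff_sq_ne_one_of_swap (h : IsSYT lam T) {i : ℕ} (hi : i + 1 < n)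
    (hs : IsSYT lam (fun a => T (adjSwap n i a))) :
    boxCoeff (T ⟨i, by omega⟩) (T ⟨i + 1, hi⟩) ^ 2 ≠ 1 := by
  unfold boxCoeff
  split_ifs with h1
  · have := h.content_sub_sq_ne_one hi hs h1
    rw [one_div, inv_pow, ne_eq, inv_eq_one]
    exact_mod_cast this
  · norm_num

/-- A tableau is recovered from its weights one entry at a time. Suppose the fillings agree before
`j` and `T j` is strictly higher than `T' j` on their common diagonal. Then `T j` is a box of the
second shape and has there an entry at most `j`; a smaller entry would repeat a box of `T`, and the
entry `j` contradicts the difference in rows. -/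
theorem eq_of_content (h : IsSYT lam T) (h' : IsSYT lam' T') (hβ : ∀ i, (T i).1 = (T' i).1)
    (hc : ∀ i, boxCt (T i) = boxCt (T' i)) : T = T' := by
  have aux : ∀ {lam lam' : RPartition r n} {T T' : Fin n → ZMod r × ℕ × ℕ}, IsSYT lam T →
      IsSYT lam' T' → (∀ i, (T i).1 = (T' i).1) → (∀ i, boxCt (T i) = boxCt (T' i)) →
      ∀ j : Fin n, (∀ i < j, T i = T' i) → (T' j).2.1 ≤ (T j).2.1 := by
    intro lam lam' T T' h h' hβ hc j ih
    by_contra hlt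
    rw [not_le] at hlt
    have hcj := hc j
    unfold boxCt at hcj
    have hm : (T j).2 ∈ lam'.part (T j).1 := by
      rw [hβ j]
      exact YoungDiagram.up_left_mem (i1 := (T j).2.1) (j1 := (T j).2.2) (i2 := (T' j).2.1) (j2 := (T' j).2.2)
        _ hlt.le (by omega)
        (h'.mem j)
    obtain ⟨k, hk⟩ := h'.exists_eq hm
    have hkj : k ≤ j := h'.le_of_le (by rw [hk, hβ]) (by rw [hk]; exact hlt.le)
      (by rw [hk]; omega)
    rcases hkj.lt_or_eq with hkj | rfl
    · have := h.injective ((ih k hkj).trans hk)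
      exact hkj.ne this
    · rw [hk] at hlt
      exact lt_irrefl _ hlt
  funext j
  induction j using WellFoundedLT.induction with
  | ind j ih =>
    have a1 := aux h h' hβ hc j ih
    have a2 := aux h' h (fun i => (hβ i).symm) (fun i => (hc i).symm) j (fun i hi => (ih i hi).symm)
    have hcj := hc j
    unfold boxCt at hcj
    refine Prod.ext (hβ j) (Prod.ext ?_ ?_) <;> omega

theorem shape_eq (h : IsSYT lam T) (h' : IsSYT lam' T) : lam = lam' := by
  have : lam.part = lam'.part := by
    funext β
    apply YoungDiagram.ext
    ext c
    have h1 : c ∈ lam.part β ↔ ∃ i, T i = (β, c) :=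
      ⟨fun hc => h.exists_eq (b := (β, c)) hc, fun ⟨i, hi⟩ => by simpa [hi] using h.mem i⟩
    have h2 : c ∈ lam'.part β ↔ ∃ i, T i = (β, c) :=
      ⟨fun hc => h'.exists_eq (b := (β, c)) hc, fun ⟨i, hi⟩ => by simpa [hi] using h'.mem i⟩
    rw [YoungDiagram.mem_cells, YoungDiagram.mem_cells, h1, h2]
  cases lam; cases lam'; simp only at this; subst this; rfl

/-- The comparison permutation of two standard tableaux of the same shape. -/
theorem exists_perm (h : IsSYT lam T) (h' : IsSYT lam T') :
    ∃ f : Equiv.Perm (Fin n), ∀ i, T' (f i) = T i := by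
  choose f hf using fun i => h'.exists_eq (h.mem i)
  have hinj : Function.Injective f := fun i j hij => h.injective (by rw [← hf, ← hf, hij])
  exact ⟨Equiv.ofBijective f (Finite.injective_iff_bijective.mp hinj), hf⟩

theorem sum_eq {A : Type*} [AddCommMonoid A] (h : IsSYT lam T) (h' : IsSYT lam T')
    (g : ZMod r × ℕ × ℕ → A) : ∑ i, g (T i) = ∑ i, g (T' i) := by
  obtain ⟨f, hf⟩ := h.exists_perm h'
  rw [← Equiv.sum_comp f (fun i => g (T' i))]
  simp [hf]

end IsSYT

/-! ### Connectedness and existence of standard tableaux -/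

namespace SYT

variable {r : ℕ} [NeZero r] {n : ℕ} {lam : RPartition r n}

/-- Any two standard tableaux of the same shape are connected by adjacent transpositions through
standard tableaux. -/
theorem induction_swap {Q : SYT lam → Prop}
    (step : ∀ (T : SYT lam) (i : ℕ), i + 1 < n →
      ∀ h : IsSYT lam (fun a => T.1 (adjSwap n i a)), Q T → Q ⟨_, h⟩)
    {T U : SYT lam} (hT : Q T) : Q U := by
  -- The permutation `f` compares `T` with `U`, and the sum of `i * f i` grows whenever a descent of
  -- `f` is removed. The number `N` bounds the distance of this sum from `n ^ 3`, a value it cannot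
  -- reach for `n > 0`.
  suffices H : ∀ (N : ℕ) (T : SYT lam) (f : Equiv.Perm (Fin n)), (∀ i, U.1 (f i) = T.1 i) →
      n * (n * n) ≤ N + ∑ i : Fin n, (i : ℕ) * (f i : ℕ) → Q T → Q U by
    obtain ⟨f, hf⟩ := T.2.exists_perm U.2
    exact H (n * (n * n)) T f hf (by omega) hT
  clear hT T
  intro N
  induction N with
  | zero =>
    intro T f hf hN hT
    have hlt : ∑ i : Fin n, (i : ℕ) * (f i : ℕ) ≤ ∑ _i : Fin n, n * n :=
      Finset.sum_le_sum fun i _ => Nat.mul_le_mul i.2.le (f i).2.le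
    rcases n with _ | n
    · have : T = U := Subtype.ext (funext fun i => i.elim0)
      exact this ▸ hT
    · have hlt : ∑ i : Fin (n + 1), (i : ℕ) * (f i : ℕ) < ∑ _i : Fin (n + 1), (n + 1) * (n + 1) :=
        Finset.sum_lt_sum_of_nonempty Finset.univ_nonempty fun i _ =>
          Nat.mul_lt_mul_of_lt_of_le i.2 (f i).2.le (by omega)
      simp at hlt hN
      omega
  | succ N ih =>
    intro T f hf hN hT
    by_cases hmono : ∀ i, ∀ hi : i + 1 < n, f ⟨i, by omega⟩ < f ⟨i + 1, hi⟩
    · have hsm : StrictMono f := by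
        rcases n with _ | n
        · exact fun i => i.elim0
        · exact Fin.strictMono_iff_lt_succ.mpr fun i => hmono i (by omega)
      have hid : (f : Fin n → Fin n) = id :=
        (hsm.range_inj strictMono_id).mp (by simp [f.surjective.range_eq])
      have : T = U := Subtype.ext (funext fun i => by rw [← hf, hid]; rfl)
      exact this ▸ hT
    · push Not at hmono
      obtain ⟨i, hi, hlt⟩ := hmono
      have hlt : f ⟨i + 1, hi⟩ < f ⟨i, by omega⟩ := lt_of_le_of_ne hlt fun e => by
        have := f.injective e
        simp at this
      -- If the boxes of `i` and `i + 1` in `T` were neighbours, standardness of `U` would order `f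
      -- i` before `f (i + 1)`, contrary to the descent.
      have hs : IsSYT lam (fun a => T.1 (adjSwap n i a)) := by
        refine (T.2.swap_isSYT_or hi).resolve_right fun ⟨h1, h2⟩ => ?_
        rw [← hf, ← hf] at h1 h2
        exact absurd (U.2.le_of_le h1 (by omega) (by omega)) (not_le.mpr hlt)
      refine ih ⟨_, hs⟩ (f * adjSwap n i) (fun j => hf _) ?_ (step T i hi hs hT)
      have hre : ∑ j : Fin n, (j : ℕ) * ((f * adjSwap n i) j : ℕ) =
          ∑ j, (adjSwap n i j : ℕ) * (f j : ℕ) := by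
        rw [← Equiv.sum_comp (adjSwap n i) (fun j => (adjSwap n i j : ℕ) * (f j : ℕ))]
        refine Finset.sum_congr rfl fun j _ => ?_
        rw [← Equiv.Perm.mul_apply (adjSwap n i), adjSwap_sq]
        rfl
      have hdiff : (∑ j, ((adjSwap n i j : ℕ) : ℤ) * (f j : ℕ)) - ∑ j : Fin n, ((j : ℕ) : ℤ) * (f j : ℕ)
          = (f ⟨i, by omega⟩ : ℕ) - (f ⟨i + 1, hi⟩ : ℕ) := by
        rw [← Finset.sum_sub_distrib]
        rw [Finset.sum_congr rfl (g := fun j : Fin n => (if j = ⟨i, by omega⟩ then ((f j : ℕ) : ℤ) else 0)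
          - (if j = ⟨i + 1, hi⟩ then ((f j : ℕ) : ℤ) else 0))]
        · simp [Finset.sum_sub_distrib]
        · intro j _
          rw [adjSwap_apply_val n i hi]
          simp only [Fin.ext_iff]
          split_ifs with h1 h2 h3 <;> simp_all <;> try omega
          · push_cast; ring
          · push_cast; ring
      rw [hre]
      have hlt' : (f ⟨i + 1, hi⟩ : ℕ) < (f ⟨i, by omega⟩ : ℕ) := hlt
      zify at hN hlt' ⊢
      push_cast at hN hdiff ⊢
      linarith

/-- The boxes are numbered in the lexicographic order of component, row and column. -/
instance instNonempty : Nonempty (SYT lam) := by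
  classical
  let _ : LinearOrder (ZMod r) := LinearOrder.lift' ZMod.val (ZMod.val_injective r)
  let g : (Σ _ : ZMod r, ℕ × ℕ) → ZMod r ×ₗ ℕ ×ₗ ℕ := fun b => toLex (b.1, toLex b.2)
  have hg : Function.Injective g := by
    rintro ⟨a, b⟩ ⟨a', b'⟩ h
    simpa [g] using h
  let s : Finset (ZMod r ×ₗ ℕ ×ₗ ℕ) := (Finset.univ.sigma fun β => (lam.part β).cells).image g
  have hs : s.card = n := by
    rw [Finset.card_image_of_injective _ hg, Finset.card_sigma]
    exact lam.card_eq
  let e := s.orderIsoOfFin hs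
  let T : Fin n → ZMod r × ℕ × ℕ := fun i => ((ofLex (e i).1).1, ofLex (ofLex (e i).1).2)
  have hT : ∀ i, (e i).1 = toLex ((T i).1, toLex (T i).2) := fun i => rfl
  have hmem : ∀ b : ZMod r × ℕ × ℕ, toLex (b.1, toLex b.2) ∈ s ↔ b.2 ∈ lam.part b.1 := by
    intro b
    have : (toLex (b.1, toLex b.2) : ZMod r ×ₗ ℕ ×ₗ ℕ) = g ⟨b.1, b.2⟩ := rfl
    rw [this, hg.mem_finset_image]
    simp
  refine ⟨⟨T, ⟨⟨?_, ?_, ?_⟩, ?_, ?_⟩⟩⟩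
  · intro i _
    exact (hmem _).mp ((e i).2)
  · intro i _ j _ hij
    apply e.injective
    apply Subtype.ext
    rw [hT, hT, hij]
  · intro b hb
    obtain ⟨i, hi⟩ := e.surjective ⟨_, (hmem b).mpr hb⟩
    refine ⟨i, trivial, ?_⟩
    have := congrArg Subtype.val hi
    rw [hT] at this
    simp only [EmbeddingLike.apply_eq_iff_eq, Prod.mk.injEq] at this
    exact Prod.ext this.1 this.2
  · intro i j h1 h2 h3
    rw [← e.lt_iff_lt, ← Subtype.coe_lt_coe, hT, hT, Prod.Lex.toLex_lt_toLex]
    refine Or.inr ⟨h1, ?_⟩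
    rw [Prod.Lex.toLex_lt_toLex]
    exact Or.inr ⟨h2, h3⟩
  · intro i j h1 h2 h3
    rw [← e.lt_iff_lt, ← Subtype.coe_lt_coe, hT, hT, Prod.Lex.toLex_lt_toLex]
    refine Or.inr ⟨h1, ?_⟩
    rw [Prod.Lex.toLex_lt_toLex]
    exact Or.inl h3

instance instFinite : Finite (SYT lam) := by
  obtain ⟨T⟩ : Nonempty (SYT lam) := inferInstance
  have hfin : {b : ZMod r × ℕ × ℕ | b.2 ∈ lam.part b.1}.Finite := by
    rw [← T.2.bij.image_eq]
    exact Set.toFinite _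
  have := hfin.to_subtype
  exact Finite.of_injective (β := Fin n → {b : ZMod r × ℕ × ℕ | b.2 ∈ lam.part b.1})
    (fun U i => ⟨U.1 i, U.2.mem i⟩) fun U V h => Subtype.ext (funext fun i => by
      simpa using congrArg Subtype.val (congrFun h i))

/-- If the weights of `U` are those of `T`, with the components shifted by `m`, then the shape is
invariant under rotation by `m`, and `U` is the rotation of `T`. -/
theorem exists_rotate_eq {T U : SYT lam} {m : ZMod r} (hβ : ∀ i, U.beta i = T.beta i + m)
    (hc : ∀ i, U.ct i = T.ct i) : ∃ h : lam.rotate m = lam, U = T.rotate m h := by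
  have h1 := (T.rotate m rfl).2.eq_of_content U.2 (fun i => (hβ i).symm) (fun i => (hc i).symm)
  have h2 : lam.rotate m = lam := (T.rotate m rfl).2.shape_eq (h1 ▸ U.2)
  exact ⟨h2, Subtype.ext h1.symm⟩

end SYT

/-! ### Roots of unity and elements of the reflection group -/

section ZetaPow

variable (F : Type*) [Field F] [Algebra ℂ F] (r : ℕ) [NeZero r]

theorem zetaPow_injective : Function.Injective (zetaPow F r) := fun _ _ h =>
  ZMod.injective_stdAddChar ((algebraMap ℂ F).injective h)

theorem zetaPow_eq_one_iff {a : ZMod r} : zetaPow F r a = 1 ↔ a = 0 := by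
  rw [← zetaPow_zero F r, (zetaPow_injective F r).eq_iff]

theorem zetaPow_mul_neg (a : ZMod r) : zetaPow F r a * zetaPow F r (-a) = 1 := by
  rw [← zetaPow_add, add_neg_cancel, zetaPow_zero]

theorem zetaPow_neg_mul (a : ZMod r) : zetaPow F r (-a) * zetaPow F r a = 1 := by
  rw [← zetaPow_add, neg_add_cancel, zetaPow_zero]

theorem zetaPow_ne_zero (a : ZMod r) : zetaPow F r a ≠ 0 :=
  left_ne_zero_of_mul_eq_one (zetaPow_mul_neg F r a)

theorem zetaPow_nsmul (k : ℕ) (a : ZMod r) : zetaPow F r (k * a) = zetaPow F r a ^ k := by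
  induction k with
  | zero => simp [zetaPow_zero]
  | succ k ih => rw [Nat.cast_succ, add_mul, one_mul, zetaPow_add, ih, pow_succ]

theorem zetaPow_sum_mul (a : ZMod r) : ∑ l : ZMod r, zetaPow F r (l * a) = if a = 0 then (r : F) else 0 := by
  simp only [zetaPow]
  rw [← map_sum, AddChar.sum_mulShift a (ZMod.isPrimitive_stdAddChar r)]
  split_ifs <;> simp

end ZetaPow

/-! ### Multiplication and conjugation in `G(r,1,n)` -/

namespace ReflGroup

variable {r n : ℕ}

theorem ext' {w v : ReflGroup r n} (h : ∀ i, w.expo i = v.expo i) (h' : w.right = v.right) : w = v :=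
  SemidirectProduct.ext (funext fun i => h i) h'

@[simp] theorem expo_one (i : Fin n) : (1 : ReflGroup r n).expo i = 0 := rfl

theorem expo_mul (w v : ReflGroup r n) (i : Fin n) :
    (w * v).expo i = w.expo i + v.expo (w.right⁻¹ i) := rfl

@[simp] theorem right_diagElt (i : Fin n) (l : ZMod r) : (diagElt i l).right = 1 := rfl

@[simp] theorem right_permElt (σ : Equiv.Perm (Fin n)) : (permElt σ : ReflGroup r n).right = σ := rfl

@[simp] theorem expo_permElt (σ : Equiv.Perm (Fin n)) (i : Fin n) :
    (permElt σ : ReflGroup r n).expo i = 0 := rfl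

theorem expo_diagElt (i j : Fin n) (l : ZMod r) : (diagElt i l).expo j = if j = i then l else 0 := by
  simp only [expo, diagElt, SemidirectProduct.left_inl, Pi.mulSingle_apply]
  split_ifs <;> rfl

@[simp] theorem right_refl (i j : Fin n) (l : ZMod r) : (refl i j l).right = Equiv.swap i j := by
  simp [refl]

theorem expo_refl {i j : Fin n} (h : i ≠ j) (l : ZMod r) (k : Fin n) :
    (refl i j l).expo k = if k = i then l else if k = j then -l else 0 := by
  simp only [refl, expo_mul, expo_diagElt, right_diagElt, expo_permElt, SemidirectProduct.mul_right,
    right_permElt, one_mul, inv_one, Equiv.Perm.one_apply, add_zero, Equiv.swap_inv]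
  by_cases h1 : k = i
  · subst h1
    simp [Ne.symm h]
  · by_cases h2 : k = j
    · subst h2; simp [h1]
    · simp [h1, h2, Equiv.swap_apply_of_ne_of_ne h1 h2]

theorem refl_symm {i j : Fin n} (h : i ≠ j) (l : ZMod r) : refl j i l = refl i j (-l) := by
  refine ext' (fun k => ?_) (by simp [Equiv.swap_comm])
  rw [expo_refl h, expo_refl h.symm]
  by_cases h1 : k = i
  · subst h1; simp [h]
  · by_cases h2 : k = j
    · subst h2; simp [h1]
    · simp [h1, h2]

theorem diagElt_zero (i : Fin n) : (diagElt i 0 : ReflGroup r n) = 1 := by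
  refine ext' (fun k => ?_) rfl
  simp [expo_diagElt]

theorem diagElt_add (i : Fin n) (a b : ZMod r) :
    (diagElt i (a + b) : ReflGroup r n) = diagElt i a * diagElt i b := by
  refine ext' (fun k => ?_) (by simp)
  simp only [expo_mul, expo_diagElt, right_diagElt, inv_one, Equiv.Perm.one_apply]
  split_ifs <;> simp

theorem mul_diagElt (w : ReflGroup r n) (i : Fin n) (l : ZMod r) :
    w * diagElt i l = diagElt (w.right i) l * w := by
  refine ext' (fun k => ?_) (by simp)
  simp only [expo_mul, expo_diagElt, right_diagElt, inv_one, Equiv.Perm.one_apply,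
    Equiv.Perm.inv_eq_iff_eq]
  simp only [add_comm]

theorem mul_refl (w : ReflGroup r n) {i j : Fin n} (h : i ≠ j) (l : ZMod r) :
    w * refl i j l =
      refl (w.right i) (w.right j) (l + w.expo (w.right i) - w.expo (w.right j)) * w := by
  have h' : w.right i ≠ w.right j := fun e => h (w.right.injective e)
  refine ext' (fun k => ?_) (by simp [Equiv.mul_swap_eq_swap_mul])
  simp only [expo_mul, expo_refl h, expo_refl h', right_refl, Equiv.swap_inv,
    Equiv.Perm.inv_eq_iff_eq]
  by_cases h1 : k = w.right i
  · subst h1; simp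
    ring
  · by_cases h2 : k = w.right j
    · subst h2; simp [h'.symm]; ring
    · simp [h1, h2, Equiv.swap_apply_of_ne_of_ne h1 h2]

/-- Any `w` is a product of diagonal elements and a permutation. -/
theorem induction_left {Q : ReflGroup r n → Prop} (one : Q 1)
    (diag : ∀ i l w, Q w → Q (diagElt i l * w))
    (swap : ∀ i, i + 1 < n → ∀ w, Q w → Q (permElt (adjSwap n i) * w)) (w : ReflGroup r n) : Q w := by
  have hperm : ∀ σ, Q (permElt σ) := fun σ => by
    induction σ using adjSwap_induction with
    | one => exact one
    | mul i hi σ ih =>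
      have : (permElt (adjSwap n i * σ) : ReflGroup r n) = permElt (adjSwap n i) * permElt σ :=
        map_mul _ _ _
      rw [this]; exact swap i hi _ ih
  -- The exponents are corrected one position at a time; `s` contains the positions where `v` and
  -- `w` may still differ.
  have hdiag : ∀ (s : Finset (Fin n)) (v w : ReflGroup r n), Q v → v.right = w.right →
      (∀ i, i ∉ s → v.expo i = w.expo i) → Q w := by
    intro s
    induction s using Finset.induction_on with
    | empty =>
      intro v w hv h1 h2
      rwa [← ext' (fun i => h2 i (by simp)) h1]
    | insert j s hj ih =>
      intro v w hv h1 h2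
      refine ih (diagElt j (w.expo j - v.expo j) * v) w (diag _ _ _ hv) (by simpa using h1) ?_
      intro i hi
      rw [expo_mul, expo_diagElt]
      split_ifs with h
      · subst h; simp
      · simp [h2 i (by simp [h, hi])]
  exact hdiag Finset.univ (permElt w.right) w (hperm _) rfl (by simp)

theorem diagElt_natCast_mul (i : Fin n) (k : ℕ) (l : ZMod r) :
    (diagElt i (k * l) : ReflGroup r n) = diagElt i l ^ k := by
  induction k with
  | zero => simp [diagElt_zero]
  | succ k ih => rw [Nat.cast_succ, add_mul, one_mul, diagElt_add, ih, pow_succ]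

end ReflGroup

theorem adjSwap_apply_left {n i : ℕ} (hi : i + 1 < n) :
    adjSwap n i ⟨i, by omega⟩ = ⟨i + 1, hi⟩ := by
  apply Fin.ext; rw [adjSwap_apply_val n i hi]; simp

theorem adjSwap_apply_right {n i : ℕ} (hi : i + 1 < n) :
    adjSwap n i ⟨i + 1, hi⟩ = ⟨i, by omega⟩ := by
  apply Fin.ext; rw [adjSwap_apply_val n i hi]; simp

theorem adjSwap_adjSwap {n i : ℕ} (a : Fin n) : adjSwap n i (adjSwap n i a) = a := by
  rw [← Equiv.Perm.mul_apply, adjSwap_sq]; rfl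

/-! ### Young's orthonormal form -/

section Young

variable (F : Type*) [Field F] [Algebra ℂ F] {r : ℕ}

/-- The diagonal coefficient in `F`. -/
def boxA (b b' : ZMod r × ℕ × ℕ) : F := algebraMap ℂ F ((boxCoeff b b' : ℝ) : ℂ)

/-- The off-diagonal coefficient in `F`. -/
def boxB (b b' : ZMod r × ℕ × ℕ) : F :=
  algebraMap ℂ F ((Real.sqrt (1 - boxCoeff b b' ^ 2) : ℝ) : ℂ)

theorem boxA_symm (b b' : ZMod r × ℕ × ℕ) : boxA F b' b = -boxA F b b' := by
  simp [boxA, boxCoeff_symm b b']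

theorem boxB_symm (b b' : ZMod r × ℕ × ℕ) : boxB F b' b = boxB F b b' := by
  simp [boxB, boxCoeff_symm b b']

theorem boxB_mul_self (b b' : ZMod r × ℕ × ℕ) :
    boxB F b b' * boxB F b b' = 1 - boxA F b b' * boxA F b b' := by
  have h : Real.sqrt (1 - boxCoeff b b' ^ 2) * Real.sqrt (1 - boxCoeff b b' ^ 2) =
      1 - boxCoeff b b' * boxCoeff b b' := by
    rw [Real.mul_self_sqrt (by linarith [boxCoeff_sq_le_one b b']), pow_two]
  unfold boxA boxB
  rw [← map_mul, ← map_mul, ← Complex.ofReal_mul, h]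
  simp

theorem boxB_eq_zero_iff (b b' : ZMod r × ℕ × ℕ) : boxB F b b' = 0 ↔ boxCoeff b b' ^ 2 = 1 := by
  unfold boxB
  rw [map_eq_zero, Complex.ofReal_eq_zero, Real.sqrt_eq_zero
    (by linarith [boxCoeff_sq_le_one b b'])]
  constructor <;> intro h <;> linarith

theorem boxA_braid {b₀ b₁ b₂ : ZMod r × ℕ × ℕ}
    (h01 : b₀.1 = b₁.1 → boxCt b₀ ≠ boxCt b₁) (h12 : b₁.1 = b₂.1 → boxCt b₁ ≠ boxCt b₂)
    (h02 : b₀.1 = b₂.1 → boxCt b₀ ≠ boxCt b₂) :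
    boxA F b₀ b₂ * (boxA F b₀ b₁ + boxA F b₁ b₂) = boxA F b₀ b₁ * boxA F b₁ b₂ := by
  have := congrArg (fun x : ℝ => algebraMap ℂ F (x : ℂ)) (boxCoeff_braid h01 h12 h02)
  simpa [boxA] using this

variable [NeZero r] {n : ℕ} {lam : RPartition r n}

open Classical in
/-- The basis vector of a filling, or zero if it is not a standard tableau. -/
def youngVec (U : Fin n → ZMod r × ℕ × ℕ) : SYT lam →₀ F :=
  if h : IsSYT lam U then Finsupp.single ⟨U, h⟩ 1 else 0

omit [Algebra ℂ F] in
theorem youngVec_of_isSYT {U : Fin n → ZMod r × ℕ × ℕ} (h : IsSYT lam U) :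
    youngVec F U = Finsupp.single (⟨U, h⟩ : SYT lam) 1 := dif_pos h

omit [Algebra ℂ F] in
theorem youngVec_of_not_isSYT {U : Fin n → ZMod r × ℕ × ℕ} (h : ¬ IsSYT lam U) :
    youngVec F (lam := lam) U = 0 := dif_neg h

variable (lam)

/-- The operator of an adjacent transposition in Young's orthonormal form. -/
def youngSwap (i : ℕ) (hi : i + 1 < n) : Module.End F (SYT lam →₀ F) :=
  Finsupp.linearCombination F fun T : SYT lam =>
    boxA F (T.1 ⟨i, by omega⟩) (T.1 ⟨i + 1, hi⟩) • Finsupp.single T (1 : F) +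
      boxB F (T.1 ⟨i, by omega⟩) (T.1 ⟨i + 1, hi⟩) • youngVec F (fun a => T.1 (adjSwap n i a))

/-- The formula survives for nonstandard fillings because the off-diagonal coefficient vanishes
exactly where an exchange would cross between nonstandard and standard ones. The relations between
the operators can thus be checked formally, without distinguishing which fillings are standard. -/
theorem youngSwap_youngVec (i : ℕ) (hi : i + 1 < n) (U : Fin n → ZMod r × ℕ × ℕ) :
    youngSwap F lam i hi (youngVec F U) =
      boxA F (U ⟨i, by omega⟩) (U ⟨i + 1, hi⟩) • youngVec F U +
      boxB F (U ⟨i, by omega⟩) (U ⟨i + 1, hi⟩) • youngVec F (fun a => U (adjSwap n i a)) := by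
  by_cases h : IsSYT lam U
  · rw [youngVec_of_isSYT F h]
    exact (Finsupp.linearCombination_single F _ _).trans (one_smul _ _)
  · rw [youngVec_of_not_isSYT F h, map_zero, smul_zero, zero_add]
    by_cases h' : IsSYT lam (fun a => U (adjSwap n i a))
    · have := h'.boxCoeff_sq_eq_one_of_not_swap hi (by simpa only [adjSwap_adjSwap] using h)
      rw [← boxB_eq_zero_iff F] at this
      simp only [adjSwap_apply_left hi, adjSwap_apply_right hi] at this
      rw [boxB_symm] at this
      rw [this, zero_smul]
    · rw [youngVec_of_not_isSYT F h', smul_zero]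

omit [Algebra ℂ F] in
theorem youngEnd_ext {f g : Module.End F (SYT lam →₀ F)}
    (h : ∀ T : SYT lam, f (youngVec F T.1) = g (youngVec F T.1)) : f = g := by
  refine Finsupp.lhom_ext' fun T => LinearMap.ext_ring ?_
  have := h T
  rw [youngVec_of_isSYT F T.2] at this
  exact this

theorem youngSwap_sq (i : ℕ) (hi : i + 1 < n) :
    youngSwap F lam i hi * youngSwap F lam i hi = 1 := by
  refine youngEnd_ext F lam fun T => ?_
  rw [Module.End.mul_apply, Module.End.one_apply, youngSwap_youngVec, map_add, map_smul, map_smul,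
    youngSwap_youngVec, youngSwap_youngVec]
  simp only [adjSwap_adjSwap, adjSwap_apply_left hi, adjSwap_apply_right hi]
  set b := T.1 ⟨i, by omega⟩
  set b' := T.1 ⟨i + 1, hi⟩
  rw [boxA_symm F b b', boxB_symm F b b']
  have hB := boxB_mul_self F b b'
  match_scalars
  · linear_combination hB
  · ring

theorem youngSwap_comm (i j : ℕ) (hij : i + 1 < j) (hj : j + 1 < n) :
    youngSwap F lam i (by omega) * youngSwap F lam j hj =
      youngSwap F lam j hj * youngSwap F lam i (by omega) := by
  have hne : ∀ (k a : ℕ) (ha : a < n), k + 1 < n → a ≠ k → a ≠ k + 1 →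
      adjSwap n k ⟨a, ha⟩ = ⟨a, ha⟩ := by
    intro k a ha hk h1 h2
    apply Fin.ext; rw [adjSwap_apply_val n k hk]; simp [h1, h2]
  have hc : ∀ a, adjSwap n i (adjSwap n j a) = adjSwap n j (adjSwap n i a) := fun a => by
    rw [← Equiv.Perm.mul_apply, adjSwap_comm n i j hij hj]; rfl
  refine youngEnd_ext F lam fun T => ?_
  simp only [Module.End.mul_apply, youngSwap_youngVec, map_add, map_smul]
  rw [hne i j (by omega) (by omega) (by omega) (by omega),
    hne i (j + 1) (by omega) (by omega) (by omega) (by omega),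
    hne j i (by omega) (by omega) (by omega) (by omega),
    hne j (i + 1) (by omega) (by omega) (by omega) (by omega)]
  simp only [hc]
  module

/-- Both sides expand over the fillings obtained by permuting three entries, and coefficients are
compared. Three comparisons need `boxA_braid`, one of them also the relation `B² = 1 - A²`; the
others are identities of polynomials. -/
theorem youngSwap_braid (i : ℕ) (hi : i + 2 < n) :
    youngSwap F lam i (by omega) * youngSwap F lam (i + 1) hi * youngSwap F lam i (by omega) =
      youngSwap F lam (i + 1) hi * youngSwap F lam i (by omega) * youngSwap F lam (i + 1) hi := by
  refine youngEnd_ext F lam fun T => ?_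
  have e1 : adjSwap n i ⟨i + 2, hi⟩ = ⟨i + 2, hi⟩ := by
    apply Fin.ext; rw [adjSwap_apply_val n i (by omega)]; simp
  have e2 : adjSwap n (i + 1) ⟨i, by omega⟩ = ⟨i, by omega⟩ := by
    apply Fin.ext; rw [adjSwap_apply_val n (i + 1) (by omega)]; simp; omega
  have e3 : adjSwap n i ⟨i, by omega⟩ = ⟨i + 1, by omega⟩ := adjSwap_apply_left (by omega)
  have e4 : adjSwap n i ⟨i + 1, by omega⟩ = ⟨i, by omega⟩ := adjSwap_apply_right (by omega)
  have e5 : adjSwap n (i + 1) ⟨i + 1, by omega⟩ = ⟨i + 2, hi⟩ := adjSwap_apply_left (by omega)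
  have e6 : adjSwap n (i + 1) ⟨i + 2, hi⟩ = ⟨i + 1, by omega⟩ := adjSwap_apply_right hi
  have e7 : ∀ a, adjSwap n (i + 1) (adjSwap n i (adjSwap n (i + 1) a)) =
      adjSwap n i (adjSwap n (i + 1) (adjSwap n i a)) := fun a => by
    rw [← Equiv.Perm.mul_apply, ← Equiv.Perm.mul_apply, ← adjSwap_braid n i hi]; rfl
  simp only [Module.End.mul_apply, youngSwap_youngVec, map_add, map_smul, e1, e2, e3, e4, e5, e6,
    e7, adjSwap_adjSwap, add_assoc, one_add_one_eq_two]
  have h01 := T.2.content_ne (i := ⟨i, by omega⟩) (j := ⟨i + 1, by omega⟩) (by simp) (by simp)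
  have h12 := T.2.content_ne (i := ⟨i + 1, by omega⟩) (j := ⟨i + 2, hi⟩) (by simp) (by simp)
  have h02 := T.2.content_ne (i := ⟨i, by omega⟩) (j := ⟨i + 2, hi⟩) (by simp) (by simp)
  set b₀ := T.1 ⟨i, by omega⟩
  set b₁ := T.1 ⟨i + 1, by omega⟩
  set b₂ := T.1 ⟨i + 2, hi⟩
  have hbr := boxA_braid F h01 h12 h02
  rw [boxA_symm F b₀ b₁, boxB_symm F b₀ b₁, boxA_symm F b₁ b₂, boxB_symm F b₁ b₂]
  have hB1 := boxB_mul_self F b₀ b₁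
  have hB2 := boxB_mul_self F b₁ b₂
  generalize boxA F b₀ b₁ = a at *
  generalize boxA F b₁ b₂ = b at *
  generalize boxA F b₀ b₂ = c at *
  generalize boxB F b₀ b₁ = A at *
  generalize boxB F b₁ b₂ = B at *
  generalize boxB F b₀ b₂ = C at *
  match_scalars
  · linear_combination c * hB1 - c * hB2 - (a - b) * hbr
  · linear_combination (-A) * hbr
  · linear_combination B * hbr
  all_goals ring

theorem exists_youngPerm : ∃ ρ : Equiv.Perm (Fin n) →* Module.End F (SYT lam →₀ F),
    ∀ i (hi : i + 1 < n), ρ (adjSwap n i) = youngSwap F lam i hi := by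
  have H := exists_perm_hom_of_coxeter n
    (fun i => if hi : i + 1 < n then youngSwap F lam i hi else 1)
    (fun i hi => by simp only [dif_pos hi, youngSwap_sq])
    (fun i j h hj => by
      simp only [dif_pos hj, dif_pos (show i + 1 < n by omega), youngSwap_comm F lam i j h hj])
    (fun i hi => by
      simp only [dif_pos (show i + 1 < n by omega), dif_pos (show i + 1 + 1 < n from hi)]
      exact youngSwap_braid F lam i hi)
  obtain ⟨ρ, hρ⟩ := H
  exact ⟨ρ, fun i hi => by rw [hρ i hi, dif_pos hi]⟩

/-- The action of permutations in Young's orthonormal form. -/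
def youngPerm : Equiv.Perm (Fin n) →* Module.End F (SYT lam →₀ F) := (exists_youngPerm F lam).choose

theorem youngPerm_adjSwap (i : ℕ) (hi : i + 1 < n) :
    youngPerm F lam (adjSwap n i) = youngSwap F lam i hi := (exists_youngPerm F lam).choose_spec i hi

/-- The action of diagonal elements in Young's orthonormal form. -/
def youngDiag (a : Fin n → ZMod r) : Module.End F (SYT lam →₀ F) :=
  Finsupp.linearCombination F fun T : SYT lam =>
    zetaPow F r (∑ i, a i * (T.1 i).1) • Finsupp.single T (1 : F)

theorem youngDiag_youngVec (a : Fin n → ZMod r) (U : Fin n → ZMod r × ℕ × ℕ) :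
    youngDiag F lam a (youngVec F U) = zetaPow F r (∑ i, a i * (U i).1) • youngVec F U := by
  by_cases h : IsSYT lam U
  · rw [youngVec_of_isSYT F h]
    exact (Finsupp.linearCombination_single F _ _).trans (one_smul _ _)
  · rw [youngVec_of_not_isSYT F h, map_zero, smul_zero]

theorem youngDiag_zero : youngDiag F lam 0 = 1 := by
  refine youngEnd_ext F lam fun T => ?_
  rw [youngDiag_youngVec]
  simp [zetaPow_zero]

theorem youngDiag_add (a b : Fin n → ZMod r) :
    youngDiag F lam (a + b) = youngDiag F lam a * youngDiag F lam b := by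
  refine youngEnd_ext F lam fun T => ?_
  rw [Module.End.mul_apply, youngDiag_youngVec, youngDiag_youngVec, map_smul, youngDiag_youngVec,
    smul_smul, ← zetaPow_add]
  simp only [Pi.add_apply, add_mul, Finset.sum_add_distrib]
  rw [add_comm]

/-- It suffices to treat an adjacent transposition. If its two entries lie in the same component,
exchanging them does not affect the diagonal weight; otherwise the coefficient `boxA` is zero and
only the exchanged tableau remains. -/
theorem youngPerm_mul_youngDiag (σ : Equiv.Perm (Fin n)) (a : Fin n → ZMod r) :
    youngPerm F lam σ * youngDiag F lam a =
      youngDiag F lam (fun i => a (σ⁻¹ i)) * youngPerm F lam σ := by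
  induction σ using adjSwap_induction with
  | one => simp
  | mul i hi σ ih =>
    rw [map_mul, mul_assoc, ih, ← mul_assoc, ← mul_assoc]
    congr 1
    rw [youngPerm_adjSwap F lam i hi]
    refine youngEnd_ext F lam fun T => ?_
    simp only [Module.End.mul_apply, youngDiag_youngVec, youngSwap_youngVec, map_smul, map_add,
      mul_inv_rev, adjSwap_inv, Equiv.Perm.mul_apply]
    generalize hg : (fun j => a (σ⁻¹ j)) = g
    have hg' : ∀ j, a (σ⁻¹ j) = g j := fun j => congrFun hg j
    simp only [hg']
    have e1 : ∑ x, g (adjSwap n i x) * (T.1 (adjSwap n i x)).1 = ∑ x, g x * (T.1 x).1 :=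
      Equiv.sum_comp (adjSwap n i) (fun x => g x * (T.1 x).1)
    have e2 : (T.1 ⟨i, by omega⟩).1 = (T.1 ⟨i + 1, hi⟩).1 →
        ∑ x, g (adjSwap n i x) * (T.1 x).1 = ∑ x, g x * (T.1 x).1 := by
      intro h
      rw [← e1]
      refine Finset.sum_congr rfl fun x _ => ?_
      congr 1
      rw [adjSwap_of_lt hi]
      by_cases h1 : x = ⟨i, by omega⟩
      · rw [h1, Equiv.swap_apply_left, h]
      · by_cases h2 : x = ⟨i + 1, hi⟩
        · rw [h2, Equiv.swap_apply_right, h]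
        · rw [Equiv.swap_apply_of_ne_of_ne h1 h2]
    rw [e1]
    by_cases h : (T.1 ⟨i, by omega⟩).1 = (T.1 ⟨i + 1, hi⟩).1
    · rw [e2 h]
      module
    · have : boxA F (T.1 ⟨i, by omega⟩) (T.1 ⟨i + 1, hi⟩) = 0 := by
        simp [boxA, boxCoeff, h]
      rw [this]
      module

/-- Young's orthonormal form of the representation `S^λ`. -/
def youngRep : ReflGroup r n →* Module.End F (SYT lam →₀ F) where
  toFun w := youngDiag F lam w.expo * youngPerm F lam w.right
  map_one' := by
    rw [SemidirectProduct.one_right, map_one, mul_one]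
    exact youngDiag_zero F lam
  map_mul' w v := by
    have : (w * v).expo = w.expo + fun i => v.expo (w.right⁻¹ i) := by
      ext i; rw [ReflGroup.expo_mul]; rfl
    rw [this, youngDiag_add, SemidirectProduct.mul_right, map_mul]
    simp only [mul_assoc]
    rw [← mul_assoc (youngPerm F lam w.right) (youngDiag F lam v.expo), youngPerm_mul_youngDiag,
      mul_assoc]

theorem youngRep_diagElt (i : Fin n) (l : ZMod r) (T : SYT lam) :
    youngRep F lam (ReflGroup.diagElt i l) (Finsupp.single T 1) =
      zetaPow F r (l * T.beta i) • Finsupp.single T 1 := by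
  have := youngDiag_youngVec F lam (ReflGroup.diagElt i l).expo T.1
  rw [youngVec_of_isSYT F T.2] at this
  simp only [ReflGroup.expo_diagElt, ite_mul, zero_mul, Finset.sum_ite_eq', Finset.mem_univ,
    if_true] at this
  simp only [youngRep, MonoidHom.coe_mk, OneHom.coe_mk, ReflGroup.right_diagElt, map_one, mul_one]
  exact this

theorem youngRep_adjSwap (i : ℕ) (hi : i + 1 < n) (T : SYT lam) :
    youngRep F lam (ReflGroup.permElt (adjSwap n i)) (Finsupp.single T 1) =
      boxA F (T.1 ⟨i, by omega⟩) (T.1 ⟨i + 1, hi⟩) • Finsupp.single T 1 +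
      boxB F (T.1 ⟨i, by omega⟩) (T.1 ⟨i + 1, hi⟩) • youngVec F (fun a => T.1 (adjSwap n i a)) := by
  have := youngSwap_youngVec F lam i hi T.1
  rw [youngVec_of_isSYT F T.2] at this
  have h0 : (ReflGroup.permElt (adjSwap n i) : ReflGroup r n).expo = 0 := rfl
  simp only [youngRep, MonoidHom.coe_mk, OneHom.coe_mk, h0, youngDiag_zero, one_mul,
    ReflGroup.right_permElt, youngPerm_adjSwap F lam i hi]
  exact this

end Young

/-! ### The commutators of the `y_i` and `x_k` -/

section CommElt

variable {F : Type*} [Field F] [Algebra ℂ F] {r : ℕ} [NeZero r] {n : ℕ} (P : ChParams F r)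
  {A : Type*} [Ring A] [Algebra F A]

/-- The commutator `[y_i, x_k]`, as an element of the group algebra. -/
def commElt (t : ReflGroup r n → A) (i k : Fin n) : A :=
  if i = k then
    algebraMap F A P.kappa - dTerm P t i -
      P.c0 • ∑ j ∈ Finset.univ.erase i, ∑ l : ZMod r, t (ReflGroup.refl i j l)
  else P.c0 • ∑ l : ZMod r, zetaPow F r (-l) • t (ReflGroup.refl i k l)

variable (t : ReflGroup r n →* A)

theorem mul_dTerm (w : ReflGroup r n) (i : Fin n) :
    t w * dTerm P t i = dTerm P t (w.right i) * t w := by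
  simp only [dTerm, Finset.mul_sum, Finset.sum_mul, mul_smul_comm, smul_mul_assoc, ← map_mul,
    ReflGroup.mul_diagElt]

/-- Conjugation by `w` moves the index `l` of a reflection by a difference of exponents of `w`.
Reindexing the sum over `l` turns this into the scalar by which `w` acts on `y_j ⊗ x_k`. -/
theorem mul_commElt (w : ReflGroup r n) (j k : Fin n) :
    t w * commElt P t j k = zetaPow F r (w.expo (w.right j) - w.expo (w.right k)) •
      (commElt P t (w.right j) (w.right k) * t w) := by
  unfold commElt
  by_cases h : j = k
  · subst h
    rw [if_pos rfl, if_pos rfl, sub_self, zetaPow_zero, one_smul]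
    simp only [mul_sub, sub_mul, mul_dTerm, mul_smul_comm, smul_mul_assoc, ← Algebra.commutes]
    congr 2
    simp only [Finset.mul_sum, Finset.sum_mul]
    refine Finset.sum_equiv w.right (by simp) fun i hi => ?_
    have hij : j ≠ i := fun e => by simp [e] at hi
    refine Fintype.sum_equiv (Equiv.addRight (w.expo (w.right j) - w.expo (w.right i))) _ _ fun l => ?_
    rw [← map_mul, ← map_mul, ReflGroup.mul_refl w hij, Equiv.coe_addRight, add_sub_assoc]
  · have h' : w.right j ≠ w.right k := fun e => h (w.right.injective e)
    rw [if_neg h, if_neg h', mul_smul_comm, smul_mul_assoc, smul_comm]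
    congr 1
    simp only [Finset.mul_sum, Finset.sum_mul, Finset.smul_sum, mul_smul_comm, smul_mul_assoc,
      smul_smul, ← zetaPow_add]
    refine Fintype.sum_equiv (Equiv.addRight (w.expo (w.right j) - w.expo (w.right k))) _ _ fun l => ?_
    rw [← map_mul, ← map_mul, ReflGroup.mul_refl w h, Equiv.coe_addRight, add_sub_assoc]
    congr 2
    ring

variable {t} {z : Fin n → A} {ε : ZMod r}
  (hz : ∀ w j, t w * z j = zetaPow F r (ε * w.expo (w.right j)) • (z (w.right j) * t w))

include hz

/-- Here and below, `z` stands for the `x`'s when `ε = -1` and for the `y`'s when `ε = 1`, so that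
both families are treated at once. -/
theorem dTerm_mul_of_ne {i l : Fin n} (h : l ≠ i) : dTerm P t i * z l = z l * dTerm P t i := by
  simp only [dTerm, Finset.mul_sum, Finset.sum_mul, mul_smul_comm, smul_mul_assoc, hz,
    ReflGroup.right_diagElt, Equiv.Perm.one_apply, ReflGroup.expo_diagElt, if_neg h, mul_zero,
    zetaPow_zero, one_smul]

theorem refl_mul_of_ne {i k l : Fin n} (h : i ≠ k) (hi : l ≠ i) (hk : l ≠ k) (m : ZMod r) :
    t (ReflGroup.refl i k m) * z l = z l * t (ReflGroup.refl i k m) := by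
  rw [hz, ReflGroup.right_refl, Equiv.swap_apply_of_ne_of_ne hi hk, ReflGroup.expo_refl h,
    if_neg hi, if_neg hk, mul_zero, zetaPow_zero, one_smul]

theorem refl_mul_right {i k : Fin n} (h : i ≠ k) (m : ZMod r) :
    t (ReflGroup.refl i k m) * z k = zetaPow F r (ε * m) • (z i * t (ReflGroup.refl i k m)) := by
  rw [hz, ReflGroup.right_refl, Equiv.swap_apply_right, ReflGroup.expo_refl h, if_pos rfl]

theorem refl_mul_left {i k : Fin n} (h : i ≠ k) (m : ZMod r) :
    t (ReflGroup.refl i k m) * z i = zetaPow F r (-(ε * m)) • (z k * t (ReflGroup.refl i k m)) := by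
  rw [hz, ReflGroup.right_refl, Equiv.swap_apply_left, ReflGroup.expo_refl h, if_neg h.symm,
    if_pos rfl, mul_neg]

theorem commElt_mul_of_ne {i k l : Fin n} (h : i ≠ k) (hi : l ≠ i) (hk : l ≠ k) :
    commElt P t i k * z l - z l * commElt P t i k = 0 := by
  rw [commElt, if_neg h, sub_eq_zero]
  simp only [mul_smul_comm, smul_mul_assoc, Finset.mul_sum, Finset.sum_mul,
    refl_mul_of_ne hz h hi hk]

/-- Among the terms of `commElt P t i i`, only the reflections that exchange `i` and `l` fail to
commute with `z l`. -/
theorem commElt_self_mul {i l : Fin n} (h : i ≠ l) :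
    commElt P t i i * z l - z l * commElt P t i i =
      P.c0 • ∑ m : ZMod r, (z l * t (ReflGroup.refl i l m) -
        zetaPow F r (ε * m) • (z i * t (ReflGroup.refl i l m))) := by
  rw [commElt, if_pos rfl]
  simp only [sub_mul, mul_sub, dTerm_mul_of_ne P hz h.symm, Algebra.commutes, mul_smul_comm,
    smul_mul_assoc, Finset.mul_sum, Finset.sum_mul]
  rw [sub_sub_sub_cancel_left, ← smul_sub, ← Finset.sum_sub_distrib]
  congr 1
  rw [Finset.sum_eq_single_of_mem l (by simp [h.symm]), ← Finset.sum_sub_distrib]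
  · simp only [refl_mul_right hz h]
  · intro j hj hjl
    have hij : i ≠ j := fun e => by simp [e] at hj
    rw [← Finset.sum_sub_distrib]
    refine Finset.sum_eq_zero fun m _ => ?_
    rw [refl_mul_of_ne hz hij h.symm hjl.symm, sub_self]

end CommElt

section CommEltSymm

variable {F : Type*} [Field F] [Algebra ℂ F] {r : ℕ} [NeZero r] {n : ℕ} (P : ChParams F r)
  {A : Type*} [Ring A] [Algebra F A] {t : ReflGroup r n →* A} {z : Fin n → A}

/-- Through the Jacobi identity this is what `[x_k, x_l] = 0` demands of the double commutators
`[[y_i, x_k], x_l]`. It is the integrability condition under which an operator with prescribed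
commutators with the `x`'s exists. -/
theorem commElt_symm_x
    (hz : ∀ w j, t w * z j = zetaPow F r (-(w.expo (w.right j))) • (z (w.right j) * t w))
    (i k l : Fin n) :
    commElt P t i k * z l - z l * commElt P t i k = commElt P t i l * z k - z k * commElt P t i l := by
  have hz' : ∀ w j, t w * z j = zetaPow F r (-1 * w.expo (w.right j)) • (z (w.right j) * t w) := by
    simpa using hz
  have key : ∀ l, i ≠ l → commElt P t i i * z l - z l * commElt P t i i =
      commElt P t i l * z i - z i * commElt P t i l := by
    intro l h
    rw [commElt_self_mul P hz' h, commElt, if_neg h]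
    simp only [mul_smul_comm, smul_mul_assoc, Finset.mul_sum, Finset.sum_mul,
      refl_mul_left hz' h, ← smul_sub, ← Finset.sum_sub_distrib]
    congr 1
    refine Finset.sum_congr rfl fun m _ => ?_
    rw [smul_sub, smul_smul, ← zetaPow_add]
    simp [zetaPow_zero]
  by_cases hk : i = k
  · subst hk
    by_cases hl : i = l
    · subst hl; rfl
    · exact key l hl
  · by_cases hl : i = l
    · subst hl; exact (key k hk).symm
    · by_cases hkl : k = l
      · subst hkl; rfl
      · rw [commElt_mul_of_ne P hz' hk (Ne.symm hl) (Ne.symm hkl),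
          commElt_mul_of_ne P hz' hl (Ne.symm hk) hkl]

/-- The dual symmetry, of `[[y_i, x_k], y_j]` in `i` and `j`; it forces the Dunkl operators to
commute. -/
theorem commElt_symm_y
    (hz : ∀ w j, t w * z j = zetaPow F r (w.expo (w.right j)) • (z (w.right j) * t w))
    (i j k : Fin n) :
    commElt P t i k * z j - z j * commElt P t i k = commElt P t j k * z i - z i * commElt P t j k := by
  have hz' : ∀ w j, t w * z j = zetaPow F r (1 * w.expo (w.right j)) • (z (w.right j) * t w) := by
    simpa using hz
  have key : ∀ j, j ≠ k → commElt P t k k * z j - z j * commElt P t k k =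
      commElt P t j k * z k - z k * commElt P t j k := by
    intro j h
    rw [commElt_self_mul P hz' h.symm, commElt, if_neg h]
    simp only [mul_smul_comm, smul_mul_assoc, Finset.mul_sum, Finset.sum_mul,
      refl_mul_right hz' h, ← smul_sub, ← Finset.sum_sub_distrib]
    congr 1
    refine Fintype.sum_equiv (Equiv.neg _) _ _ fun m => ?_
    rw [smul_sub, smul_smul, ← zetaPow_add, ReflGroup.refl_symm h.symm]
    simp [zetaPow_zero]
  by_cases hi : i = k
  · subst hi
    by_cases hj : j = i
    · subst hj; rfl
    · exact key j hj
  · by_cases hj : j = k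
    · subst hj; exact (key i hi).symm
    · by_cases hij : i = j
      · subst hij; rfl
      · rw [commElt_mul_of_ne P hz' hi (Ne.symm hij) hj,
          commElt_mul_of_ne P hz' hj hij hi]

variable {x y : Fin n → A}
  (hx : ∀ w j, t w * x j = zetaPow F r (-(w.expo (w.right j))) • (x (w.right j) * t w))
  (hyx : ∀ i k, y i * x k = x k * y i + commElt P t i k)

include hyx

include hx in
-- The defect in the relation between `t_w` and `y_j` moves past each `x_k` up to a twist. It
-- therefore vanishes on everything the `x`'s generate once it vanishes on the generating vectors.
theorem sub_twist_mul_x (w : ReflGroup r n) (j k : Fin n) :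
    (t w * y j - zetaPow F r (w.expo (w.right j)) • (y (w.right j) * t w)) * x k =
      (zetaPow F r (-(w.expo (w.right k))) • x (w.right k)) *
        (t w * y j - zetaPow F r (w.expo (w.right j)) • (y (w.right j) * t w)) := by
  have h1 : t w * y j * x k =
      zetaPow F r (-(w.expo (w.right k))) • (x (w.right k) * (t w * y j)) +
      zetaPow F r (w.expo (w.right j) - w.expo (w.right k)) •
        (commElt P t (w.right j) (w.right k) * t w) := by
    rw [mul_assoc, hyx, mul_add, ← mul_assoc, hx, mul_commElt, smul_mul_assoc, mul_assoc]
  have h2 : y (w.right j) * t w * x k =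
      zetaPow F r (-(w.expo (w.right k))) • (x (w.right k) * (y (w.right j) * t w) +
          commElt P t (w.right j) (w.right k) * t w) := by
    rw [mul_assoc, hx, mul_smul_comm, ← mul_assoc, hyx, add_mul, mul_assoc]
  rw [sub_mul, h1, smul_mul_assoc, h2, sub_eq_add_neg (w.expo _), zetaPow_add, mul_sub,
    smul_mul_assoc, mul_smul_comm, smul_mul_assoc]
  module

/-- The same principle for the commutator of two `y`'s: commuting with every `x_k`, it is determined
by its values on generating vectors. -/
theorem sub_comm_mul_x
    (hy : ∀ w j, t w * y j = zetaPow F r (w.expo (w.right j)) • (y (w.right j) * t w))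
    (i j k : Fin n) : (y i * y j - y j * y i) * x k = x k * (y i * y j - y j * y i) := by
  have key := commElt_symm_y P hy i j k
  have h : ∀ a b : Fin n, y a * y b * x k =
      x k * (y a * y b) + commElt P t a k * y b + y a * commElt P t b k := by
    intro a b
    rw [mul_assoc, hyx, mul_add, ← mul_assoc, hyx, add_mul, mul_assoc]
  rw [sub_mul, h, h, mul_sub]
  rw [sub_eq_sub_iff_add_eq_add] at key
  have key' : commElt P t i k * y j + y i * commElt P t j k =
      commElt P t j k * y i + y j * commElt P t i k := by rw [key]
  rw [add_assoc, key']
  abel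

end CommEltSymm

/-! ### Dunkl operators -/

open scoped IsMulCommutative in
-- Commuting elements generate a commutative subalgebra, where the usual evaluation homomorphism is
-- available.
theorem exists_aeval_of_commute {F A σ : Type*} [CommRing F] [Ring A] [Algebra F A] (a : σ → A)
    (h : ∀ i j, a i * a j = a j * a i) :
    ∃ φ : MvPolynomial σ F →ₐ[F] A, ∀ i, φ (MvPolynomial.X i) = a i := by
  have : IsMulCommutative (Algebra.adjoin F (Set.range a)) := Algebra.isMulCommutative_adjoin F (by
    rintro _ ⟨i, rfl⟩ _ ⟨j, rfl⟩
    exact h i j)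
  let φ : MvPolynomial σ F →ₐ[F] Algebra.adjoin F (Set.range a) :=
    MvPolynomial.aeval fun i => (⟨a i, Algebra.subset_adjoin ⟨i, rfl⟩⟩ : Algebra.adjoin F (Set.range a))
  exact ⟨(Algebra.adjoin F (Set.range a)).val.comp φ, fun i => by simp [φ]⟩

section Dunkl

variable {F : Type*} [Field F] {n : ℕ} {V : Type*} [AddCommGroup V] [Module F V]

variable (F V) in
/-- Multiplication by `x_k` on `F[x] ⊗ V`. -/
def polyX (k : Fin n) : Module.End F (MvPolynomial (Fin n) F ⊗[F] V) :=
  LinearMap.rTensor V (LinearMap.mulLeft F (MvPolynomial.X k))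

@[simp] theorem polyX_tmul (k : Fin n) (f : MvPolynomial (Fin n) F) (v : V) :
    polyX F V k (f ⊗ₜ v) = (MvPolynomial.X k * f) ⊗ₜ v := rfl

theorem polyX_comm (k l : Fin n) : polyX F V k * polyX F V l = polyX F V l * polyX F V k := by
  refine TensorProduct.ext' fun f v => ?_
  simp [mul_left_comm]

theorem polyEnd_eq_zero {z : Module.End F (MvPolynomial (Fin n) F ⊗[F] V)}
    (g : Fin n → Module.End F (MvPolynomial (Fin n) F ⊗[F] V)) (h1 : ∀ v, z (1 ⊗ₜ v) = 0)
    (h2 : ∀ k, z * polyX F V k = g k * z) : z = 0 := by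
  refine TensorProduct.ext' fun f v => ?_
  rw [LinearMap.zero_apply]
  induction f using MvPolynomial.induction_on with
  | C a =>
    rw [MvPolynomial.C_eq_smul_one, ← TensorProduct.smul_tmul', map_smul, h1, smul_zero]
  | add p q hp hq => rw [TensorProduct.add_tmul, map_add, hp, hq, add_zero]
  | mul_X p k hp =>
    have := LinearMap.congr_fun (h2 k) (p ⊗ₜ v)
    rw [Module.End.mul_apply, Module.End.mul_apply, hp, map_zero, polyX_tmul, mul_comm] at this
    exact this

/-- Operators with prescribed commutators with the multiplications by `x_k` exist when an
integrability condition holds. -/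
theorem exists_polyEnd_of_commutators (R : Fin n → Module.End F (MvPolynomial (Fin n) F ⊗[F] V))
    (hR : ∀ k l, R k * polyX F V l - polyX F V l * R k = R l * polyX F V k - polyX F V k * R l) :
    ∃ y : Module.End F (MvPolynomial (Fin n) F ⊗[F] V), (∀ v, y (1 ⊗ₜ v) = 0) ∧
      ∀ k, y * polyX F V k = polyX F V k * y + R k := by
  -- The block matrices with `X_k` on the diagonal and `R_k` in the corner commute exactly under the
  -- integrability condition `hR`. Evaluating a polynomial `f` at them and applying it to `(0, 1 ⊗
  -- v)` gives `f ⊗ v` in the second coordinate and the wanted value `y (f ⊗ v)` in the first, so no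
  -- product formula has to be checked for consistency.
  let Z : Fin n → Module.End F
      ((MvPolynomial (Fin n) F ⊗[F] V) × (MvPolynomial (Fin n) F ⊗[F] V)) := fun k =>
    ((polyX F V k).comp (LinearMap.fst F _ _) + (R k).comp (LinearMap.snd F _ _)).prod
      ((polyX F V k).comp (LinearMap.snd F _ _))
  have hZ : ∀ k a b, Z k (a, b) = (polyX F V k a + R k b, polyX F V k b) := fun k a b => rfl
  obtain ⟨φ, hφ⟩ := exists_aeval_of_commute (F := F) Z fun k l => by
    refine LinearMap.ext fun ⟨a, b⟩ => ?_
    simp only [Module.End.mul_apply, hZ, map_add]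
    have h1 := fun c => LinearMap.congr_fun (polyX_comm (F := F) (V := V) k l) c
    have h2 := LinearMap.congr_fun (hR k l) b
    simp only [Module.End.mul_apply, LinearMap.sub_apply] at h1 h2
    rw [h1 a, h1 b]
    refine Prod.ext ?_ rfl
    simp only
    rw [sub_eq_sub_iff_add_eq_add] at h2
    rw [add_assoc, add_assoc, add_comm (polyX F V k _), h2, add_comm (R l _)]
  let y : Module.End F (MvPolynomial (Fin n) F ⊗[F] V) := TensorProduct.lift
    (LinearMap.mk₂ F (fun f v => (φ f (0, 1 ⊗ₜ v)).1)
      (fun f g v => by simp) (fun c f v => by simp)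
      (fun f v w => by
        rw [TensorProduct.tmul_add, ← Prod.fst_add, ← map_add, Prod.mk_add_mk, add_zero])
      (fun c f v => by
        rw [TensorProduct.tmul_smul, ← Prod.smul_fst, ← map_smul, Prod.smul_mk, smul_zero]))
  have hy : ∀ f v, y (f ⊗ₜ v) = (φ f (0, 1 ⊗ₜ v)).1 := fun f v => rfl
  have hsnd : ∀ f v, (φ f (0, 1 ⊗ₜ v)).2 = f ⊗ₜ v := by
    intro f v
    induction f using MvPolynomial.induction_on with
    | C a =>
      rw [← MvPolynomial.algebraMap_eq, AlgHom.commutes, Module.algebraMap_end_apply,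
        Prod.smul_snd, Algebra.algebraMap_eq_smul_one, TensorProduct.smul_tmul']
    | add p q hp hq => rw [map_add, LinearMap.add_apply, Prod.snd_add, hp, hq, TensorProduct.add_tmul]
    | mul_X p k hp =>
      rw [mul_comm, map_mul, hφ, Module.End.mul_apply, hZ, hp, polyX_tmul]
  refine ⟨y, fun v => ?_, fun k => TensorProduct.ext' fun f v => ?_⟩
  · rw [hy, map_one, Module.End.one_apply]
  · rw [Module.End.mul_apply, polyX_tmul, hy, map_mul, hφ, Module.End.mul_apply, hZ, hsnd]
    rfl

end Dunkl

/-! ### The action of `G(r,1,n)` on vector-valued polynomials -/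

section PolynomialRep

variable {F : Type*} [Field F] [Algebra ℂ F] {r : ℕ} [NeZero r] {n : ℕ}

/-- The action of `G(r,1,n)` on polynomials. -/
def polyAct (w : ReflGroup r n) : MvPolynomial (Fin n) F →ₐ[F] MvPolynomial (Fin n) F :=
  MvPolynomial.aeval fun j => zetaPow F r (-(w.expo (w.right j))) • MvPolynomial.X (w.right j)

theorem polyAct_X (w : ReflGroup r n) (j : Fin n) :
    polyAct (F := F) w (MvPolynomial.X j) =
      zetaPow F r (-(w.expo (w.right j))) • MvPolynomial.X (w.right j) := by
  simp [polyAct]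

variable {V : Type*} [AddCommGroup V] [Module F V] (ρ : ReflGroup r n →* Module.End F V)

/-- The action of `G(r,1,n)` on `F[x] ⊗ V`. -/
def polyT : ReflGroup r n →* Module.End F (MvPolynomial (Fin n) F ⊗[F] V) where
  toFun w := TensorProduct.map (polyAct w).toLinearMap (ρ w)
  map_one' := by
    refine TensorProduct.ext' fun f v => ?_
    have : polyAct (F := F) (1 : ReflGroup r n) = AlgHom.id F _ := by
      refine MvPolynomial.algHom_ext fun j => ?_
      simp [polyAct_X, zetaPow_zero]
    simp [this]
  map_mul' w v := by
    refine TensorProduct.ext' fun f u => ?_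
    have : polyAct (F := F) (w * v) = (polyAct w).comp (polyAct v) := by
      refine MvPolynomial.algHom_ext fun j => ?_
      simp only [polyAct_X, AlgHom.comp_apply, map_smul, smul_smul, ← zetaPow_add,
        ReflGroup.expo_mul, SemidirectProduct.mul_right, Equiv.Perm.mul_apply]
      rw [show w.right⁻¹ (w.right (v.right j)) = v.right j from w.right.symm_apply_apply _]
      congr 2
      ring
    simp [this]

theorem polyT_tmul (w : ReflGroup r n) (f : MvPolynomial (Fin n) F) (v : V) :
    polyT ρ w (f ⊗ₜ v) = polyAct w f ⊗ₜ ρ w v := rfl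

theorem polyT_mul_polyX (w : ReflGroup r n) (j : Fin n) :
    polyT ρ w * polyX F V j =
      zetaPow F r (-(w.expo (w.right j))) • (polyX F V (w.right j) * polyT ρ w) := by
  refine TensorProduct.ext' fun f v => ?_
  simp only [Module.End.mul_apply, LinearMap.smul_apply, polyX_tmul, polyT_tmul, map_mul, polyAct_X,
    smul_mul_assoc, TensorProduct.smul_tmul']

end PolynomialRep

/-! ### From Dunkl operators to a representation of the Cherednik algebra -/

section DunklRep

variable {F : Type*} [Field F] [Algebra ℂ F] {r : ℕ} [NeZero r] {n : ℕ} (P : ChParams F r)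
  {E : Type*} [AddCommGroup E] [Module F E]

/-- Images of the generators of the Cherednik algebra. -/
def genMap (x y : Fin n → Module.End F E) (t : ReflGroup r n → Module.End F E) :
    ChGen r n → Module.End F E
  | ChGen.x i => x i
  | ChGen.y i => y i
  | ChGen.t w => t w

theorem genMap_rel {x y : Fin n → Module.End F E} {t : ReflGroup r n →* Module.End F E}
    (hxx : ∀ i j, x i * x j = x j * x i) (hyy : ∀ i j, y i * y j = y j * y i)
    (hx : ∀ w j, t w * x j = zetaPow F r (-(w.expo (w.right j))) • (x (w.right j) * t w))
    (hy : ∀ w j, t w * y j = zetaPow F r (w.expo (w.right j)) • (y (w.right j) * t w))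
    (hyx : ∀ i k, y i * x k = x k * y i + commElt P t i k)
    {a b : FreeAlgebra F (ChGen r n)} (h : ChRel P n a b) :
    FreeAlgebra.lift F (genMap x y t) a = FreeAlgebra.lift F (genMap x y t) b := by
  induction h with
  | t_one => simp [genMap]
  | t_mul w v => simp [genMap]
  | x_comm i j => simpa [genMap] using hxx i j
  | y_comm i j => simpa [genMap] using hyy i j
  | t_x w j => simpa [genMap] using hx w j
  | t_y w j => simpa [genMap] using hy w j
  | y_x_ne i j h =>
    have := hyx i j
    rw [commElt, if_neg h] at this
    simpa [genMap] using this
  | y_x_self i =>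
    have := hyx i i
    rw [commElt, if_pos rfl] at this
    simp only [dTerm] at this
    simp only [dTerm, map_mul, map_sub, map_add, map_smul, map_sum, FreeAlgebra.lift_ι_apply,
      genMap, AlgHom.commutes]
    rw [this]
    simp only [sub_eq_add_neg, add_assoc]

/-- If operators `x_k` and `t_w` are given, then the Cherednik algebra acts through them and through
operators `y_i` killing a set of vectors, provided that operators are determined by their values on
this set and their commutators with the `x_k`, and that the latter can be prescribed. -/
theorem exists_cherednik_rep {x : Fin n → Module.End F E} {t : ReflGroup r n →* Module.End F E}
    (S : Set E) (htS : ∀ w, ∀ v ∈ S, t w v ∈ S)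
    (hxx : ∀ i j, x i * x j = x j * x i)
    (hx : ∀ w j, t w * x j = zetaPow F r (-(w.expo (w.right j))) • (x (w.right j) * t w))
    (huniq : ∀ (z : Module.End F E) (g : Fin n → Module.End F E), (∀ v ∈ S, z v = 0) →
      (∀ k, z * x k = g k * z) → z = 0)
    (hex : ∀ R : Fin n → Module.End F E, (∀ k l, R k * x l - x l * R k = R l * x k - x k * R l) →
      ∃ y : Module.End F E, (∀ v ∈ S, y v = 0) ∧ ∀ k, y * x k = x k * y + R k) :
    ∃ Θ : Cherednik P n →ₐ[F] Module.End F E, (∀ i, Θ (Cherednik.x i) = x i) ∧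
      (∀ w, Θ (Cherednik.t w) = t w) ∧ ∀ i, ∀ v ∈ S, Θ (Cherednik.y i) v = 0 := by
  -- The `y_i` are determined by killing `S` and by their commutators with the `x_k`. The remaining
  -- relations follow from uniqueness: their defects also kill `S` and move past the `x_k`.
  choose y hyS hyx using fun i => hex (fun k => commElt P t i k) fun k l => commElt_symm_x P hx i k l
  have hy : ∀ w j, t w * y j = zetaPow F r (w.expo (w.right j)) • (y (w.right j) * t w) := by
    intro w j
    rw [← sub_eq_zero]
    refine huniq _ _ (fun v hv => ?_) (fun k => sub_twist_mul_x P hx hyx w j k)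
    simp only [LinearMap.sub_apply, Module.End.mul_apply, LinearMap.smul_apply, hyS _ v hv,
      map_zero, hyS _ _ (htS w v hv), smul_zero, sub_zero]
  have hyy : ∀ i j, y i * y j = y j * y i := by
    intro i j
    rw [← sub_eq_zero]
    refine huniq _ _ (fun v hv => ?_) (fun k => sub_comm_mul_x P hyx hy i j k)
    simp only [LinearMap.sub_apply, Module.End.mul_apply, hyS _ v hv, map_zero, sub_zero]
  let Θ : Cherednik P n →ₐ[F] Module.End F E := RingQuot.liftAlgHom F
    ⟨FreeAlgebra.lift F (genMap x y t), fun _ _ h => genMap_rel P hxx hyy hx hy hyx h⟩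
  have hΘ : ∀ a, Θ (Cherednik.mk P n (FreeAlgebra.ι F a)) = genMap x y t a := fun a => by
    refine (RingQuot.liftAlgHom_mkAlgHom_apply F _ _ _).trans ?_
    rw [FreeAlgebra.lift_ι_apply]
  exact ⟨Θ, fun i => hΘ _, fun w => hΘ _, fun i v hv => by
    rw [Cherednik.y, hΘ]; exact hyS i v hv⟩

end DunklRep

/-- The representation of the Cherednik algebra on `F[x] ⊗ V` by Dunkl operators. -/
theorem exists_dunkl_rep {F : Type*} [Field F] [Algebra ℂ F] {r : ℕ} [NeZero r] {n : ℕ}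
    {V : Type*} [AddCommGroup V] [Module F V] (ρ : ReflGroup r n →* Module.End F V)
    (P : ChParams F r) :
    ∃ Θ : Cherednik P n →ₐ[F] Module.End F (MvPolynomial (Fin n) F ⊗[F] V),
      (∀ i, Θ (Cherednik.x i) = polyX F V i) ∧ (∀ w, Θ (Cherednik.t w) = polyT ρ w) ∧
        ∀ i v, Θ (Cherednik.y i) (1 ⊗ₜ v) = 0 := by
  obtain ⟨Θ, h1, h2, h3⟩ := exists_cherednik_rep P (x := polyX F V) (t := polyT ρ)
    (Set.range fun v : V => (1 : MvPolynomial (Fin n) F) ⊗ₜ[F] v)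
    (by rintro w _ ⟨v, rfl⟩; exact ⟨ρ w v, by simp [polyT_tmul]⟩) polyX_comm (polyT_mul_polyX ρ)
    (fun z g h1 h2 => polyEnd_eq_zero g (fun v => h1 _ ⟨v, rfl⟩) h2)
    (fun R hR => by
      obtain ⟨y, hy1, hy2⟩ := exists_polyEnd_of_commutators R hR
      exact ⟨y, by rintro _ ⟨v, rfl⟩; exact hy1 v, hy2⟩)
  exact ⟨Θ, h1, h2, fun i v => h3 i _ ⟨v, rfl⟩⟩

/-! ### The Cherednik algebra: relations and generation -/

namespace Cherednik

variable {F : Type*} [Field F] [Algebra ℂ F] {r : ℕ} [NeZero r] {P : ChParams F r} {n : ℕ}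

theorem t_one : t (P := P) (1 : ReflGroup r n) = 1 := by
  simpa [t] using mk_rel (P := P) (n := n) ChRel.t_one

theorem t_mul (w v : ReflGroup r n) : t (P := P) (w * v) = t w * t v := by
  simpa [t] using mk_rel (P := P) (n := n) (ChRel.t_mul w v)

variable (P) in
/-- The group `G(r,1,n)` inside the Cherednik algebra. -/
def tHom : ReflGroup r n →* Cherednik P n where
  toFun := t
  map_one' := t_one
  map_mul' := t_mul

theorem x_comm (i j : Fin n) : x (P := P) i * x j = x j * x i := by
  simpa [x] using mk_rel (P := P) (ChRel.x_comm i j)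

theorem t_mul_x (w : ReflGroup r n) (j : Fin n) :
    tHom P w * x j = zetaPow F r (-(w.expo (w.right j))) • (x (w.right j) * tHom P w) := by
  simpa [x, t, tHom] using mk_rel (P := P) (ChRel.t_x w j)

theorem t_mul_y (w : ReflGroup r n) (j : Fin n) :
    tHom P w * y j = zetaPow F r (w.expo (w.right j)) • (y (w.right j) * tHom P w) := by
  simpa [y, t, tHom] using mk_rel (P := P) (ChRel.t_y w j)

theorem y_mul_x (i k : Fin n) :
    y (P := P) i * x k = x k * y i + commElt P (tHom P) i k := by
  unfold commElt
  split_ifs with h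
  · subst h
    have := mk_rel (P := P) (ChRel.y_x_self (P := P) i)
    simp only [dTerm, map_mul, map_smul, map_add, map_sub, map_sum, AlgHom.commutes] at this
    simp only [dTerm, tHom, MonoidHom.coe_mk, OneHom.coe_mk, x, y, t]
    rw [this]
    simp only [sub_eq_add_neg, add_assoc]
  · have := mk_rel (P := P) (ChRel.y_x_ne (P := P) i k h)
    simpa [x, y, t, tHom] using this

/-- Induction on elements of the Cherednik algebra. -/
theorem induction {Q : Cherednik P n → Prop} (scalar : ∀ c : F, Q (algebraMap F _ c))
    (x : ∀ i, Q (x i)) (y : ∀ i, Q (y i)) (t : ∀ w, Q (t w))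
    (add : ∀ a b, Q a → Q b → Q (a + b)) (mul : ∀ a b, Q a → Q b → Q (a * b))
    (h : Cherednik P n) : Q h := by
  obtain ⟨a, rfl⟩ := RingQuot.mkAlgHom_surjective F (ChRel P n) h
  change Q (mk P n a)
  induction a using FreeAlgebra.induction with
  | grade0 c => rw [AlgHom.commutes]; exact scalar c
  | grade1 g =>
    cases g with
    | x i => exact x i
    | y i => exact y i
    | t w => exact t w
  | mul a b ha hb => rw [map_mul]; exact mul _ _ ha hb
  | add a b ha hb => rw [map_add]; exact add _ _ ha hb

theorem smul_mem_of_stable {N : Type*} [AddCommGroup N] [Module F N] [Module (Cherednik P n) N]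
    [IsScalarTower F (Cherednik P n) N] (W : Submodule F N) (hx : ∀ i, ∀ m ∈ W, (x i : Cherednik P n) • m ∈ W)
    (hy : ∀ i, ∀ m ∈ W, (y i : Cherednik P n) • m ∈ W) (ht : ∀ w, ∀ m ∈ W, (t w : Cherednik P n) • m ∈ W)
    (h : Cherednik P n) : ∀ m ∈ W, h • m ∈ W := by
  induction h using induction with
  | scalar c => intro m hm; rw [algebraMap_smul]; exact W.smul_mem c hm
  | x i => exact hx i
  | y i => exact hy i
  | t w => exact ht w
  | add a b ha hb => intro m hm; rw [add_smul]; exact W.add_mem (ha m hm) (hb m hm)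
  | mul a b ha hb => intro m hm; rw [mul_smul]; exact ha _ (hb m hm)

theorem commElt_smul_mem {N : Type*} [AddCommGroup N] [Module F N] [Module (Cherednik P n) N]
    [IsScalarTower F (Cherednik P n) N] (W : Submodule F N)
    (ht : ∀ w : ReflGroup r n, ∀ m ∈ W, tHom P w • m ∈ W) (i k : Fin n) (m : N) (hm : m ∈ W) :
    commElt P (tHom P) i k • m ∈ W := by
  unfold commElt dTerm
  have hs : ∀ (c : F) (h : Cherednik P n), h • m ∈ W → (c • h) • m ∈ W := fun c h hh => by
    rw [smul_assoc]; exact W.smul_mem c hh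
  have hsum : ∀ {ι : Type _} (s : Finset ι) (f : ι → Cherednik P n), (∀ a ∈ s, f a • m ∈ W) →
      (∑ a ∈ s, f a) • m ∈ W := fun s f hf => by
    rw [Finset.sum_smul]; exact W.sum_mem hf
  split_ifs
  · rw [sub_smul, sub_smul, algebraMap_smul]
    refine W.sub_mem (W.sub_mem (W.smul_mem _ hm) ?_) ?_
    · exact hsum _ _ fun _ _ => hs _ _ (hs _ _ (hsum _ _ fun _ _ => hs _ _ (ht _ _ hm)))
    · refine hs _ _ (hsum _ _ fun j _ => ?_)
      rw [Finset.sum_smul]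
      exact W.sum_mem fun l _ => ht _ _ hm
  · exact hs _ _ (hsum _ _ fun _ _ => hs _ _ (ht _ _ hm))

variable (P n) in
/-- The polynomial subalgebra generated by the `x_i`. -/
def poly : MvPolynomial (Fin n) F →ₐ[F] Cherednik P n :=
  (exists_aeval_of_commute (F := F) (fun i => x (P := P) (n := n) i) x_comm).choose

theorem poly_X (i : Fin n) : poly P n (MvPolynomial.X i) = x i :=
  (exists_aeval_of_commute (F := F) (fun i => x (P := P) (n := n) i) x_comm).choose_spec i

theorem poly_prod (μ : Fin n → ℕ) : poly P n (∏ i, MvPolynomial.X i ^ μ i) = xMon μ := by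
  rw [← List.prod_ofFn, map_list_prod, List.map_ofFn]
  unfold xMon
  congr 2
  funext i
  simp [poly_X]

theorem xMon_zero : xMon (P := P) (0 : Fin n → ℕ) = 1 := by
  rw [← poly_prod]; simp

theorem x_mul_xMon (k : Fin n) (μ : Fin n → ℕ) :
    x (P := P) k * xMon μ = xMon (μ + Pi.single k 1) := by
  rw [← poly_prod, ← poly_prod, ← poly_X, ← map_mul]
  congr 1
  simp only [Pi.add_apply, pow_add, Finset.prod_mul_distrib]
  rw [mul_comm, Finset.prod_eq_single (M := MvPolynomial (Fin n) F) k
    (f := fun i => MvPolynomial.X i ^ (Pi.single k 1 : Fin n → ℕ) i)]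
  · simp
  · intro i _ hi
    simp [Pi.single_eq_of_ne hi]
  · simp

end Cherednik

/-! ### The universal property of the Verma module -/

section Universal

variable {F : Type*} [Field F] [Algebra ℂ F] {r : ℕ} [NeZero r] {n : ℕ} {lam : RPartition r n}

open Classical in
/-- The vector attached to a filling in a family indexed by standard tableaux. -/
def fillVec {N : Type*} [Zero N] (u : SYT lam → N) (U : Fin n → ZMod r × ℕ × ℕ) : N :=
  if h : IsSYT lam U then u ⟨U, h⟩ else 0

theorem fillVec_of_isSYT {N : Type*} [Zero N] (u : SYT lam → N) {U : Fin n → ZMod r × ℕ × ℕ}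
    (h : IsSYT lam U) : fillVec u U = u ⟨U, h⟩ := dif_pos h

theorem fillVec_of_not_isSYT {N : Type*} [Zero N] (u : SYT lam → N) {U : Fin n → ZMod r × ℕ × ℕ}
    (h : ¬ IsSYT lam U) : fillVec u U = 0 := dif_neg h

theorem map_fillVec {N N' : Type*} [AddCommMonoid N] [AddCommMonoid N'] (f : N →+ N')
    (u : SYT lam → N) (U : Fin n → ZMod r × ℕ × ℕ) :
    f (fillVec u U) = fillVec (fun T => f (u T)) U := by
  unfold fillVec
  split_ifs <;> simp

theorem swapSymbol_eq (A : Type*) [Semiring A] (T : SYT lam) {i : ℕ} (hi : i + 1 < n) :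
    T.swapSymbol A ⟨i, by omega⟩ ⟨i + 1, hi⟩ =
      fillVec (fun T : SYT lam => Finsupp.single T (1 : A)) (fun a => T.1 (adjSwap n i a)) := by
  rw [adjSwap_of_lt hi]
  rfl

/-- A family of vectors satisfying the relations of Young's orthonormal form and killed by all
`y_i`. -/
structure YoungFamily {N : Type*} [AddCommGroup N] [Module F N] (P : ChParams F r)
    [Module (Cherednik P n) N] (u : SYT lam → N) : Prop where
  zeta : ∀ T i, (Cherednik.t (ReflGroup.diagElt i 1) : Cherednik P n) • u T = zetaPow F r (T.beta i) • u T
  swap : ∀ (T : SYT lam) (i : ℕ) (hi : i + 1 < n),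
    (Cherednik.t (ReflGroup.permElt (adjSwap n i)) : Cherednik P n) • u T =
      boxA F (T.1 ⟨i, by omega⟩) (T.1 ⟨i + 1, hi⟩) • u T +
      boxB F (T.1 ⟨i, by omega⟩) (T.1 ⟨i + 1, hi⟩) • fillVec u (fun a => T.1 (adjSwap n i a))
  y : ∀ T i, (Cherednik.y i : Cherednik P n) • u T = 0

/-- The map is built in two stages: Young's relations let the `u T` define a map of group algebra
modules on the Specht module, and extending it to the algebra is compatible with `VermaRel`. -/
theorem Verma.exists_lift {P : ChParams F r} {N : Type*} [AddCommGroup N] [Module F N]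
    [Module (Cherednik P n) N] [IsScalarTower F (Cherednik P n) N] {u : SYT lam → N}
    (hu : YoungFamily P u) :
    ∃ f : Verma P lam →ₗ[Cherednik P n] N, ∀ T, f (Verma.v P T) = u T := by
  let τ : MonoidAlgebra F (ReflGroup r n) →ₐ[F] Cherednik P n :=
    MonoidAlgebra.lift F _ _ (Cherednik.tHom P)
  have hτ : ∀ w, τ (MonoidAlgebra.of F (ReflGroup r n) w) = Cherednik.t w := fun w => by
    simp [τ, Cherednik.tHom]
  let _ : Module (MonoidAlgebra F (ReflGroup r n)) N := Module.compHom N τ.toRingHom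
  have hsm : ∀ (a : MonoidAlgebra F (ReflGroup r n)) (m : N), a • m = τ a • m := fun _ _ => rfl
  have hst : IsScalarTower F (MonoidAlgebra F (ReflGroup r n)) N :=
    ⟨fun c a m => by rw [hsm, hsm, map_smul, smul_assoc]⟩
  let g : (SYT lam →₀ MonoidAlgebra F (ReflGroup r n)) →ₗ[MonoidAlgebra F (ReflGroup r n)] N :=
    Finsupp.linearCombination _ u
  have hg : ∀ T a, g (Finsupp.single T a) = τ a • u T := fun T a =>
    Finsupp.linearCombination_single _ _ _
  have hgs : ∀ (c : F) z, g (c • z) = c • g z := fun c z => by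
    rw [← algebraMap_smul (MonoidAlgebra F (ReflGroup r n)) c z, map_smul, algebraMap_smul]
  have hker : Submodule.span (MonoidAlgebra F (ReflGroup r n)) {z | YoungRel F lam z} ≤
      LinearMap.ker g := by
    rw [Submodule.span_le]
    rintro z hz
    rw [SetLike.mem_coe, LinearMap.mem_ker]
    cases hz with
    | zeta T i =>
      rw [map_sub, hg, hτ, hgs, hg, map_one, one_smul, hu.zeta, sub_self]
    | swap T i j h =>
      have hi : (i : ℕ) + 1 < n := h ▸ j.2
      obtain rfl : j = ⟨i + 1, hi⟩ := Fin.ext h.symm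
      have hsw := swapSymbol_eq (MonoidAlgebra F (ReflGroup r n)) T hi
      rw [Fin.eta] at hsw
      have hp : Equiv.swap i ⟨i + 1, hi⟩ = adjSwap n i := (adjSwap_of_lt hi).symm
      have h2 := hu.swap T i hi
      rw [map_sub, map_add, hg, hτ, hgs, hgs, hg, map_one, one_smul, hsw, hp, h2, sub_eq_zero]
      have := map_fillVec g.toAddMonoidHom
        (fun T : SYT lam => Finsupp.single T (1 : MonoidAlgebra F (ReflGroup r n)))
        (fun a => T.1 (adjSwap n i a))
      have e : (fun T => g.toAddMonoidHom (Finsupp.single T (1 : MonoidAlgebra F (ReflGroup r n))))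
          = u := by
        funext T
        exact (hg T 1).trans (by rw [map_one, one_smul])
      rw [e] at this
      change _ = _ + _ • g _
      rw [show g (fillVec _ _) = _ from this]
      rfl
  let gb : SpechtMod F lam →ₗ[MonoidAlgebra F (ReflGroup r n)] N := Submodule.liftQ _ g hker
  have hgb : ∀ T, gb (SpechtMod.v F T) = u T := fun T => by
    refine (Submodule.liftQ_apply _ g _).trans ?_
    rw [hg, map_one, one_smul]
  let l : (Cherednik P n ⊗[F] SpechtMod F lam) →ₗ[Cherednik P n] N :=
    TensorProduct.AlgebraTensorModule.lift
      (LinearMap.toSpanSingleton (Cherednik P n) (SpechtMod F lam →ₗ[F] N) (gb.restrictScalars F))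
  have hl : ∀ h s, l (h ⊗ₜ s) = h • gb s := fun h s => rfl
  -- The hypothesis gives vanishing on the vectors `u T` only; it spreads to the whole image because
  -- `y_i t_w` is a scalar multiple of `t_w y_j` for a suitable `j`.
  have hyk : ∀ i s, (Cherednik.y i : Cherednik P n) • gb s = 0 := by
    intro i s
    obtain ⟨s, rfl⟩ := Submodule.Quotient.mk_surjective _ s
    change (Cherednik.y i : Cherednik P n) • g s = 0
    induction s using Finsupp.induction_linear with
    | zero => rw [map_zero, smul_zero]
    | add a b ha hb => rw [map_add, smul_add, ha, hb, add_zero]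
    | single T a =>
      rw [hg]
      induction a using MonoidAlgebra.induction_on with
      | of w =>
        rw [hτ, ← mul_smul]
        have := Cherednik.t_mul_y (P := P) w (w.right⁻¹ i)
        rw [show w.right (w.right⁻¹ i) = i from w.right.apply_symm_apply i] at this
        have h2 : Cherednik.y (P := P) i * Cherednik.t w =
            zetaPow F r (-(w.expo i)) • (Cherednik.t w * Cherednik.y (w.right⁻¹ i)) := by
          change _ = _ • (Cherednik.tHom P w * _)
          rw [this, smul_smul, zetaPow_neg_mul, one_smul]; rfl
        rw [h2, smul_assoc, mul_smul, hu.y, smul_zero, smul_zero]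
      | add a b ha hb => rw [map_add, add_smul, smul_add, ha, hb, add_zero]
      | smul c a ha => rw [map_smul, smul_assoc, smul_comm, ha, smul_zero]
  have hker2 : Submodule.span (Cherednik P n) {z | VermaRel P lam z} ≤ LinearMap.ker l := by
    rw [Submodule.span_le]
    rintro z hz
    rw [SetLike.mem_coe, LinearMap.mem_ker]
    cases hz with
    | t h w v =>
      rw [map_sub, hl, hl, map_smul, hsm, hτ, mul_smul, sub_self]
    | y h i v => rw [hl, mul_smul, hyk, smul_zero]
  refine ⟨Submodule.liftQ _ l hker2, fun T => ?_⟩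
  refine (Submodule.liftQ_apply _ l _).trans ?_
  rw [hl, hgb, one_smul]

end Universal

/-! ### The basis of the Verma module -/

namespace Verma

variable {F : Type*} [Field F] [Algebra ℂ F] {r : ℕ} [NeZero r] {n : ℕ} {lam : RPartition r n}
  (P : ChParams F r)

theorem t_smul_mk (w : ReflGroup r n) (s : SpechtMod F lam) :
    Cherednik.t (P := P) w • (Submodule.Quotient.mk ((1 : Cherednik P n) ⊗ₜ[F] s) : Verma P lam) =
      Submodule.Quotient.mk ((1 : Cherednik P n) ⊗ₜ[F] (MonoidAlgebra.of F (ReflGroup r n) w • s)) := by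
  rw [← Submodule.Quotient.mk_smul, Submodule.Quotient.eq]
  refine Submodule.subset_span ?_
  have := VermaRel.t (P := P) (lam := lam) 1 w s
  rw [one_mul] at this
  simpa [TensorProduct.smul_tmul'] using this

theorem of_smul_v (w : ReflGroup r n) (T : SYT lam) :
    MonoidAlgebra.of F (ReflGroup r n) w • SpechtMod.v F T =
      Submodule.Quotient.mk (Finsupp.single T (MonoidAlgebra.of F (ReflGroup r n) w)) := by
  rw [SpechtMod.v, ← Submodule.Quotient.mk_smul, Finsupp.smul_single, smul_eq_mul, mul_one]

variable (lam) in
/-- The map `s ↦ 1 ⊗ s`. -/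
def incl : SpechtMod F lam →ₗ[F] Verma P lam :=
  (Submodule.mkQ _).restrictScalars F ∘ₗ TensorProduct.mk F (Cherednik P n) (SpechtMod F lam) 1

theorem youngFamily_v : YoungFamily P (Verma.v P (lam := lam)) where
  zeta T i := by
    have h : MonoidAlgebra.of F (ReflGroup r n) (ReflGroup.diagElt i 1) • SpechtMod.v F T =
        zetaPow F r (T.beta i) • SpechtMod.v F T := by
      rw [of_smul_v, SpechtMod.v, ← Submodule.Quotient.mk_smul, Submodule.Quotient.eq]
      exact Submodule.subset_span (YoungRel.zeta T i)
    have := t_smul_mk P (ReflGroup.diagElt i 1) (SpechtMod.v F T)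
    rw [h] at this
    refine this.trans ?_
    exact (incl lam P).map_smul _ _
  swap T i hi := by
    have h : MonoidAlgebra.of F (ReflGroup r n) (ReflGroup.permElt (adjSwap n i)) • SpechtMod.v F T =
        boxA F (T.1 ⟨i, by omega⟩) (T.1 ⟨i + 1, hi⟩) • SpechtMod.v F T +
        boxB F (T.1 ⟨i, by omega⟩) (T.1 ⟨i + 1, hi⟩) • fillVec (SpechtMod.v F)
          (fun a => T.1 (adjSwap n i a)) := by
      have hq := map_fillVec (Submodule.mkQ
          (Submodule.span (MonoidAlgebra F (ReflGroup r n)) {u | YoungRel F lam u})).toAddMonoidHom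
        (fun T : SYT lam => Finsupp.single T (1 : MonoidAlgebra F (ReflGroup r n)))
        (fun a => T.1 (adjSwap n i a))
      have hr := YoungRel.swap (F := F) T ⟨i, by omega⟩ ⟨i + 1, hi⟩ rfl
      rw [swapSymbol_eq, ← adjSwap_of_lt hi] at hr
      have hr := (Submodule.Quotient.eq (Submodule.span (MonoidAlgebra F (ReflGroup r n))
        {u | YoungRel F lam u})).mpr (Submodule.subset_span hr)
      rw [of_smul_v, hr]
      change _ = _ + _ • fillVec (fun T => _) _
      rw [Submodule.Quotient.mk_add, Submodule.Quotient.mk_smul, Submodule.Quotient.mk_smul]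
      congr 1
      exact congrArg _ hq
    have := t_smul_mk P (ReflGroup.permElt (adjSwap n i)) (SpechtMod.v F T)
    rw [h] at this
    refine this.trans ?_
    have h2 := map_fillVec (incl lam P).toAddMonoidHom (SpechtMod.v F)
      (fun a => T.1 (adjSwap n i a))
    refine ((incl lam P).map_add _ _).trans ?_
    rw [(incl lam P).map_smul, (incl lam P).map_smul]
    congr 1
    exact congrArg _ h2
  y T i := by
    have := VermaRel.y (P := P) (lam := lam) 1 i (SpechtMod.v F T)
    rw [one_mul] at this
    refine (Submodule.Quotient.mk_smul _ _ _).symm.trans ?_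
    rw [Submodule.Quotient.mk_eq_zero]
    refine Submodule.subset_span ?_
    simpa [TensorProduct.smul_tmul'] using this

theorem span_v_eq_top : Submodule.span (Cherednik P n) (Set.range (Verma.v P (lam := lam))) = ⊤ := by
  set W := Submodule.span (Cherednik P n) (Set.range (Verma.v P (lam := lam))) with hW
  rw [eq_top_iff]
  rintro m -
  obtain ⟨z, rfl⟩ := Submodule.Quotient.mk_surjective _ m
  induction z using TensorProduct.induction_on with
  | zero => exact W.zero_mem
  | add a b ha hb => rw [Submodule.Quotient.mk_add]; exact W.add_mem ha hb
  | tmul h s =>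
    suffices H : incl lam P s ∈ W by
      have h1 := W.smul_mem h H
      have h2 : h • incl lam P s = (Submodule.Quotient.mk (h ⊗ₜ[F] s) : Verma P lam) := by
        refine (Submodule.Quotient.mk_smul _ _ _).symm.trans ?_
        simp [TensorProduct.smul_tmul']
      rwa [h2] at h1
    obtain ⟨s, rfl⟩ := Submodule.Quotient.mk_surjective _ s
    induction s using Finsupp.induction_linear with
    | zero => rw [Submodule.Quotient.mk_zero, map_zero]; exact W.zero_mem
    | add a b ha hb => rw [Submodule.Quotient.mk_add, map_add]; exact W.add_mem ha hb
    | single T a =>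
      induction a using MonoidAlgebra.induction_on with
      | of w =>
        rw [← of_smul_v]
        have := t_smul_mk P w (SpechtMod.v F T)
        change (Submodule.Quotient.mk ((1 : Cherednik P n) ⊗ₜ[F] _) : Verma P lam) ∈ W
        rw [← this]
        exact W.smul_mem _ (Submodule.subset_span ⟨T, rfl⟩)
      | add a b ha hb =>
        rw [Finsupp.single_add, Submodule.Quotient.mk_add, map_add]; exact W.add_mem ha hb
      | smul c a ha =>
        rw [← Finsupp.smul_single, Submodule.Quotient.mk_smul, map_smul]
        exact W.smul_of_tower_mem c ha

end Verma

/-! ### Grading and basis of the Verma module -/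

namespace YoungFamily

variable {F : Type*} [Field F] [Algebra ℂ F] {r : ℕ} [NeZero r] {n : ℕ} {lam : RPartition r n}
  {P : ChParams F r} {N : Type*} [AddCommGroup N] [Module F N] [Module (Cherednik P n) N]
  [IsScalarTower F (Cherednik P n) N] {u : SYT lam → N} (hu : YoungFamily P u)

include hu

theorem diag (T : SYT lam) (i : Fin n) (l : ZMod r) :
    (Cherednik.t (ReflGroup.diagElt i l) : Cherednik P n) • u T = zetaPow F r (l * T.beta i) • u T := by
  have key : ∀ k : ℕ, (Cherednik.t (ReflGroup.diagElt i (k : ZMod r)) : Cherednik P n) • u T =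
      zetaPow F r (k * T.beta i) • u T := by
    intro k
    induction k with
    | zero => simp [ReflGroup.diagElt_zero, Cherednik.t_one, zetaPow_zero]
    | succ k ih =>
      rw [Nat.cast_succ, ReflGroup.diagElt_add, Cherednik.t_mul, mul_smul, hu.zeta, smul_comm, ih,
        smul_smul, add_mul, one_mul, zetaPow_add, mul_comm]
  have := key l.val
  rwa [ZMod.natCast_zmod_val] at this

theorem t_smul_mem (w : ReflGroup r n) (m : N) (hm : m ∈ Submodule.span F (Set.range u)) :
    (Cherednik.t w : Cherednik P n) • m ∈ Submodule.span F (Set.range u) := by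
  set W := Submodule.span F (Set.range u)
  have gen : ∀ a : Cherednik P n, (∀ T, a • u T ∈ W) → ∀ m ∈ W, a • m ∈ W := by
    intro a ha m hm
    induction hm using Submodule.span_induction with
    | mem x hx => obtain ⟨T, rfl⟩ := hx; exact ha T
    | zero => rw [smul_zero]; exact W.zero_mem
    | add x y _ _ hx hy => rw [smul_add]; exact W.add_mem hx hy
    | smul c x _ hx => rw [smul_comm]; exact W.smul_mem c hx
  have hmem : ∀ T, u T ∈ W := fun T => Submodule.subset_span ⟨T, rfl⟩
  induction w using ReflGroup.induction_left with
  | one => rw [Cherednik.t_one, one_smul]; exact hm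
  | diag i l w ih =>
    rw [Cherednik.t_mul, mul_smul]
    exact gen _ (fun T => by rw [hu.diag]; exact W.smul_mem _ (hmem T)) _ ih
  | swap i hi w ih =>
    rw [Cherednik.t_mul, mul_smul]
    refine gen _ (fun T => ?_) _ ih
    rw [hu.swap T i hi]
    refine W.add_mem (W.smul_mem _ (hmem T)) (W.smul_mem _ ?_)
    unfold fillVec
    split_ifs
    · exact hmem _
    · exact W.zero_mem

end YoungFamily

namespace Verma

variable {F : Type*} [Field F] [Algebra ℂ F] {r : ℕ} [NeZero r] {n : ℕ}
  {P : ChParams F r} {lam : RPartition r n}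

theorem deg_zero : Verma.deg P lam 0 = Submodule.span F (Set.range (Verma.v P)) := by
  unfold Verma.deg
  congr 1
  ext m
  constructor
  · rintro ⟨μ, T, hμ, rfl⟩
    have : μ = 0 := by
      funext j
      exact (Finset.sum_eq_zero_iff.mp hμ) j (Finset.mem_univ j)
    subst this
    exact ⟨T, by rw [Cherednik.xMon_zero, one_smul]⟩
  · rintro ⟨T, rfl⟩
    exact ⟨0, T, by simp, by rw [Cherednik.xMon_zero, one_smul]⟩

theorem v_mem_deg (T : SYT lam) : Verma.v P T ∈ Verma.deg P lam 0 := by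
  rw [deg_zero]; exact Submodule.subset_span ⟨T, rfl⟩

theorem xMon_smul_v_mem_deg (μ : Fin n → ℕ) (T : SYT lam) :
    (Cherednik.xMon μ : Cherednik P n) • Verma.v P T ∈ Verma.deg P lam (∑ j, μ j) :=
  Submodule.subset_span ⟨μ, T, rfl, rfl⟩

theorem x_smul_mem_deg (k : Fin n) {d : ℕ} {m : Verma P lam} (hm : m ∈ Verma.deg P lam d) :
    (Cherednik.x k : Cherednik P n) • m ∈ Verma.deg P lam (d + 1) := by
  induction hm using Submodule.span_induction with
  | mem m hm =>
    obtain ⟨μ, T, hμ, rfl⟩ := hm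
    rw [← mul_smul, Cherednik.x_mul_xMon]
    refine Submodule.subset_span ⟨_, T, ?_, rfl⟩
    simp [Finset.sum_add_distrib, hμ]
  | zero => rw [smul_zero]; exact zero_mem _
  | add x y _ _ hx hy => rw [smul_add]; exact add_mem hx hy
  | smul c x _ hx => rw [smul_comm]; exact Submodule.smul_mem _ c hx

/-- A monomial of positive degree has some factor `x_k`, so statements about the graded pieces can
be proved by induction on the degree. -/
theorem deg_succ_le {d : ℕ} {W : Submodule F (Verma P lam)}
    (h : ∀ k, ∀ m ∈ Verma.deg P lam d, (Cherednik.x k : Cherednik P n) • m ∈ W) :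
    Verma.deg P lam (d + 1) ≤ W := by
  refine Submodule.span_le.mpr ?_
  rintro _ ⟨μ, T, hμ, rfl⟩
  obtain ⟨k, hk⟩ : ∃ k, μ k ≠ 0 := by
    by_contra hcon
    push Not at hcon
    simp [hcon] at hμ
  have e : μ = (μ - Pi.single k 1) + Pi.single k 1 := by
    funext j
    by_cases hj : j = k
    · subst hj
      simp only [Pi.add_apply, Pi.sub_apply, Pi.single_eq_same]
      omega
    · simp [Pi.single_eq_of_ne hj]
  rw [e, ← Cherednik.x_mul_xMon, mul_smul]
  refine h k _ (Submodule.subset_span ⟨_, T, ?_, rfl⟩)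
  rw [e] at hμ
  simp only [Pi.add_apply, Finset.sum_add_distrib, Finset.sum_pi_single', Finset.mem_univ,
    if_true] at hμ
  omega

theorem t_smul_mem_deg (w : ReflGroup r n) {d : ℕ} {m : Verma P lam} (hm : m ∈ Verma.deg P lam d) :
    (Cherednik.t w : Cherednik P n) • m ∈ Verma.deg P lam d := by
  induction d generalizing m with
  | zero =>
    rw [deg_zero] at hm ⊢
    exact (youngFamily_v P).t_smul_mem w m hm
  | succ d ih =>
    let W : Submodule F (Verma P lam) := (Verma.deg P lam (d + 1)).comap
      (Module.toModuleEnd F (S := Cherednik P n) (Verma P lam) (Cherednik.t w))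
    suffices H : Verma.deg P lam (d + 1) ≤ W from H hm
    refine deg_succ_le fun k m hm => ?_
    change (Cherednik.t w : Cherednik P n) • ((Cherednik.x k : Cherednik P n) • m) ∈
      Verma.deg P lam (d + 1)
    have := Cherednik.t_mul_x (P := P) w k
    rw [← mul_smul, show (Cherednik.t w : Cherednik P n) * Cherednik.x k = _ from this, smul_assoc,
      mul_smul]
    exact Submodule.smul_mem _ _ (x_smul_mem_deg _ (ih hm))

theorem y_smul_eq_zero (i : Fin n) {m : Verma P lam} (hm : m ∈ Verma.deg P lam 0) :
    (Cherednik.y i : Cherednik P n) • m = 0 := by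
  rw [deg_zero] at hm
  induction hm using Submodule.span_induction with
  | mem m hm => obtain ⟨T, rfl⟩ := hm; exact (youngFamily_v P).y T i
  | zero => rw [smul_zero]
  | add x y _ _ hx hy => rw [smul_add, hx, hy, add_zero]
  | smul c x _ hx => rw [smul_comm, hx, smul_zero]

/-- Moving `y_i` past `x_k` costs only a combination of group elements, and these preserve the
degree. -/
theorem y_smul_mem_deg (i : Fin n) {d : ℕ} {m : Verma P lam} (hm : m ∈ Verma.deg P lam (d + 1)) :
    (Cherednik.y i : Cherednik P n) • m ∈ Verma.deg P lam d := by
  induction d generalizing m with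
  | zero =>
    let W : Submodule F (Verma P lam) := (Verma.deg P lam 0).comap
      (Module.toModuleEnd F (S := Cherednik P n) (Verma P lam) (Cherednik.y i))
    suffices H : Verma.deg P lam (0 + 1) ≤ W from H hm
    refine deg_succ_le fun k m hm => ?_
    change (Cherednik.y i : Cherednik P n) • ((Cherednik.x k : Cherednik P n) • m) ∈
      Verma.deg P lam 0
    rw [← mul_smul, Cherednik.y_mul_x, add_smul, mul_smul, y_smul_eq_zero i hm, smul_zero, zero_add]
    exact Cherednik.commElt_smul_mem _ (fun w m hm => t_smul_mem_deg w hm) i k m hm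
  | succ d ih =>
    let W : Submodule F (Verma P lam) := (Verma.deg P lam (d + 1)).comap
      (Module.toModuleEnd F (S := Cherednik P n) (Verma P lam) (Cherednik.y i))
    suffices H : Verma.deg P lam (d + 1 + 1) ≤ W from H hm
    refine deg_succ_le fun k m hm => ?_
    change (Cherednik.y i : Cherednik P n) • ((Cherednik.x k : Cherednik P n) • m) ∈
      Verma.deg P lam (d + 1)
    rw [← mul_smul, Cherednik.y_mul_x, add_smul, mul_smul]
    exact add_mem (x_smul_mem_deg _ (ih hm))
      (Cherednik.commElt_smul_mem _ (fun w m hm => t_smul_mem_deg w hm) i k m hm)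

theorem iSup_stable {W : Submodule F (Verma P lam)} {a : Cherednik P n}
    (h : ∀ d, ∀ m ∈ Verma.deg P lam d, a • m ∈ W) : ∀ m ∈ ⨆ d, Verma.deg P lam d, a • m ∈ W := by
  intro m hm
  induction hm using Submodule.iSup_induction' with
  | mem d m hm => exact h d m hm
  | zero => rw [smul_zero]; exact W.zero_mem
  | add x y _ _ hx hy => rw [smul_add]; exact W.add_mem hx hy

/-- The sum of the graded pieces is stable under all generators of the algebra and contains the
`v_T`, which generate the module. -/
theorem iSup_deg : ⨆ d, Verma.deg P lam d = ⊤ := by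
  have hle : ∀ d, Verma.deg P lam d ≤ ⨆ d, Verma.deg P lam d := fun d => le_iSup _ d
  have hst := Cherednik.smul_mem_of_stable (P := P) (⨆ d, Verma.deg P lam d)
    (fun i => iSup_stable fun d m hm => hle (d + 1) (x_smul_mem_deg i hm))
    (fun i => iSup_stable fun d m hm => by
      rcases d with _ | d
      · rw [y_smul_eq_zero i hm]; exact zero_mem _
      · exact hle d (y_smul_mem_deg i hm))
    (fun w => iSup_stable fun d m hm => hle d (t_smul_mem_deg w hm))
  rw [eq_top_iff]
  rintro m -
  have hm : m ∈ Submodule.span (Cherednik P n) (Set.range (Verma.v P (lam := lam))) := by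
    rw [span_v_eq_top]; trivial
  induction hm using Submodule.span_induction with
  | mem m hm => obtain ⟨T, rfl⟩ := hm; exact hle 0 (v_mem_deg T)
  | zero => exact zero_mem _
  | add x y _ _ hx hy => exact add_mem hx hy
  | smul c x _ hx => exact hst c x hx

variable (P lam) in
theorem span_monomials : Submodule.span F (Set.range fun b : (Fin n →₀ ℕ) × SYT lam =>
    (Cherednik.xMon b.1 : Cherednik P n) • Verma.v P b.2) = ⊤ := by
  rw [eq_top_iff, ← iSup_deg]
  refine iSup_le fun d => Submodule.span_mono ?_
  rintro _ ⟨μ, T, -, rfl⟩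
  exact ⟨(Finsupp.equivFunOnFinite.symm μ, T), rfl⟩

variable (P lam) in
-- The universal property yields a map to the Dunkl representation on `F[x] ⊗ S^λ`, under which the
-- vectors in question become the tensor product of two known bases. This is what excludes a
-- collapse of the algebra or of `S^λ` under their defining relations.
theorem linearIndependent_monomials : LinearIndependent F fun b : (Fin n →₀ ℕ) × SYT lam =>
    (Cherednik.xMon b.1 : Cherednik P n) • Verma.v P b.2 := by
  obtain ⟨Θ, hx, ht, hy⟩ := exists_dunkl_rep (youngRep F lam) P
  let E := MvPolynomial (Fin n) F ⊗[F] (SYT lam →₀ F)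
  let _ : Module (Cherednik P n) E := Module.compHom E Θ.toRingHom
  have hsm : ∀ (a : Cherednik P n) (m : E), a • m = Θ a m := fun _ _ => rfl
  have _ : IsScalarTower F (Cherednik P n) E := ⟨fun c a m => by
    rw [hsm, hsm, map_smul, LinearMap.smul_apply]⟩
  let u : SYT lam → E := fun T => 1 ⊗ₜ Finsupp.single T 1
  have hu : YoungFamily P u := by
    refine ⟨fun T i => ?_, fun T i hi => ?_, fun T i => ?_⟩
    · rw [hsm, ht, polyT_tmul, map_one, youngRep_diagElt, one_mul, TensorProduct.tmul_smul]
    · rw [hsm, ht, polyT_tmul, map_one, youngRep_adjSwap F lam i hi, TensorProduct.tmul_add,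
        TensorProduct.tmul_smul, TensorProduct.tmul_smul]
      congr 2
      have := map_fillVec (TensorProduct.mk F (MvPolynomial (Fin n) F) (SYT lam →₀ F)
        1).toAddMonoidHom (fun T : SYT lam => Finsupp.single T (1 : F))
        (fun a => T.1 (adjSwap n i a))
      exact this
    · rw [hsm, hy]
  obtain ⟨f, hf⟩ := exists_lift hu
  have hpoly : ∀ (g h : MvPolynomial (Fin n) F) (s : SYT lam →₀ F),
      Θ (Cherednik.poly P n g) (h ⊗ₜ s) = (g * h) ⊗ₜ s := by
    intro g
    induction g using MvPolynomial.induction_on with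
    | C a =>
      intro h s
      rw [← MvPolynomial.algebraMap_eq, AlgHom.commutes, AlgHom.commutes,
        Module.algebraMap_end_apply, ← Algebra.smul_def, TensorProduct.smul_tmul']
    | add p q hp hq =>
      intro h s
      rw [map_add, map_add, LinearMap.add_apply, hp, hq, add_mul, TensorProduct.add_tmul]
    | mul_X p k hp =>
      intro h s
      rw [map_mul, map_mul, Module.End.mul_apply, Cherednik.poly_X, hx, polyX_tmul, hp, mul_assoc]
  have hmon : ∀ b : (Fin n →₀ ℕ) × SYT lam,
      f ((Cherednik.xMon b.1 : Cherednik P n) • Verma.v P b.2) =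
        ((MvPolynomial.basisMonomials (Fin n) F).tensorProduct Finsupp.basisSingleOne) b := by
    rintro ⟨μ, T⟩
    rw [map_smul, hf, hsm, ← Cherednik.poly_prod, hpoly, mul_one, Module.Basis.tensorProduct_apply,
      MvPolynomial.coe_basisMonomials, Finsupp.coe_basisSingleOne]
    change _ = (MvPolynomial.monomial μ (1 : F)) ⊗ₜ[F] _
    rw [MvPolynomial.monomial_eq, map_one, one_mul, Finsupp.prod_fintype _ _ (fun i => pow_zero _)]
  refine LinearIndependent.of_comp (f.restrictScalars F) ?_
  have : (f.restrictScalars F) ∘ (fun b : (Fin n →₀ ℕ) × SYT lam =>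
      (Cherednik.xMon b.1 : Cherednik P n) • Verma.v P b.2) =
      ((MvPolynomial.basisMonomials (Fin n) F).tensorProduct Finsupp.basisSingleOne) :=
    funext hmon
  rw [this]
  exact Module.Basis.linearIndependent _

variable (P lam) in
/-- The monomial basis `x ^ μ v_T` of the Verma module. -/
def basis : Module.Basis ((Fin n →₀ ℕ) × SYT lam) F (Verma P lam) :=
  Module.Basis.mk (linearIndependent_monomials P lam) (span_monomials P lam).ge

theorem basis_apply (b : (Fin n →₀ ℕ) × SYT lam) :
    basis P lam b = (Cherednik.xMon b.1 : Cherednik P n) • Verma.v P b.2 := by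
  rw [basis, Module.Basis.mk_apply]

theorem deg_eq_span_basis (d : ℕ) : Verma.deg P lam d =
    Submodule.span F (basis P lam '' {b | ∑ j, b.1 j = d}) := by
  unfold Verma.deg
  congr 1
  ext m
  constructor
  · rintro ⟨μ, T, hμ, rfl⟩
    exact ⟨(Finsupp.equivFunOnFinite.symm μ, T), hμ, basis_apply _⟩
  · rintro ⟨⟨μ, T⟩, hμ, rfl⟩
    exact ⟨μ, T, hμ, basis_apply _⟩

theorem deg_independent : iSupIndep (Verma.deg P lam) := by
  rw [iSupIndep_def]
  intro d
  simp only [deg_eq_span_basis]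
  rw [← Submodule.span_iUnion₂]
  have : (⋃ j, ⋃ (_ : j ≠ d), basis P lam '' {b | ∑ i, b.1 i = j}) =
      basis P lam '' {b | ∑ i, b.1 i ≠ d} := by
    ext m
    simp only [Set.mem_iUnion, Set.mem_image]
    constructor
    · rintro ⟨j, hj, b, hb, rfl⟩
      exact ⟨b, by rw [Set.mem_ofPred_eq] at hb ⊢; rw [hb]; exact hj, rfl⟩
    · rintro ⟨b, hb, rfl⟩
      exact ⟨_, hb, b, rfl, rfl⟩
  rw [this]
  refine (basis P lam).linearIndependent.disjoint_span_image ?_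
  rw [Set.disjoint_left]
  intro b hb hb'
  exact hb' hb

theorem deg_isInternal : DirectSum.IsInternal (Verma.deg P lam) :=
  DirectSum.isInternal_submodule_of_iSupIndep_of_iSup_eq_top deg_independent iSup_deg

theorem finite_deg (d : ℕ) : Module.Finite F (Verma.deg P lam d) := by
  rw [Module.Finite.iff_fg, deg_eq_span_basis]
  refine Submodule.fg_span (Set.Finite.image _ ?_)
  have h1 : {μ : Fin n →₀ ℕ | ∑ j, μ j = d}.Finite := by
    refine ((Finset.finsuppAntidiag Finset.univ d).finite_toSet).subset fun μ hμ => ?_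
    simpa using hμ
  exact (h1.prod (Set.finite_univ (α := SYT lam))).subset fun b hb => ⟨hb, trivial⟩

end Verma

/-! ### Simultaneous eigenvectors -/

open Classical in
/-- A subspace that is stable under operators contains the partial sums, over the classes of equal
eigenvalues, of its elements that are sums of simultaneous eigenvectors. -/
theorem sum_filter_mem_of_stable {F V ι κ : Type*} [Field F] [AddCommGroup V] [Module F V]
    (N : Submodule F V) (A : κ → V →ₗ[F] V) (hN : ∀ a, ∀ m ∈ N, A a m ∈ N) (χ : κ → ι → F)
    (s : Finset ι) (w : ι → V) (hw : ∀ i ∈ s, ∀ a, A a (w i) = χ a i • w i)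
    (hs : ∑ i ∈ s, w i ∈ N) (i₀ : ι) : ∑ i ∈ s with ∀ a, χ a i = χ a i₀, w i ∈ N := by
  induction s using Finset.strongInduction generalizing w with
  | H s ih =>
    by_cases h : ∀ i ∈ s, ∀ a, χ a i = χ a i₀
    · rwa [Finset.filter_true_of_mem h]
    · push Not at h
      obtain ⟨i₁, hi₁, a, ha⟩ := h
      -- The values on eigenvectors of the interpolation factor `(A_a - χ_a(i₁)) / (χ_a(i₀) -
      -- χ_a(i₁))`. It is `0` at `i₁` and `1` on the class of `i₀`, so it removes one summand and
      -- leaves the wanted partial sum unchanged.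
      let c : ι → F := fun i => (χ a i₀ - χ a i₁)⁻¹ * (χ a i - χ a i₁)
      have h1 : ∑ i ∈ s, c i • w i ∈ N := by
        have := N.smul_mem (χ a i₀ - χ a i₁)⁻¹ (N.sub_mem (hN a _ hs) (N.smul_mem (χ a i₁) hs))
        rw [map_sum, Finset.smul_sum, ← Finset.sum_sub_distrib, Finset.smul_sum] at this
        rw [Finset.sum_congr rfl (g := fun i =>
          (χ a i₀ - χ a i₁)⁻¹ • (A a (w i) - χ a i₁ • w i)) (fun i hi => ?_)]
        · exact this
        · rw [hw i hi, ← sub_smul, smul_smul]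
      have hc1 : c i₁ = 0 := by simp [c]
      rw [← Finset.sum_erase s (a := i₁) (by rw [hc1, zero_smul])] at h1
      have h2 := ih (s.erase i₁) (Finset.erase_ssubset hi₁) (fun i => c i • w i)
        (fun i hi b => by
          rw [map_smul, hw i (Finset.mem_of_mem_erase hi), smul_comm]) h1
      have h3 : (s.erase i₁).filter (fun i => ∀ a, χ a i = χ a i₀) =
          s.filter (fun i => ∀ a, χ a i = χ a i₀) := by
        ext i
        simp only [Finset.mem_filter, Finset.mem_erase]
        refine ⟨fun hh => ⟨hh.1.2, hh.2⟩, fun hh => ⟨⟨?_, hh.1⟩, hh.2⟩⟩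
        rintro rfl
        exact ha (hh.2 a)
      rw [h3] at h2
      rw [Finset.sum_congr rfl (g := fun i => c i • w i) (fun i hi => ?_)]
      · exact h2
      · have : c i = 1 := by
          simp only [c]
          rw [(Finset.mem_filter.mp hi).2 a, inv_mul_cancel₀ (sub_ne_zero.mpr (Ne.symm ha))]
        rw [this, one_smul]

/-! ### Internal direct sums -/

theorem isInternal_of_proj {ι A M : Type*} [Fintype ι] [DecidableEq ι] [Ring A] [AddCommGroup M]
    [Module A M] (N : ι → Submodule A M) (p : ι → M →+ M) (hp : ∀ q m, p q m ∈ N q)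
    (hsum : ∀ m, ∑ q, p q m = m) (h1 : ∀ q, ∀ m ∈ N q, p q m = m)
    (h0 : ∀ q q', q ≠ q' → ∀ m ∈ N q', p q m = 0) : DirectSum.IsInternal N := by
  constructor
  · rw [injective_iff_map_eq_zero]
    intro x hx
    have key : ∀ (q : ι) (x : DirectSum ι fun q => N q),
        p q (DirectSum.coeAddMonoidHom N x) = x q := by
      intro q x
      induction x using DirectSum.induction_on with
      | zero => simp
      | of q' m =>
        rw [DirectSum.coeAddMonoidHom_of]
        by_cases hq : q = q'
        · subst hq
          rw [DirectSum.of_eq_same, h1 q _ m.2]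
        · rw [DirectSum.of_eq_of_ne _ _ _ hq, h0 q q' hq _ m.2, Submodule.coe_zero]
      | add a b ha hb => rw [map_add, map_add, ha, hb, DirectSum.add_apply, Submodule.coe_add]
    ext q
    rw [← key q x, hx, map_zero, DirectSum.zero_apply, Submodule.coe_zero]
  · intro m
    refine ⟨∑ q, DirectSum.of (fun q => N q) q ⟨p q m, hp q m⟩, ?_⟩
    rw [map_sum]
    simp only [DirectSum.coeAddMonoidHom_of]
    exact hsum m

theorem summandProj_apply_of_mem {A M ι : Type*} [Ring A] [AddCommGroup M] [Module A M]
    [DecidableEq ι] {N : ι → Submodule A M} (hN : DirectSum.IsInternal N) (q : ι) (m : N q) :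
    summandProj hN q m = m := by
  have : (LinearEquiv.ofBijective (DirectSum.coeLinearMap N) hN).symm (m : M) =
      DirectSum.lof A ι (fun q => N q) q m := by
    rw [LinearEquiv.symm_apply_eq]
    exact (DirectSum.coeLinearMap_lof N q m).symm
  exact (congrArg (DirectSum.component A ι (fun q => N q) q) this).trans
    (DirectSum.component.lof_self A (M := fun q => N q) q m)

/-- Homomorphisms carry radicals into radicals; this is applied once to the inclusion of the summand
and once to the retraction. -/
theorem jacobson_summand {A M : Type*} [Ring A] [AddCommGroup M] [Module A M] {N : Submodule A M}
    (f : M →ₗ[A] N) (hf : ∀ m : N, f m = m) :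
    Module.jacobson A N = (Module.jacobson A M).map f := by
  refine le_antisymm (fun x hx => ?_) (Module.map_jacobson_le f)
  exact ⟨x, Module.map_jacobson_le N.subtype ⟨x, hx, rfl⟩, hf x⟩

/-! ### Eigenspaces of endomorphisms of finite order -/

section Eigen

variable {F A M : Type*} [Field F] [Ring A] [Algebra F A] [AddCommGroup M] [Module F M]
    [Module A M] [IsScalarTower F A M]

variable (C : M →ₗ[A] M) (N : ℕ)

/-- The projection onto the `c`-eigenspace of an endomorphism with `C ^ N = 1`, if `c ^ N = 1`. -/
def eigProj (c : F) : M →+ M where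
  toFun m := (N : F)⁻¹ • ∑ j ∈ Finset.range N, c⁻¹ ^ j • (C ^ j) m
  map_zero' := by simp
  map_add' a b := by simp [smul_add, Finset.sum_add_distrib]

omit [Algebra F A] [IsScalarTower F A M] in
theorem eigProj_apply (c : F) (m : M) :
    eigProj C N c m = (N : F)⁻¹ • ∑ j ∈ Finset.range N, c⁻¹ ^ j • (C ^ j) m := rfl

theorem eigProj_smul (c : F) (a : A) (m : M) : eigProj C N c (a • m) = a • eigProj C N c m := by
  have hcomm : ∀ (d : F) (a : A) (m : M), d • a • m = a • d • m := fun d a m => by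
    rw [← algebraMap_smul A d, ← algebraMap_smul A d m, smul_smul, smul_smul, Algebra.commutes]
  simp only [eigProj_apply, map_smul, hcomm, Finset.smul_sum]

variable {C N}

theorem eigProj_of_mem (hN : (N : F) ≠ 0) {c : F} (hc : c ≠ 0) {m : M} (hm : C m = c • m) :
    eigProj C N c m = m := by
  have hj : ∀ j : ℕ, (C ^ j) m = c ^ j • m := by
    intro j
    induction j with
    | zero => simp
    | succ j ih => rw [pow_succ', Module.End.mul_apply, ih, LinearMap.map_smul_of_tower, hm,
        smul_smul, pow_succ]
  simp only [eigProj_apply, hj, smul_smul, ← mul_pow, inv_mul_cancel₀ hc, one_pow, one_smul,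
    Finset.sum_const, Finset.card_range]
  rw [← Nat.cast_smul_eq_nsmul F, smul_smul, inv_mul_cancel₀ hN, one_smul]

theorem eigProj_of_mem_ne {c d : F} (hc : c ^ N = 1) (hd : d ^ N = 1) (hcd : c ≠ d) {m : M}
    (hm : C m = d • m) : eigProj C N c m = 0 := by
  have hj : ∀ j : ℕ, (C ^ j) m = d ^ j • m := by
    intro j
    induction j with
    | zero => simp
    | succ j ih => rw [pow_succ', Module.End.mul_apply, ih, LinearMap.map_smul_of_tower, hm,
        smul_smul, pow_succ]
  simp only [eigProj_apply, hj, smul_smul, ← mul_pow]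
  rw [← Finset.sum_smul]
  have h1 : c⁻¹ * d - 1 ≠ 0 := by
    intro h
    -- The value `c = 0` has to be considered because `N = 0` is allowed here, and then `c ^ N = 1`
    -- says nothing.
    rcases eq_or_ne c 0 with h0 | h0
    · subst h0
      rw [inv_zero, zero_mul] at h
      norm_num at h
    · apply hcd
      field_simp at h
      linear_combination -h
  have h2 := geom_sum_mul (c⁻¹ * d) N
  rw [mul_pow, inv_pow, hc, hd, inv_one, one_mul, sub_self] at h2
  rw [(mul_eq_zero.mp h2).resolve_right h1, zero_smul, smul_zero]

/-- Applying `C` raises the summation index by one, and the end terms match because `C ^ N = 1` and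
`c ^ N = 1`. -/
theorem eigProj_mem (hC : C ^ N = 1) {c : F} (hc : c ^ N = 1) (m : M) :
    C (eigProj C N c m) = c • eigProj C N c m := by
  rcases Nat.eq_zero_or_pos N with h0 | hpos
  · subst h0; simp [eigProj_apply]
  have hc0 : c ≠ 0 := fun h => by
    rw [h, zero_pow hpos.ne'] at hc; exact zero_ne_one hc
  rw [eigProj_apply, LinearMap.map_smul_of_tower, smul_comm, map_sum]
  congr 1
  have e : ∀ j, C (c⁻¹ ^ j • (C ^ j) m) = c • (c⁻¹ ^ (j + 1) • (C ^ (j + 1)) m) := by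
    intro j
    rw [LinearMap.map_smul_of_tower, smul_smul, pow_succ' c⁻¹, mul_inv_cancel_left₀ hc0, pow_succ' C,
      Module.End.mul_apply]
  simp only [e]
  rw [← Finset.smul_sum]
  congr 1
  have h1 := Finset.sum_range_succ (fun j => c⁻¹ ^ j • (C ^ j) m) N
  rw [Finset.sum_range_succ', inv_pow c N, hc, hC] at h1
  simpa using h1

omit [Algebra F A] [IsScalarTower F A M] in
-- After exchanging the sums, the geometric sum over `q` vanishes for `0 < j < N`; only the term `j
-- = 0` remains.
theorem sum_eigProj (hN : (N : F) ≠ 0) {ω : F} (hω : IsPrimitiveRoot ω N) (m : M) :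
    ∑ q : Fin N, eigProj C N (ω ^ (q : ℕ)) m = m := by
  simp only [eigProj_apply]
  rw [← Finset.smul_sum, Finset.sum_comm]
  have hpos : 0 < N := Nat.pos_of_ne_zero fun h => hN (by rw [h, Nat.cast_zero])
  have h1 : ∀ j ∈ Finset.range N, ∑ q : Fin N, (ω ^ (q : ℕ))⁻¹ ^ j • (C ^ j) m =
      if j = 0 then (N : F) • m else 0 := by
    intro j hj
    rw [← Finset.sum_smul]
    split_ifs with h
    · subst h; simp
    · have e : ∑ q : Fin N, (ω ^ (q : ℕ))⁻¹ ^ j = ∑ q ∈ Finset.range N, (ω⁻¹ ^ j) ^ q := by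
        rw [Finset.sum_range]
        refine Finset.sum_congr rfl fun q _ => ?_
        rw [← inv_pow, ← pow_mul, ← pow_mul, mul_comm]
      have h2 := geom_sum_mul (ω⁻¹ ^ j) N
      have h3 : (ω⁻¹ ^ j) ^ N = 1 := by
        rw [← pow_mul, mul_comm, pow_mul, inv_pow, hω.pow_eq_one, inv_one, one_pow]
      rw [h3, sub_self] at h2
      have h4 : ω⁻¹ ^ j - 1 ≠ 0 := by
        rw [sub_ne_zero, inv_pow, ne_eq, inv_eq_one]
        exact hω.pow_ne_one_of_pos_of_lt h (Finset.mem_range.mp hj)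
      rw [e, (mul_eq_zero.mp h2).resolve_right h4, zero_smul]
  rw [Finset.sum_congr rfl h1, Finset.sum_ite_eq' (Finset.range N) 0,
    if_pos (Finset.mem_range.mpr hpos), smul_smul, inv_mul_cancel₀ hN, one_smul]

theorem eigenSub_isInternal (hN : (N : F) ≠ 0) (hC : C ^ N = 1) {ω : F} (hω : IsPrimitiveRoot ω N) :
    DirectSum.IsInternal (fun q : Fin N => eigenSub C (ω ^ (q : ℕ))) := by
  have hpow : ∀ q : ℕ, (ω ^ q) ^ N = 1 := fun q => by
    rw [← pow_mul, mul_comm, pow_mul, hω.pow_eq_one, one_pow]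
  have hne : ∀ q : ℕ, ω ^ q ≠ 0 := fun q h => by
    have := hpow q
    rw [h, zero_pow (fun h => hN (by rw [h, Nat.cast_zero]))] at this
    exact zero_ne_one this
  refine isInternal_of_proj _ (fun q => eigProj C N (ω ^ (q : ℕ)))
    (fun q m => eigProj_mem hC (hpow q) m) (sum_eigProj hN hω)
    (fun q m hm => eigProj_of_mem hN (hne q) hm) (fun q q' hq m hm => ?_)
  refine eigProj_of_mem_ne (hpow q) (hpow q') (fun h => hq (Fin.ext ?_)) hm
  exact hω.pow_inj q.2 q'.2 h

end Eigen

/-! ### Radicals over a subalgebra normalized by a unit of finite order -/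

section Clifford

variable {F A M : Type*} [Field F] [Ring A] [Algebra F A] [AddCommGroup M] [Module F M]
    [Module A M] [IsScalarTower F A M]

/-- An algebra `A` is generated by a subalgebra `B` and an element `t` with `t ^ r = 1` that
normalizes `B`, where `r` is invertible. -/
structure CyclicExtension (B : Subalgebra F A) (t : A) (r : ℕ) : Prop where
  gen : Algebra.adjoin F ((B : Set A) ∪ {t}) = ⊤
  pow_eq_one : t ^ r = 1
  cast_ne_zero : (r : F) ≠ 0
  conj_mem : ∀ b ∈ B, ∃ b' ∈ B, t * b = b' * t

namespace CyclicExtension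

variable {B : Subalgebra F A} {t : A} {r : ℕ} (h : CyclicExtension B t r)

include h

theorem pos : 0 < r := Nat.pos_of_ne_zero fun h0 => h.cast_ne_zero (by rw [h0, Nat.cast_zero])

theorem pow_conj_mem (i : ℕ) {b : A} (hb : b ∈ B) : ∃ b' ∈ B, t ^ i * b = b' * t ^ i := by
  induction i with
  | zero => exact ⟨b, hb, by simp⟩
  | succ i ih =>
    obtain ⟨b', hb', e⟩ := ih
    obtain ⟨b'', hb'', e'⟩ := h.conj_mem b' hb'
    exact ⟨b'', hb'', by rw [pow_succ', mul_assoc, e, ← mul_assoc, e', mul_assoc]⟩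

theorem induction {Q : A → Prop} (mem : ∀ b ∈ B, Q b) (ht : Q t)
    (add : ∀ a b, Q a → Q b → Q (a + b)) (mul : ∀ a b, Q a → Q b → Q (a * b)) (a : A) : Q a := by
  have ha : a ∈ Algebra.adjoin F ((B : Set A) ∪ {t}) := by rw [h.gen]; trivial
  induction ha using Algebra.adjoin_induction with
  | mem x hx =>
    rcases hx with hx | hx
    · exact mem x hx
    · rw [Set.mem_singleton_iff.mp hx]; exact ht
  | algebraMap c => exact mem _ (B.algebraMap_mem c)
  | add a b _ _ ha hb => exact add a b ha hb
  | mul a b _ _ ha hb => exact mul a b ha hb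

/-- The largest `A`-submodule contained in a `B`-submodule. -/
def core (N : Submodule B M) : Submodule A M where
  carrier := {m | ∀ i : ℕ, t ^ i • m ∈ N}
  zero_mem' i := by rw [smul_zero]; exact N.zero_mem
  add_mem' ha hb i := by rw [smul_add]; exact N.add_mem (ha i) (hb i)
  smul_mem' a := by
    induction a using h.induction with
    | mem b hb =>
      intro m hm i
      obtain ⟨b', hb', e⟩ := h.pow_conj_mem i hb
      rw [← mul_smul, e, mul_smul]
      exact N.smul_mem ⟨b', hb'⟩ (hm i)
    | ht =>
      intro m hm i
      rw [← mul_smul, ← pow_succ]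
      exact hm (i + 1)
    | add a b ha hb =>
      intro m hm i
      rw [add_smul, smul_add]
      exact N.add_mem (ha hm i) (hb hm i)
    | mul a b ha hb =>
      intro m hm
      rw [mul_smul]
      exact ha (hb hm)

omit [Module F M] [IsScalarTower F A M] in
theorem mem_core {N : Submodule B M} {m : M} : m ∈ h.core N ↔ ∀ i : ℕ, t ^ i • m ∈ N := Iff.rfl

omit [Module F M] [IsScalarTower F A M] in
theorem mem_of_mem_core {N : Submodule B M} {m : M} (hm : m ∈ h.core N) : m ∈ N := by
  simpa using hm 0

/-- The preimage of a `B`-submodule under `t ^ i`. -/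
def twist (i : ℕ) (N : Submodule B M) : Submodule B M where
  carrier := {m | t ^ i • m ∈ N}
  zero_mem' := by simp
  add_mem' ha hb := by
    simp only [Set.mem_ofPred_eq, smul_add] at *
    exact N.add_mem ha hb
  smul_mem' b m hm := by
    obtain ⟨b', hb', e⟩ := h.pow_conj_mem i b.2
    change t ^ i • (b : A) • m ∈ N
    rw [← mul_smul, e, mul_smul]
    exact N.smul_mem ⟨b', hb'⟩ hm

omit [Module F M] [IsScalarTower F A M] in
theorem mem_twist {i : ℕ} {N : Submodule B M} {m : M} : m ∈ h.twist i N ↔ t ^ i • m ∈ N := Iff.rfl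

theorem twist_twist {i j : ℕ} (hij : t ^ (i + j) = 1) (N : Submodule B M) :
    h.twist i (h.twist j N) = N := by
  ext m
  rw [mem_twist, mem_twist, ← mul_smul, ← pow_add, add_comm, hij, one_smul]

theorem exists_pow_add (i : ℕ) : ∃ j, t ^ (i + j) = 1 ∧ t ^ (j + i) = 1 := by
  refine ⟨(r - 1) * i, ?_⟩
  have h1 : i + (r - 1) * i = r * i := by
    have := h.pos
    rw [← Nat.succ_pred_eq_of_pos this]
    simp only [Nat.succ_eq_add_one, Nat.add_sub_cancel]
    ring
  rw [add_comm _ i, h1, pow_mul, h.pow_eq_one, one_pow]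
  exact ⟨rfl, rfl⟩

/-- Since `t` is invertible, taking preimages under `t ^ i` is an automorphism of the lattice of
`B`-submodules. -/
theorem isCoatom_twist {N : Submodule B M} (hN : IsCoatom N) (i : ℕ) : IsCoatom (h.twist i N) := by
  obtain ⟨j, hj, hj'⟩ := h.exists_pow_add i
  have hle : ∀ i (N N' : Submodule B M), N ≤ N' → h.twist i N ≤ h.twist i N' :=
    fun i N N' hNN' m hm => hNN' hm
  have htop : ∀ i, h.twist i (⊤ : Submodule B M) = ⊤ := fun i => rfl
  let e : Submodule B M ≃o Submodule B M :=
    { toFun := h.twist i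
      invFun := h.twist j
      left_inv := fun N => h.twist_twist hj' N
      right_inv := fun N => h.twist_twist hj N
      map_rel_iff' := fun {N N'} => ⟨fun hh => by
        have := hle j _ _ hh
        simpa only [Equiv.coe_fn_mk, h.twist_twist hj'] using this, fun hh => hle i _ _ hh⟩ }
  exact (e.isCoatom_iff N).mpr hN

theorem smul_mem_jacobson (i : ℕ) {m : M} (hm : m ∈ Module.jacobson B M) :
    t ^ i • m ∈ Module.jacobson B M := by
  rw [Module.jacobson, Submodule.mem_sInf] at *
  intro N hN
  exact hm (h.twist i N) (h.isCoatom_twist hN i)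

/-- A module that is semisimple over `B` is semisimple over `A`. -/
theorem isSemisimpleModule [IsSemisimpleModule B M] : IsSemisimpleModule A M := by
  rw [isSemisimpleModule_iff]
  refine ⟨fun W => ?_⟩
  obtain ⟨U, hU⟩ := exists_isCompl (W.restrictScalars B)
  let π : M →ₗ[B] M := (W.restrictScalars B).subtype ∘ₗ Submodule.projectionOnto _ U hU
  have hπ : ∀ m, π m ∈ W := fun m => (Submodule.projectionOnto _ U hU m).2
  have hπ' : ∀ m ∈ W, π m = m := fun m hm =>
    congrArg Subtype.val (Submodule.projectionOnto_apply_left hU ⟨m, hm⟩)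
  have hcomm : ∀ (d : F) (a : A) (m : M), d • a • m = a • d • m := fun d a m => by
    rw [← algebraMap_smul A d, ← algebraMap_smul A d m, smul_smul, smul_smul, Algebra.commutes]
  have hπB : ∀ b ∈ B, ∀ m, π (b • m) = b • π m := fun b hb m => π.map_smul (⟨b, hb⟩ : B) m
  obtain ⟨s, hs, hs'⟩ : ∃ s : A, t * s = 1 ∧ s * t = 1 := by
    obtain ⟨j, hj, hj'⟩ := h.exists_pow_add 1
    exact ⟨t ^ j, by rw [← pow_succ', add_comm, hj], by rw [← pow_succ, hj']⟩
  have hcst : Commute s t := by rw [commute_iff_eq, hs, hs']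
  have hst : ∀ i, s ^ i * t ^ i = 1 := fun i => by rw [← hcst.mul_pow, hs', one_pow]
  have hts : ∀ i, t ^ i * s ^ i = 1 := fun i => by rw [← hcst.symm.mul_pow, hs, one_pow]
  -- Maschke's averaging with `s = t⁻¹`: the mean of the conjugates `t^{-i} π t^i` of a `B`-linear
  -- projection is linear over `B`, commutes with `t` because `t ^ r = 1`, and still restricts to
  -- the identity on the `t`-stable submodule `W`.
  let g : M → ℕ → M := fun m i => s ^ i • π (t ^ i • m)
  have hsr : s ^ r = 1 := by
    have := hst r
    rwa [h.pow_eq_one, mul_one] at this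
  have hshift : ∀ m : M, ∑ i ∈ Finset.range r, g m (i + 1) = ∑ i ∈ Finset.range r, g m i := by
    intro m
    have h1 := Finset.sum_range_succ (g m) r
    rw [Finset.sum_range_succ'] at h1
    have h2 : g m r = g m 0 := by simp [g, h.pow_eq_one, hsr]
    rw [h2] at h1
    exact add_right_cancel h1
  let f0 : M → M := fun m => (r : F)⁻¹ • ∑ i ∈ Finset.range r, g m i
  have hf0 : ∀ m m' : M, f0 (m + m') = f0 m + f0 m' := fun m m' => by
    simp only [f0, g, smul_add, map_add, Finset.sum_add_distrib]
  have hf1 : ∀ (a : A) (m : M), f0 (a • m) = a • f0 m := by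
    intro a
    induction a using h.induction with
    | mem b hb =>
      intro m
      simp only [f0]
      rw [← hcomm, Finset.smul_sum (r := b)]
      congr 1
      refine Finset.sum_congr rfl fun i _ => ?_
      simp only [g]
      obtain ⟨b', hb', e⟩ := h.pow_conj_mem i hb
      have e' : s ^ i * b' = b * s ^ i := by
        calc s ^ i * b' = s ^ i * (b' * t ^ i) * s ^ i := by
              rw [mul_assoc, mul_assoc, hts, mul_one]
          _ = b * s ^ i := by rw [← e, ← mul_assoc, hst, one_mul]
      rw [← mul_smul, e, mul_smul, hπB b' hb', ← mul_smul, e', mul_smul]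
    | ht =>
      intro m
      simp only [f0]
      rw [← hcomm, ← hshift m, Finset.smul_sum (r := t)]
      congr 1
      refine Finset.sum_congr rfl fun i _ => ?_
      simp only [g]
      rw [← mul_smul, ← pow_succ, pow_succ' s, mul_smul s, ← mul_smul t, hs, one_smul]
    | add a b ha hb => intro m; rw [add_smul, hf0, ha, hb, add_smul]
    | mul a b ha hb => intro m; rw [mul_smul, ha, hb, mul_smul]
  have hf2 : ∀ m : M, f0 m ∈ W := fun m =>
    W.smul_of_tower_mem _ (W.sum_mem fun i _ => W.smul_mem _ (hπ _))
  have hf3 : ∀ m ∈ W, f0 m = m := fun m hm => by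
    simp only [f0, g]
    rw [Finset.sum_congr rfl (g := fun _ => m) (fun i _ => by
      rw [hπ' _ (W.smul_mem _ hm), ← mul_smul, hst, one_smul])]
    rw [Finset.sum_const, Finset.card_range, ← Nat.cast_smul_eq_nsmul F, smul_smul,
      inv_mul_cancel₀ h.cast_ne_zero, one_smul]
  let f : M →ₗ[A] W :=
    { toFun := fun m => ⟨f0 m, hf2 m⟩
      map_add' := fun m m' => Subtype.ext (hf0 m m')
      map_smul' := fun a m => Subtype.ext (hf1 a m) }
  exact ⟨LinearMap.ker f, LinearMap.isCompl_of_proj fun x => Subtype.ext (hf3 x x.2)⟩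

/-- The quotient of `M` by the core embeds in the finite product of the simple `B`-modules `M /
twist i N`. So it is semisimple over `B`, hence over `A`, and its radical is zero. -/
theorem jacobson_le_core {N : Submodule B M} (hN : IsCoatom N) :
    Module.jacobson A M ≤ h.core N := by
  refine Module.jacobson_le_of_eq_bot ?_
  suffices IsSemisimpleModule A (M ⧸ h.core N) from IsSemisimpleModule.jacobson_eq_bot _ _
  suffices IsSemisimpleModule B (M ⧸ h.core N) from h.isSemisimpleModule
  have hsimple : ∀ i : Fin r, IsSimpleModule B (M ⧸ h.twist (i : ℕ) N) := fun i =>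
    isSimpleModule_iff_isCoatom.mpr (h.isCoatom_twist hN i)
  let q : M →ₗ[B] ∀ i : Fin r, M ⧸ h.twist (i : ℕ) N :=
    LinearMap.pi fun i => Submodule.mkQ _
  have hker : LinearMap.ker q = (h.core N).restrictScalars B := by
    ext m
    rw [LinearMap.mem_ker, Submodule.restrictScalars_mem, mem_core]
    constructor
    · intro hm i
      have h1 := congrFun hm ⟨i % r, Nat.mod_lt _ h.pos⟩
      have h2 : m ∈ h.twist (i % r) N := (Submodule.Quotient.mk_eq_zero _).mp h1
      rw [mem_twist] at h2
      rwa [pow_eq_pow_mod i h.pow_eq_one]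
    · intro hm
      funext i
      exact (Submodule.Quotient.mk_eq_zero _).mpr (hm i)
  let e : (M ⧸ h.core N) →ₗ[B] ∀ i : Fin r, M ⧸ h.twist (i : ℕ) N :=
    ((h.core N).restrictScalars B).liftQ q hker.ge
  refine IsSemisimpleModule.of_injective e ?_
  rw [injective_iff_map_eq_zero]
  intro m hm
  obtain ⟨m, rfl⟩ := Submodule.Quotient.mk_surjective _ m
  have h1 : m ∈ LinearMap.ker q := hm
  rw [hker] at h1
  exact (Submodule.Quotient.mk_eq_zero _).mpr h1

/-- One inclusion holds because the core of a maximal `B`-submodule lies in that submodule. For the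
other, finiteness puts a maximal `A`-submodule inside a maximal `B`-submodule, whose core it must
equal; the radical over `B` is stable under `t`, so it lies in this core. -/
theorem jacobson_eq [Module.Finite B M] :
    (Module.jacobson A M).restrictScalars B = Module.jacobson B M := by
  refine le_antisymm (fun m hm => ?_) (fun m hm => ?_)
  · rw [Module.jacobson, Submodule.mem_sInf]
    intro N hN
    exact h.mem_of_mem_core (h.jacobson_le_core hN hm)
  · rw [Submodule.restrictScalars_mem, Module.jacobson, Submodule.mem_sInf]
    intro N hN
    obtain ⟨N', hN', hle⟩ := (eq_top_or_exists_le_coatom (N.restrictScalars B)).resolve_left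
      (fun e => hN.1 (by
        rw [eq_top_iff]
        intro m _
        have : m ∈ N.restrictScalars B := by rw [e]; trivial
        exact this))
    have hNc : N ≤ h.core N' := fun x hx i => hle (N.smul_mem _ hx)
    have hne : h.core N' ≠ ⊤ := fun e => hN'.1 (by
      rw [eq_top_iff]
      intro m _
      exact h.mem_of_mem_core (by rw [e]; trivial))
    have heq : h.core N' = N := by
      by_contra hcon
      exact hne (hN.2 _ (lt_of_le_of_ne hNc (Ne.symm hcon)))
    rw [← heq]
    intro i
    have := h.smul_mem_jacobson i hm
    rw [Module.jacobson, Submodule.mem_sInf] at this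
    exact this N' hN'

end CyclicExtension

end Clifford

/-! ### The algebra `ℍ_p` -/

theorem natCast_ne_zero_of_dvd (F : Type*) [Field F] [Algebra ℂ F] {r p : ℕ} [NeZero r] (hp : p ∣ r) :
    (p : F) ≠ 0 := by
  have : CharZero F := charZero_of_injective_algebraMap (algebraMap ℂ F).injective
  exact Nat.cast_ne_zero.mpr fun h => NeZero.ne r (by rw [h] at hp; exact Nat.eq_zero_of_zero_dvd hp)

theorem natCast_div_mul_eq_zero_iff {r p : ℕ} [NeZero r] (hp : p ∣ r) (l : ℕ) :
    ((r / p : ℕ) : ZMod r) * (l : ZMod r) = 0 ↔ p ∣ l := by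
  rw [← Nat.cast_mul, ZMod.natCast_eq_zero_iff]
  obtain ⟨q, rfl⟩ := hp
  have hr := NeZero.ne (p * q)
  have hp : 0 < p := Nat.pos_of_ne_zero (left_ne_zero_of_mul hr)
  have hq : 0 < q := Nat.pos_of_ne_zero (right_ne_zero_of_mul hr)
  rw [Nat.mul_div_cancel_left _ hp, mul_comm p q]
  exact Nat.mul_dvd_mul_iff_left hq

namespace Cherednik

variable {F : Type*} [Field F] [Algebra ℂ F] {r : ℕ} [NeZero r] {P : ChParams F r} {n p : ℕ}

theorem t_diagElt_pow (i : Fin n) (l : ℕ) :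
    (t (ReflGroup.diagElt i 1) : Cherednik P n) ^ l = t (ReflGroup.diagElt i (l : ZMod r)) := by
  have := (tHom P).map_pow (ReflGroup.diagElt i (1 : ZMod r)) l
  rw [← ReflGroup.diagElt_natCast_mul, mul_one] at this
  exact this.symm

theorem t_diagElt_neg_mul (i : Fin n) (l : ZMod r) :
    (t (ReflGroup.diagElt i (-l)) : Cherednik P n) * t (ReflGroup.diagElt i l) = 1 := by
  rw [← t_mul, ← ReflGroup.diagElt_add, neg_add_cancel, ReflGroup.diagElt_zero, t_one]

theorem t_diagElt_mul_neg (i : Fin n) (l : ZMod r) :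
    (t (ReflGroup.diagElt i l) : Cherednik P n) * t (ReflGroup.diagElt i (-l)) = 1 := by
  rw [← t_mul, ← ReflGroup.diagElt_add, add_neg_cancel, ReflGroup.diagElt_zero, t_one]

section Alpha

variable (hd : ∀ i : ZMod r, P.d (i + ((r / p : ℕ) : ZMod r)) = P.d i)

theorem alpha_mk (a : FreeAlgebra F (ChGen r n)) :
    alpha P n p hd (mk P n a) = FreeAlgebra.lift F (alphaGen P n p) a :=
  RingQuot.liftAlgHom_mkAlgHom_apply F _ _ a

theorem alpha_x (i : Fin n) : alpha P n p hd (x i) = x i := by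
  rw [x, alpha_mk, FreeAlgebra.lift_ι_apply]; rfl

theorem alpha_y (i : Fin n) : alpha P n p hd (y i) = y i := by
  rw [y, alpha_mk, FreeAlgebra.lift_ι_apply]; rfl

theorem alpha_t (w : ReflGroup r n) : alpha P n p hd (t w) =
    zetaPow F r (((r / p : ℕ) : ZMod r) * w.totalExpo) • t w := by
  rw [t, alpha_mk, FreeAlgebra.lift_ι_apply]; rfl

theorem alpha_pow_apply_eq {h : Cherednik P n} (hh : alpha P n p hd h = h) (j : ℕ) :
    (alpha P n p hd ^ j) h = h := by
  induction j with
  | zero => simp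
  | succ j ih => rw [pow_succ', AlgHom.mul_apply, ih, hh]

theorem alpha_pow_t (j : ℕ) (w : ReflGroup r n) : (alpha P n p hd ^ j) (t w) =
    zetaPow F r (j * (((r / p : ℕ) : ZMod r) * w.totalExpo)) • t w := by
  rw [zetaPow_nsmul]
  induction j with
  | zero => simp
  | succ j ih => rw [pow_succ', AlgHom.mul_apply, ih, map_smul, alpha_t, smul_smul, pow_succ]

theorem alpha_pow_eq_one (hp : p ∣ r) : alpha P n p hd ^ p = 1 := by
  refine AlgHom.ext fun h => ?_
  induction h using Cherednik.induction with
  | scalar c => simp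
  | x i => exact alpha_pow_apply_eq hd (alpha_x hd i) p
  | y i => exact alpha_pow_apply_eq hd (alpha_y hd i) p
  | t w =>
    rw [alpha_pow_t, ← mul_assoc, ← Nat.cast_mul, Nat.mul_div_cancel' hp, ZMod.natCast_self,
      zero_mul, zetaPow_zero, one_smul]
    rfl
  | add a b ha hb => rw [map_add, ha, hb, map_add]
  | mul a b ha hb => rw [map_mul, ha, hb, map_mul]

theorem mem_fixedAlg {h : Cherednik P n} : h ∈ fixedAlg P n p hd ↔ alpha P n p hd h = h := Iff.rfl

theorem x_mem_fixedAlg (i : Fin n) : x i ∈ fixedAlg P n p hd := alpha_x hd i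

theorem y_mem_fixedAlg (i : Fin n) : y i ∈ fixedAlg P n p hd := alpha_y hd i

theorem t_mem_fixedAlg {w : ReflGroup r n} (hw : w ∈ ReflGroup.subgroupP r p n) :
    t w ∈ fixedAlg P n p hd := by
  have hw' : ((r / p : ℕ) : ZMod r) * w.totalExpo = 0 := hw
  rw [mem_fixedAlg, alpha_t, hw', zetaPow_zero, one_smul]

theorem t_mem_fixedAlg_of_totalExpo {w : ReflGroup r n} (hw : w.totalExpo = 0) :
    t w ∈ fixedAlg P n p hd :=
  t_mem_fixedAlg hd (show ((r / p : ℕ) : ZMod r) * w.totalExpo = 0 by rw [hw, mul_zero])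

theorem xMon_mem_fixedAlg (μ : Fin n → ℕ) : xMon μ ∈ fixedAlg P n p hd :=
  list_prod_mem fun a ha => by
    obtain ⟨i, rfl⟩ := (List.mem_ofFn' _ _).mp ha
    exact pow_mem (x_mem_fixedAlg hd i) _

end Alpha

variable (P n p) in
/-- The subalgebra generated by the `x_i`, the `y_i` and the `t_w` with `w` in `G(r,p,n)`. -/
def genAlg : Subalgebra F (Cherednik P n) :=
  Algebra.adjoin F (Set.range x ∪ Set.range y ∪ t '' ReflGroup.subgroupP r p n)

theorem x_mem_genAlg (i : Fin n) : x i ∈ genAlg P n p :=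
  Algebra.subset_adjoin (Or.inl (Or.inl ⟨i, rfl⟩))

theorem y_mem_genAlg (i : Fin n) : y i ∈ genAlg P n p :=
  Algebra.subset_adjoin (Or.inl (Or.inr ⟨i, rfl⟩))

theorem t_mem_genAlg {w : ReflGroup r n} (hw : ((r / p : ℕ) : ZMod r) * w.totalExpo = 0) :
    t w ∈ genAlg P n p :=
  Algebra.subset_adjoin (Or.inr ⟨w, hw, rfl⟩)

theorem t_eq_mul_diagElt (o : Fin n) (w : ReflGroup r n) : (t w : Cherednik P n) =
    t (w * ReflGroup.diagElt o (-w.totalExpo)) * t (ReflGroup.diagElt o 1) ^ w.totalExpo.val := by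
  rw [t_diagElt_pow, ZMod.natCast_rightInverse, ← t_mul, mul_assoc, ← ReflGroup.diagElt_add,
    neg_add_cancel, ReflGroup.diagElt_zero, mul_one]

omit [NeZero r] in
theorem totalExpo_mul_diagElt_neg (o : Fin n) (w : ReflGroup r n) :
    (w * ReflGroup.diagElt o (-w.totalExpo)).totalExpo = 0 := by
  rw [ReflGroup.totalExpo_mul, ReflGroup.totalExpo_diagElt, add_neg_cancel]

theorem diagElt_conj_genAlg (o : Fin n) {a : Cherednik P n} (ha : a ∈ genAlg P n p) :
    ∃ a' ∈ genAlg P n p, t (ReflGroup.diagElt o 1) * a = a' * t (ReflGroup.diagElt o 1) := by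
  induction ha using Algebra.adjoin_induction with
  | mem a ha =>
    rcases ha with (⟨i, rfl⟩ | ⟨i, rfl⟩) | ⟨w, hw, rfl⟩
    · refine ⟨_, (genAlg P n p).smul_mem (x_mem_genAlg ((ReflGroup.diagElt o (1 : ZMod r)).right i))
        (zetaPow F r (-((ReflGroup.diagElt o (1 : ZMod r)).expo ((ReflGroup.diagElt o (1 : ZMod r)).right i)))), ?_⟩
      rw [smul_mul_assoc]
      exact t_mul_x (P := P) (ReflGroup.diagElt o 1) i
    · refine ⟨_, (genAlg P n p).smul_mem (y_mem_genAlg ((ReflGroup.diagElt o (1 : ZMod r)).right i))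
        (zetaPow F r (((ReflGroup.diagElt o (1 : ZMod r)).expo ((ReflGroup.diagElt o (1 : ZMod r)).right i)))), ?_⟩
      rw [smul_mul_assoc]
      exact t_mul_y (P := P) (ReflGroup.diagElt o 1) i
    · refine ⟨t (ReflGroup.diagElt o 1 * w * ReflGroup.diagElt o (-1)), t_mem_genAlg ?_, ?_⟩
      · rw [ReflGroup.totalExpo_mul, ReflGroup.totalExpo_mul, ReflGroup.totalExpo_diagElt,
          ReflGroup.totalExpo_diagElt, add_comm (1 : ZMod r), add_neg_cancel_right]
        exact hw
      · rw [t_mul, t_mul, mul_assoc, t_diagElt_neg_mul, mul_one]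
  | algebraMap c => exact ⟨_, (genAlg P n p).algebraMap_mem c, (Algebra.commutes _ _).symm⟩
  | add a b _ _ ha hb =>
    obtain ⟨a', ha', ea⟩ := ha
    obtain ⟨b', hb', eb⟩ := hb
    exact ⟨a' + b', add_mem ha' hb', by rw [mul_add, ea, eb, add_mul]⟩
  | mul a b _ _ ha hb =>
    obtain ⟨a', ha', ea⟩ := ha
    obtain ⟨b', hb', eb⟩ := hb
    exact ⟨a' * b', mul_mem ha' hb', by rw [← mul_assoc, ea, mul_assoc, eb, mul_assoc]⟩

/-- The span is stable under left multiplication by every generator: `t_{ζ_o}` normalizes the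
subalgebra, and each `t_w` is an element of the subalgebra times a power of `t_{ζ_o}`. -/
theorem span_genAlg_mul_diagElt (o : Fin n) : Submodule.span F {h : Cherednik P n |
    ∃ a ∈ genAlg P n p, ∃ l : ℕ, h = a * t (ReflGroup.diagElt o 1) ^ l} = ⊤ := by
  set W := Submodule.span F {h : Cherednik P n |
    ∃ a ∈ genAlg P n p, ∃ l : ℕ, h = a * t (ReflGroup.diagElt o 1) ^ l}
  have key : ∀ g : Cherednik P n, (∀ a ∈ genAlg P n p, ∀ l : ℕ,
      g * (a * t (ReflGroup.diagElt o 1) ^ l) ∈ W) → ∀ m ∈ W, g * m ∈ W := by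
    intro g hg m hm
    induction hm using Submodule.span_induction with
    | mem m hm => obtain ⟨a, ha, l, rfl⟩ := hm; exact hg a ha l
    | zero => rw [mul_zero]; exact W.zero_mem
    | add a b _ _ ha hb => rw [mul_add]; exact W.add_mem ha hb
    | smul c a _ ha => rw [mul_smul_comm]; exact W.smul_mem c ha
  have hA : ∀ b ∈ genAlg P n p, ∀ m ∈ W, b * m ∈ W := fun b hb => key b fun a ha l =>
    Submodule.subset_span ⟨b * a, mul_mem hb ha, l, by rw [mul_assoc]⟩
  have hτ : ∀ m ∈ W, t (ReflGroup.diagElt o 1) * m ∈ W := key _ fun a ha l => by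
    obtain ⟨a', ha', e⟩ := diagElt_conj_genAlg o ha
    exact Submodule.subset_span ⟨a', ha', l + 1, by rw [← mul_assoc, e, mul_assoc, pow_succ']⟩
  have hτl : ∀ l : ℕ, ∀ m ∈ W, t (ReflGroup.diagElt o 1) ^ l * m ∈ W := by
    intro l
    induction l with
    | zero => intro m hm; rwa [pow_zero, one_mul]
    | succ l ih => intro m hm; rw [pow_succ', mul_assoc]; exact hτ _ (ih m hm)
  have hall : ∀ h : Cherednik P n, ∀ m ∈ W, h • m ∈ W := smul_mem_of_stable W
    (fun i m hm => hA _ (x_mem_genAlg i) m hm) (fun i m hm => hA _ (y_mem_genAlg i) m hm)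
    (fun w m hm => by
      rw [smul_eq_mul, t_eq_mul_diagElt o w, mul_assoc]
      refine hA _ (t_mem_genAlg ?_) _ (hτl _ m hm)
      rw [totalExpo_mul_diagElt_neg, mul_zero])
  rw [eq_top_iff]
  rintro h -
  have := hall h 1 (Submodule.subset_span ⟨1, one_mem _, 0, by simp⟩)
  rwa [smul_eq_mul, mul_one] at this

variable (hd : ∀ i : ZMod r, P.d (i + ((r / p : ℕ) : ZMod r)) = P.d i)

theorem genAlg_le_fixedAlg : genAlg P n p ≤ fixedAlg P n p hd := by
  refine Algebra.adjoin_le ?_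
  rintro _ ((⟨i, rfl⟩ | ⟨i, rfl⟩) | ⟨w, hw, rfl⟩)
  · exact x_mem_fixedAlg hd i
  · exact y_mem_fixedAlg hd i
  · exact t_mem_fixedAlg hd hw

/-- Averaging over the powers of `α` fixes every invariant. On the spanning products `a * t_{ζ_o}^l`
it is a geometric sum of roots of unity, which vanishes unless `p ∣ l`; in that case `ζ_o^l` lies in
`G(r,p,n)`. -/
theorem fixedAlg_eq_genAlg (hp : p ∣ r) (hn : 0 < n) : fixedAlg P n p hd = genAlg P n p := by
  refine le_antisymm ?_ (genAlg_le_fixedAlg hd)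
  let o : Fin n := ⟨0, hn⟩
  have hpF := natCast_ne_zero_of_dvd F hp
  let e : Cherednik P n →ₗ[F] Cherednik P n :=
    (p : F)⁻¹ • ∑ j ∈ Finset.range p, (alpha P n p hd ^ j).toLinearMap
  have he : ∀ h, e h = (p : F)⁻¹ • ∑ j ∈ Finset.range p, (alpha P n p hd ^ j) h := fun h => by
    simp [e]
  have hle : (⊤ : Submodule F (Cherednik P n)) ≤ (Subalgebra.toSubmodule (genAlg P n p)).comap e := by
    rw [← span_genAlg_mul_diagElt (P := P) (p := p) o]
    refine Submodule.span_le.mpr ?_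
    rintro _ ⟨a, ha, l, rfl⟩
    change e _ ∈ genAlg P n p
    have hα : ∀ j : ℕ, (alpha P n p hd ^ j) (a * t (ReflGroup.diagElt o 1) ^ l) =
        zetaPow F r (((r / p : ℕ) : ZMod r) * l) ^ j • (a * t (ReflGroup.diagElt o 1) ^ l) := by
      intro j
      rw [map_mul, alpha_pow_apply_eq hd (genAlg_le_fixedAlg hd ha), t_diagElt_pow, alpha_pow_t,
        ReflGroup.totalExpo_diagElt, zetaPow_nsmul, mul_smul_comm]
    rw [he]
    simp only [hα]
    rw [← Finset.sum_smul]
    by_cases hl : p ∣ l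
    · refine Subalgebra.smul_mem _ (Subalgebra.smul_mem _ (mul_mem ha ?_) _) _
      rw [t_diagElt_pow]
      refine t_mem_genAlg ?_
      rw [ReflGroup.totalExpo_diagElt, natCast_div_mul_eq_zero_iff hp]
      exact hl
    · have h1 := geom_sum_mul (zetaPow F r (((r / p : ℕ) : ZMod r) * l)) p
      rw [← zetaPow_nsmul, ← mul_assoc, ← Nat.cast_mul p, Nat.mul_div_cancel' hp, ZMod.natCast_self,
        zero_mul, zetaPow_zero, sub_self] at h1
      have h2 : zetaPow F r (((r / p : ℕ) : ZMod r) * l) - 1 ≠ 0 := by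
        rw [sub_ne_zero, ne_eq, zetaPow_eq_one_iff, natCast_div_mul_eq_zero_iff hp]
        exact hl
      rw [(mul_eq_zero.mp h1).resolve_right h2, zero_smul, smul_zero]
      exact zero_mem _
  intro h hh
  have h1 : e h ∈ genAlg P n p := hle (Submodule.mem_top (x := h))
  rw [he] at h1
  simp only [alpha_pow_apply_eq hd hh, Finset.sum_const, Finset.card_range] at h1
  rwa [← Nat.cast_smul_eq_nsmul F, smul_smul, inv_mul_cancel₀ hpF, one_smul] at h1

theorem cyclicExtension_fixedAlg (o : Fin n) :
    CyclicExtension (fixedAlg P n p hd) (t (ReflGroup.diagElt o 1)) r where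
  gen := by
    rw [eq_top_iff]
    rintro h -
    set A := Algebra.adjoin F ((fixedAlg P n p hd : Set (Cherednik P n)) ∪
      {t (ReflGroup.diagElt o 1)})
    have hB : ∀ b ∈ fixedAlg P n p hd, b ∈ A := fun b hb => Algebra.subset_adjoin (Or.inl hb)
    have hτ : t (ReflGroup.diagElt o 1) ∈ A := Algebra.subset_adjoin (Or.inr rfl)
    induction h using Cherednik.induction with
    | scalar c => exact A.algebraMap_mem c
    | x i => exact hB _ (x_mem_fixedAlg hd i)
    | y i => exact hB _ (y_mem_fixedAlg hd i)
    | t w =>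
      rw [t_eq_mul_diagElt o w]
      exact mul_mem (hB _ (t_mem_fixedAlg_of_totalExpo hd (totalExpo_mul_diagElt_neg o w)))
        (pow_mem hτ _)
    | add a b ha hb => exact add_mem ha hb
    | mul a b ha hb => exact mul_mem ha hb
  pow_eq_one := by rw [t_diagElt_pow, ZMod.natCast_self, ReflGroup.diagElt_zero, t_one]
  cast_ne_zero := natCast_ne_zero_of_dvd F dvd_rfl
  conj_mem b hb := by
    refine ⟨t (ReflGroup.diagElt o 1) * b * t (ReflGroup.diagElt o (-1)), ?_, ?_⟩
    · rw [mem_fixedAlg] at *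
      rw [map_mul, map_mul, hb, alpha_t, alpha_t, ReflGroup.totalExpo_diagElt,
        ReflGroup.totalExpo_diagElt, smul_mul_assoc, smul_mul_smul_comm, mul_neg, zetaPow_mul_neg,
        one_smul]
    · rw [mul_assoc, t_diagElt_neg_mul, mul_one]

/-- All monomials in the `x_i` lie in `ℍ_p`, so the finitely many `v_T` still generate. This
provides the finiteness needed to compare radicals. -/
instance finite_fixedAlg (lam : RPartition r n) :
    Module.Finite (fixedAlg P n p hd) (Verma P lam) := by
  refine ⟨Submodule.fg_def.mpr ⟨Set.range (Verma.v P), Set.finite_range _, ?_⟩⟩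
  set W := Submodule.span (fixedAlg P n p hd) (Set.range (Verma.v P (lam := lam)))
  rw [eq_top_iff]
  rintro m -
  have hm : m ∈ Submodule.span F (Set.range fun b : (Fin n →₀ ℕ) × SYT lam =>
      (xMon b.1 : Cherednik P n) • Verma.v P b.2) := by
    rw [Verma.span_monomials]; trivial
  have hle : Submodule.span F (Set.range fun b : (Fin n →₀ ℕ) × SYT lam =>
      (xMon b.1 : Cherednik P n) • Verma.v P b.2) ≤ W.restrictScalars F := by
    refine Submodule.span_le.mpr ?_
    rintro _ ⟨b, rfl⟩
    exact W.smul_mem ⟨xMon b.1, xMon_mem_fixedAlg hd _⟩ (Submodule.subset_span ⟨b.2, rfl⟩)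
  exact hle hm

end Cherednik

/-! ### Jucys-Murphy elements -/

theorem IsSYT.boxCt_zero {r : ℕ} [NeZero r] {n : ℕ} {lam : RPartition r n}
    {T : Fin n → ZMod r × ℕ × ℕ} (h : IsSYT lam T) (hn : 0 < n) : boxCt (T ⟨0, hn⟩) = 0 := by
  obtain ⟨k, hk⟩ := h.exists_eq (b := ((T ⟨0, hn⟩).1, 0, 0))
    (YoungDiagram.up_left_mem _ (Nat.zero_le _) (Nat.zero_le _) (h.mem ⟨0, hn⟩))
  have h1 : k ≤ ⟨0, hn⟩ := h.le_of_le (by rw [hk]) (by rw [hk]; exact Nat.zero_le _)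
    (by rw [hk]; exact Nat.zero_le _)
  have h2 : k = ⟨0, hn⟩ := le_antisymm h1 (Fin.mk_le_of_le_val (Nat.zero_le _))
  rw [← h2, hk]
  simp [boxCt]

theorem boxA_mul_content (F : Type*) [Field F] [Algebra ℂ F] {r : ℕ} {b b' : ZMod r × ℕ × ℕ}
    (h : b.1 = b'.1 → boxCt b ≠ boxCt b') :
    boxA F b b' * ((boxCt b' : F) - boxCt b) = if b.1 = b'.1 then 1 else 0 := by
  have h1 : boxCoeff b b' * ((boxCt b' : ℝ) - boxCt b) = if b.1 = b'.1 then 1 else 0 := by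
    unfold boxCoeff
    by_cases e : b.1 = b'.1
    · rw [if_pos e, if_pos e, one_div, inv_mul_cancel₀]
      rw [sub_ne_zero]
      exact_mod_cast (h e).symm
    · rw [if_neg e, if_neg e, zero_mul]
  have h2 := congrArg (fun z : ℝ => algebraMap ℂ F (z : ℂ)) h1
  simp only [Complex.ofReal_mul, map_mul, Complex.ofReal_sub, map_sub, Complex.ofReal_intCast,
    map_intCast] at h2
  rw [boxA, h2]
  split_ifs <;> simp

namespace Cherednik

variable {F : Type*} [Field F] [Algebra ℂ F] {r : ℕ} [NeZero r] {P : ChParams F r} {n : ℕ}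

variable (P) in
/-- The Jucys-Murphy elements of `G(r,1,n)`. -/
def jm (i : Fin n) : Cherednik P n :=
  ∑ j : Fin n with j < i, ∑ l : ZMod r, t (ReflGroup.refl j i l)

theorem t_adjSwap_mul_self (i : ℕ) :
    (t (ReflGroup.permElt (adjSwap n i)) : Cherednik P n) * t (ReflGroup.permElt (adjSwap n i)) =
      1 := by
  rw [← t_mul, ReflGroup.permElt, ← map_mul, adjSwap_sq, map_one, t_one]

/-- Conjugation by the adjacent transposition turns the reflections in `j, i` into those in `j, i +
1` for `j < i`; the reflections in `i, i + 1` are the only ones missing. -/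
theorem jm_succ {i : ℕ} (hi : i + 1 < n) : jm P ⟨i + 1, hi⟩ =
    t (ReflGroup.permElt (adjSwap n i)) * jm P ⟨i, by omega⟩ * t (ReflGroup.permElt (adjSwap n i)) +
      ∑ l : ZMod r, t (ReflGroup.refl ⟨i, by omega⟩ ⟨i + 1, hi⟩ l) := by
  have hf : (Finset.univ.filter fun j : Fin n => j < ⟨i + 1, hi⟩) =
      insert ⟨i, by omega⟩ (Finset.univ.filter fun j : Fin n => j < ⟨i, by omega⟩) := by
    ext j
    simp only [Finset.mem_filter, Finset.mem_univ, true_and, Finset.mem_insert, Fin.lt_def,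
      Fin.ext_iff]
    omega
  unfold jm
  rw [hf, Finset.sum_insert (by simp), add_comm, Finset.mul_sum, Finset.sum_mul]
  congr 1
  refine Finset.sum_congr rfl fun j hj => ?_
  have hj : (j : ℕ) < i := (Finset.mem_filter.mp hj).2
  rw [Finset.mul_sum, Finset.sum_mul]
  refine Finset.sum_congr rfl fun l _ => ?_
  have hsj : adjSwap n i j = j := by
    apply Fin.ext
    rw [adjSwap_apply_val n i hi]
    simp [show (j : ℕ) ≠ i by omega, show (j : ℕ) ≠ i + 1 by omega]
  have hne : j ≠ (⟨i, by omega⟩ : Fin n) := fun e => by rw [e] at hj; exact lt_irrefl _ hj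
  rw [← t_mul, ReflGroup.mul_refl _ hne, t_mul, mul_assoc, t_adjSwap_mul_self, mul_one]
  simp only [ReflGroup.right_permElt, ReflGroup.expo_permElt, add_zero, sub_zero, hsj,
    adjSwap_apply_left hi]

end Cherednik

namespace YoungFamily

variable {F : Type*} [Field F] [Algebra ℂ F] {r : ℕ} [NeZero r] {n : ℕ} {lam : RPartition r n}
  {P : ChParams F r} {N : Type*} [AddCommGroup N] [Module F N] [Module (Cherednik P n) N]
  [IsScalarTower F (Cherednik P n) N] {u : SYT lam → N} (hu : YoungFamily P u)

include hu

theorem diag_fillVec (U : Fin n → ZMod r × ℕ × ℕ) (i : Fin n) (l : ZMod r) :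
    (Cherednik.t (ReflGroup.diagElt i l) : Cherednik P n) • fillVec u U =
      zetaPow F r (l * (U i).1) • fillVec u U := by
  by_cases h : IsSYT lam U
  · rw [fillVec_of_isSYT u h]; exact hu.diag ⟨U, h⟩ i l
  · rw [fillVec_of_not_isSYT u h, smul_zero, smul_zero]

/-- Conjugation by `ζ_i^l` multiplies the off-diagonal term by `ζ^{l(β_{i+1} - β_i)}` and leaves the
diagonal term alone. If the components differ, the sum over `l` kills the former and the latter is
already zero; if they agree, all `r` summands act alike. -/
theorem sum_refl_smul (T : SYT lam) {i : ℕ} (hi : i + 1 < n) :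
    (∑ l : ZMod r, Cherednik.t (ReflGroup.refl ⟨i, by omega⟩ ⟨i + 1, hi⟩ l) : Cherednik P n) • u T =
      ((r : F) * if T.beta ⟨i, by omega⟩ = T.beta ⟨i + 1, hi⟩ then 1 else 0) •
        (Cherednik.t (ReflGroup.permElt (adjSwap n i)) : Cherednik P n) • u T := by
  have hcomm : ∀ (d : F) (a : Cherednik P n) (m : N), a • d • m = d • a • m := fun d a m => by
    rw [← algebraMap_smul (Cherednik P n) d, ← algebraMap_smul (Cherednik P n) d (a • m), smul_smul,
      smul_smul, Algebra.commutes]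
  have hA := boxA_mul_content F (b := T.1 ⟨i, by omega⟩) (b' := T.1 ⟨i + 1, hi⟩)
    (T.2.content_ne (by simp) (by simp))
  set a := boxA F (T.1 ⟨i, by omega⟩) (T.1 ⟨i + 1, hi⟩) with ha
  set b := boxB F (T.1 ⟨i, by omega⟩) (T.1 ⟨i + 1, hi⟩) with hb
  set z := fillVec u (fun a => T.1 (adjSwap n i a)) with hz
  have key : ∀ l : ZMod r,
      (Cherednik.t (ReflGroup.refl ⟨i, by omega⟩ ⟨i + 1, hi⟩ l) : Cherednik P n) • u T =
        a • u T + zetaPow F r (l * (T.beta ⟨i + 1, hi⟩ - T.beta ⟨i, by omega⟩)) • b • z := by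
    intro l
    rw [ReflGroup.refl, ← adjSwap_of_lt hi, Cherednik.t_mul, Cherednik.t_mul, mul_smul, mul_smul,
      hu.diag, hcomm, hu.swap T i hi, smul_add, smul_add, hcomm, hcomm, hcomm, hcomm, hu.diag,
      hu.diag_fillVec, adjSwap_apply_left hi]
    simp only [← ha, ← hb, ← hz, smul_smul]
    congr 2
    · rw [mul_left_comm, ← zetaPow_add, neg_mul, neg_add_cancel, zetaPow_zero, mul_one]
    · rw [mul_left_comm, ← zetaPow_add, mul_comm b]
      congr 2
      change -l * T.beta _ + l * T.beta _ = _
      ring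
  rw [Finset.sum_smul, Finset.sum_congr rfl fun l _ => key l, Finset.sum_add_distrib,
    Finset.sum_const, Finset.card_univ, ZMod.card, ← Finset.sum_smul, zetaPow_sum_mul,
    hu.swap T i hi, ← Nat.cast_smul_eq_nsmul F]
  by_cases e : T.beta ⟨i, by omega⟩ = T.beta ⟨i + 1, hi⟩
  · rw [if_pos (sub_eq_zero.mpr e.symm), if_pos e, mul_one, smul_add]
  · rw [if_neg (fun h => e (sub_eq_zero.mp h).symm), if_neg e, zero_smul, mul_zero, zero_smul,
      add_zero]
    have : a = 0 := by
      have h0 : boxCoeff (T.1 ⟨i, by omega⟩) (T.1 ⟨i + 1, hi⟩) = 0 := if_neg e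
      rw [ha, boxA, h0]
      simp
    rw [this, zero_smul, smul_zero]

/-- Induction through `jm_succ`. The entry `i` of the exchanged tableau occupies the box of `i + 1`
in `T`, so the induction hypothesis gives the previous element on both tableaux. The resulting
multiple of `v_T` cancels the reflection sum, since `boxA` times the content difference is `1` or
`0`. -/
theorem jm_smul (T : SYT lam) (i : Fin n) :
    (Cherednik.jm P i) • u T = ((r : F) * (T.ct i : F)) • u T := by
  have hcomm : ∀ (d : F) (a : Cherednik P n) (m : N), a • d • m = d • a • m := fun d a m => by
    rw [← algebraMap_smul (Cherednik P n) d, ← algebraMap_smul (Cherednik P n) d (a • m), smul_smul,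
      smul_smul, Algebra.commutes]
  obtain ⟨i, hi⟩ := i
  induction i generalizing T with
  | zero =>
    have h1 : T.ct ⟨0, hi⟩ = 0 := T.2.boxCt_zero hi
    have h2 : Cherednik.jm P (⟨0, hi⟩ : Fin n) = 0 := by
      unfold Cherednik.jm
      rw [Finset.filter_false_of_mem (fun j _ => by simp [Fin.lt_def]), Finset.sum_empty]
    rw [h1, h2, Int.cast_zero, mul_zero, zero_smul, zero_smul]
  | succ i ih =>
    have hA := boxA_mul_content F (b := T.1 ⟨i, by omega⟩) (b' := T.1 ⟨i + 1, hi⟩)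
      (T.2.content_ne (by simp) (by simp))
    have hfill : Cherednik.jm P (⟨i, by omega⟩ : Fin n) • fillVec u (fun a => T.1 (adjSwap n i a)) =
        ((r : F) * (T.ct ⟨i + 1, hi⟩ : F)) • fillVec u (fun a => T.1 (adjSwap n i a)) := by
      by_cases h : IsSYT lam (fun a => T.1 (adjSwap n i a))
      · rw [fillVec_of_isSYT u h]
        refine (ih ⟨_, h⟩ (by omega)).trans ?_
        congr 3
        change boxCt (T.1 (adjSwap n i ⟨i, _⟩)) = boxCt (T.1 ⟨i + 1, hi⟩)
        rw [adjSwap_apply_left hi]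
      · rw [fillVec_of_not_isSYT u h, smul_zero, smul_zero]
    have hs := hu.swap T i hi
    have hb : boxB F (T.1 ⟨i, by omega⟩) (T.1 ⟨i + 1, hi⟩) •
        fillVec u (fun a => T.1 (adjSwap n i a)) =
        (Cherednik.t (ReflGroup.permElt (adjSwap n i)) : Cherednik P n) • u T -
          boxA F (T.1 ⟨i, by omega⟩) (T.1 ⟨i + 1, hi⟩) • u T := by
      rw [hs, add_sub_cancel_left]
    have h1 : Cherednik.jm P (⟨i, by omega⟩ : Fin n) •
        (Cherednik.t (ReflGroup.permElt (adjSwap n i)) : Cherednik P n) • u T =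
        ((r : F) * (T.ct ⟨i + 1, hi⟩ : F)) •
          (Cherednik.t (ReflGroup.permElt (adjSwap n i)) : Cherednik P n) • u T -
        ((r : F) * if T.beta ⟨i, by omega⟩ = T.beta ⟨i + 1, hi⟩ then 1 else 0) • u T := by
      change _ = if T.beta ⟨i, by omega⟩ = T.beta ⟨i + 1, hi⟩ then (1 : F) else 0 at hA
      rw [← hA]
      conv_lhs => rw [hs, smul_add, hcomm, hcomm, ih, hfill, smul_comm (boxB F _ _), hb]
      change boxA F _ _ • ((r : F) * (boxCt _ : F)) • _ + _ = _
      change _ = ((r : F) * (boxCt _ : F)) • _ - _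
      change _ + ((r : F) * (boxCt _ : F)) • _ = _
      generalize (Cherednik.t (ReflGroup.permElt (adjSwap n i)) : Cherednik P n) • u T = X
      generalize u T = Y
      module
    rw [Cherednik.jm_succ hi, add_smul, hu.sum_refl_smul T hi, mul_smul, mul_smul, h1, smul_sub,
      hcomm, ← mul_smul, Cherednik.t_adjSwap_mul_self, one_smul, hcomm, sub_add_cancel]

end YoungFamily

/-! ### Twisted modules -/

section TwistMod

variable {R A : Type*} [CommRing R] [Ring A] [Algebra R A] (σ : A →ₐ[R] A) (M : Type*)
  [AddCommGroup M] [Module R M] [Module A M]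

instance TwistMod.moduleBase : Module R (TwistMod σ M) := inferInstanceAs (Module R M)

instance TwistMod.isScalarTower [IsScalarTower R A M] : IsScalarTower R A (TwistMod σ M) where
  smul_assoc c a := by
    have key : ∀ m : M, σ (c • a) • m = c • σ a • m := fun m => by rw [map_smul, smul_assoc]
    exact key

end TwistMod

/-! ### Rotation of the Verma module -/

section Rotation

variable {F : Type*} [Field F] [Algebra ℂ F] {r : ℕ} [NeZero r] {n : ℕ} {lam : RPartition r n}

omit [NeZero r] in
theorem boxCoeff_add (b b' : ZMod r × ℕ × ℕ) (m : ZMod r) :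
    boxCoeff (b.1 + m, b.2) (b'.1 + m, b'.2) = boxCoeff b b' := by
  unfold boxCoeff
  simp only [add_left_inj]
  rfl

theorem RPartition.rotate_rotate (lam : RPartition r n) (a b : ZMod r) :
    (lam.rotate a).rotate b = lam.rotate (a + b) := by
  unfold RPartition.rotate
  congr 1
  funext i
  simp only [sub_sub, add_comm]

theorem RPartition.rotate_zero (lam : RPartition r n) : lam.rotate 0 = lam := by
  unfold RPartition.rotate
  congr 1
  funext i
  simp only [sub_zero]

theorem RPartition.rotate_neg {m : ZMod r} (h : lam.rotate m = lam) : lam.rotate (-m) = lam := by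
  conv_lhs => rw [← h]
  rw [rotate_rotate, add_neg_cancel, rotate_zero]

theorem RPartition.rotate_natCast_mul {m : ZMod r} (h : lam.rotate m = lam) (j : ℕ) :
    lam.rotate (j * m) = lam := by
  induction j with
  | zero => rw [Nat.cast_zero, zero_mul, rotate_zero]
  | succ j ih =>
    conv_rhs => rw [← h, ← ih]
    rw [rotate_rotate, Nat.cast_succ, add_mul, one_mul]

/-- Rotation as a permutation of the standard tableaux of a shape that it fixes. -/
def SYT.rotateEquiv {m : ZMod r} (h : lam.rotate m = lam) : SYT lam ≃ SYT lam where
  toFun T := T.rotate m h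
  invFun T := T.rotate (-m) (RPartition.rotate_neg h)
  left_inv _ := Subtype.ext (funext fun _ => Prod.ext (add_neg_cancel_right _ _) rfl)
  right_inv _ := Subtype.ext (funext fun _ => Prod.ext (neg_add_cancel_right _ _) rfl)

theorem isSYT_rotate_iff {m : ZMod r} (h : lam.rotate m = lam) (U : Fin n → ZMod r × ℕ × ℕ) :
    IsSYT lam (fun a => ((U a).1 + m, (U a).2)) ↔ IsSYT lam U := by
  refine ⟨fun hU => ?_, fun hU => (SYT.rotate ⟨U, hU⟩ m h).2⟩
  have := (SYT.rotate ⟨_, hU⟩ (-m) (RPartition.rotate_neg h)).2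
  have e : (SYT.rotate ⟨_, hU⟩ (-m) (RPartition.rotate_neg h) : SYT lam).1 = U :=
    funext fun _ => Prod.ext (add_neg_cancel_right _ _) rfl
  rwa [e] at this

theorem fillVec_rotate {N : Type*} [Zero N] (u : SYT lam → N) {m : ZMod r} (h : lam.rotate m = lam)
    (U : Fin n → ZMod r × ℕ × ℕ) : fillVec (fun T : SYT lam => u (T.rotate m h)) U =
      fillVec u (fun a => ((U a).1 + m, (U a).2)) := by
  by_cases hU : IsSYT lam U
  · rw [fillVec_of_isSYT _ hU, fillVec_of_isSYT _ ((isSYT_rotate_iff h U).mpr hU)]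
    rfl
  · rw [fillVec_of_not_isSYT _ hU,
      fillVec_of_not_isSYT _ (fun hh => hU ((isSYT_rotate_iff h U).mp hh))]

namespace Verma

variable (P : ChParams F r)

/-- The map `x ^ μ v_T ↦ x ^ μ v_{C ^ m T}`. -/
def rotEquiv {m : ZMod r} (h : lam.rotate m = lam) : Verma P lam ≃ₗ[F] Verma P lam :=
  (basis P lam).equiv (basis P lam) (Equiv.prodCongr (Equiv.refl _) (SYT.rotateEquiv h))

variable {P}

theorem rotEquiv_xMon_smul_v {m : ZMod r} (h : lam.rotate m = lam) (μ : Fin n → ℕ) (T : SYT lam) :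
    rotEquiv P h ((Cherednik.xMon μ : Cherednik P n) • Verma.v P T) =
      (Cherednik.xMon μ : Cherednik P n) • Verma.v P (T.rotate m h) := by
  have h1 := (basis P lam).equiv_apply (b' := basis P lam)
    (e := Equiv.prodCongr (Equiv.refl _) (SYT.rotateEquiv h)) (i := (Finsupp.equivFunOnFinite.symm μ, T))
  rw [basis_apply, basis_apply] at h1
  exact h1

variable {p : ℕ} (hd : ∀ i : ZMod r, P.d (i + ((r / p : ℕ) : ZMod r)) = P.d i)

/-- In the module twisted by `α^j` the rotated vectors satisfy the Young relations of the unrotated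
tableaux: the factor `ζ^{j r/p}` cancels the change `ζ^m` of the diagonal weights, and the
coefficients of adjacent transpositions are unaffected. The resulting homomorphism agrees with the
rotation on the basis because `α` fixes the `x_i`. -/
theorem rotEquiv_smul {m : ZMod r} (h : lam.rotate m = lam) {j : ℕ}
    (hj : (j : ZMod r) * ((r / p : ℕ) : ZMod r) + m = 0) (a : Cherednik P n) (z : Verma P lam) :
    rotEquiv P h (a • z) = (Cherednik.alpha P n p hd ^ j) a • rotEquiv P h z := by
  let N := TwistMod (Cherednik.alpha P n p hd ^ j) (Verma P lam)
  let u : SYT lam → N := fun T => Verma.v P (T.rotate m h)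
  have hv := youngFamily_v P (lam := lam)
  have hu : YoungFamily P u :=
    { zeta := fun T i => by
        change ((Cherednik.alpha P n p hd ^ j) (Cherednik.t (ReflGroup.diagElt i 1)) •
          Verma.v P (T.rotate m h) : Verma P lam) = zetaPow F r (T.beta i) • Verma.v P (T.rotate m h)
        rw [Cherednik.alpha_pow_t, ReflGroup.totalExpo_diagElt, smul_assoc, hv.zeta, smul_smul,
          ← zetaPow_add]
        congr 2
        change _ + (T.beta i + m) = _
        linear_combination hj
      swap := fun T i hi => by
        change ((Cherednik.alpha P n p hd ^ j) (Cherednik.t (ReflGroup.permElt (adjSwap n i))) •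
          Verma.v P (T.rotate m h) : Verma P lam) = boxA F _ _ • Verma.v P (T.rotate m h) +
            boxB F _ _ • fillVec (fun T : SYT lam => Verma.v P (T.rotate m h)) _
        rw [Cherednik.alpha_pow_t, ReflGroup.totalExpo_permElt, mul_zero, mul_zero, zetaPow_zero,
          one_smul, hv.swap _ i hi, fillVec_rotate]
        have hc := boxCoeff_add (T.1 ⟨i, by omega⟩) (T.1 ⟨i + 1, hi⟩) m
        have hA : boxA F ((T.rotate m h).1 ⟨i, by omega⟩) ((T.rotate m h).1 ⟨i + 1, hi⟩) =
            boxA F (T.1 ⟨i, by omega⟩) (T.1 ⟨i + 1, hi⟩) :=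
          congrArg (fun c : ℝ => algebraMap ℂ F (c : ℂ)) hc
        have hB : boxB F ((T.rotate m h).1 ⟨i, by omega⟩) ((T.rotate m h).1 ⟨i + 1, hi⟩) =
            boxB F (T.1 ⟨i, by omega⟩) (T.1 ⟨i + 1, hi⟩) :=
          congrArg (fun c : ℝ => algebraMap ℂ F ((Real.sqrt (1 - c ^ 2) : ℝ) : ℂ)) hc
        rw [hA, hB]
        rfl
      y := fun T i => by
        change ((Cherednik.alpha P n p hd ^ j) (Cherednik.y i) •
          Verma.v P (T.rotate m h) : Verma P lam) = 0
        rw [Cherednik.alpha_pow_apply_eq hd (Cherednik.alpha_y hd i), hv.y] }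
  obtain ⟨f, hf⟩ := Verma.exists_lift hu
  have hfr : ∀ z, f z = (show N from rotEquiv P h z) := by
    have e : (f.restrictScalars F : Verma P lam →ₗ[F] N) =
        (show Verma P lam →ₗ[F] N from (rotEquiv P h).toLinearMap) := by
      refine (basis P lam).ext fun b => ?_
      rw [basis_apply]
      refine Eq.trans ?_ (rotEquiv_xMon_smul_v h b.1 b.2).symm
      change f _ = _
      rw [map_smul, hf]
      change ((Cherednik.alpha P n p hd ^ j) (Cherednik.xMon b.1) •
        Verma.v P (b.2.rotate m h) : Verma P lam) = _
      rw [Cherednik.alpha_pow_apply_eq hd (Cherednik.xMon_mem_fixedAlg hd _)]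
    exact fun z => LinearMap.congr_fun e z
  have h1 := f.map_smul a z
  rw [hfr, hfr] at h1
  exact h1

theorem nonempty_twist_equiv (hp : p ∣ r) {k : ℕ}
    (h : lam.rotate ((k * (r / p) : ℕ) : ZMod r) = lam) :
    Nonempty (TwistMod (Cherednik.alpha P n p hd ^ k) (Verma P lam) ≃ₗ[Cherednik P n]
      Verma P lam) := by
  have hp0 : 0 < p := Nat.pos_of_ne_zero fun h0 => NeZero.ne r (by
    rw [h0] at hp; exact Nat.eq_zero_of_zero_dvd hp)
  -- The exponent `(p - 1) * k` represents `-k`, since `α^p = 1`; rotation is semilinear for the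
  -- inverse of `α^k`.
  have hj : (((p - 1) * k : ℕ) : ZMod r) * ((r / p : ℕ) : ZMod r) + ((k * (r / p) : ℕ) : ZMod r) = 0 := by
    rw [← Nat.cast_mul, ← Nat.cast_add]
    have : (p - 1) * k * (r / p) + k * (r / p) = k * r := by
      obtain ⟨q, rfl⟩ := Nat.exists_eq_add_of_lt hp0
      conv_rhs => rw [← Nat.mul_div_cancel' hp]
      simp only [zero_add, Nat.add_sub_cancel]
      ring
    rw [this, Nat.cast_mul, ZMod.natCast_self, mul_zero]
  have key : ∀ (a : Cherednik P n) (z : Verma P lam),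
      rotEquiv P h ((Cherednik.alpha P n p hd ^ k) a • z) = a • rotEquiv P h z := fun a z => by
    have : (p - 1) * k + k = p * k := by
      rw [← Nat.succ_mul, Nat.succ_eq_add_one, Nat.sub_add_cancel hp0]
    rw [rotEquiv_smul hd h hj, ← AlgHom.mul_apply, ← pow_add, this, pow_mul,
      Cherednik.alpha_pow_eq_one hd hp, one_pow, AlgHom.one_apply]
  exact ⟨{ toFun := fun z => rotEquiv P h z
           invFun := fun z => (rotEquiv P h).symm z
           left_inv := fun z => (rotEquiv P h).symm_apply_apply z
           right_inv := fun z => (rotEquiv P h).apply_symm_apply z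
           map_add' := fun a b => (rotEquiv P h).map_add a b
           map_smul' := key }⟩

end Verma

end Rotation

/-! ### Projections onto graded pieces -/

section SummandProj

variable {A M ι : Type*} [Ring A] [AddCommGroup M] [Module A M] [DecidableEq ι]
  {N : ι → Submodule A M} (hN : DirectSum.IsInternal N)

theorem summandProj_apply_of_mem_ne {q q' : ι} (h : q ≠ q') {m : M} (hm : m ∈ N q') :
    summandProj hN q m = 0 := by
  have : (LinearEquiv.ofBijective (DirectSum.coeLinearMap N) hN).symm m =
      DirectSum.lof A ι (fun q => N q) q' ⟨m, hm⟩ := by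
    rw [LinearEquiv.symm_apply_eq]
    exact (DirectSum.coeLinearMap_lof N q' ⟨m, hm⟩).symm
  refine (congrArg (DirectSum.component A ι (fun q => N q) q) this).trans ?_
  exact DirectSum.of_eq_of_ne _ _ _ h

include hN in
theorem isInternal_induction {Q : M → Prop} (mem : ∀ q, ∀ m ∈ N q, Q m)
    (add : ∀ a b, Q a → Q b → Q (a + b)) (zero : Q 0) (m : M) : Q m := by
  have hm : m ∈ ⨆ q, N q := by rw [hN.submodule_iSup_eq_top]; trivial
  exact Submodule.iSup_induction N (motive := Q) hm mem zero add

include hN in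
theorem summandProj_map (g : M →+ M) (hg : ∀ q, ∀ m ∈ N q, g m ∈ N q) (q : ι) (m : M) :
    (summandProj hN q (g m) : M) = g (summandProj hN q m) := by
  induction m using isInternal_induction hN with
  | mem q' m hm =>
    by_cases h : q = q'
    · subst h
      rw [summandProj_apply_of_mem hN q ⟨m, hm⟩, summandProj_apply_of_mem hN q ⟨g m, hg q m hm⟩]
    · rw [summandProj_apply_of_mem_ne hN h hm, summandProj_apply_of_mem_ne hN h (hg q' m hm),
        Submodule.coe_zero, map_zero]
  | add a b ha hb => rw [map_add, map_add, map_add, Submodule.coe_add, Submodule.coe_add, ha, hb,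
      map_add]
  | zero => rw [map_zero, map_zero, Submodule.coe_zero, map_zero]

end SummandProj

theorem eigenvalue_eq_of_coeff_ne_zero {F V ι : Type*} [Field F] [AddCommGroup V] [Module F V]
    [Fintype ι] {v : ι → V} (hv : LinearIndependent F v) (A : V →ₗ[F] V) {χ : ι → F}
    (hA : ∀ i, A (v i) = χ i • v i) {c : ι → F} {χ₀ : F}
    (h : A (∑ i, c i • v i) = χ₀ • ∑ i, c i • v i) {i : ι} (hi : c i ≠ 0) : χ i = χ₀ := by
  have h1 : ∑ i, ((χ i - χ₀) * c i) • v i = 0 := by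
    simp only [map_sum, map_smul, hA, Finset.smul_sum] at h
    rw [← sub_eq_zero, ← Finset.sum_sub_distrib] at h
    rw [← h]
    refine Finset.sum_congr rfl fun i _ => ?_
    module
  have h2 := Fintype.linearIndependent_iff.mp hv _ h1 i
  exact sub_eq_zero.mp ((mul_eq_zero.mp h2).resolve_right hi)

namespace Verma

variable {F : Type*} [Field F] [Algebra ℂ F] {r : ℕ} [NeZero r] {n : ℕ} {lam : RPartition r n}
  {P : ChParams F r}

variable (P) in
theorem linearIndependent_v : LinearIndependent F (Verma.v P (lam := lam)) := by
  have := (linearIndependent_monomials P lam).comp (fun T : SYT lam => ((0 : Fin n →₀ ℕ), T))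
    (fun T T' h => congrArg Prod.snd h)
  convert this using 1
  funext T
  exact (by rw [Cherednik.xMon_zero, one_smul] :
    Verma.v P T = (Cherednik.xMon (0 : Fin n → ℕ) : Cherednik P n) • Verma.v P T)

variable (P) in
theorem v_ne_zero (T : SYT lam) : Verma.v P T ≠ 0 := (linearIndependent_v P).ne_zero T

theorem exists_eq_sum_of_mem_deg_zero [Fintype (SYT lam)] {m : Verma P lam}
    (hm : m ∈ Verma.deg P lam 0) : ∃ c : SYT lam → F, m = ∑ T, c T • Verma.v P T := by
  rw [deg_zero, Submodule.mem_span_range_iff_exists_fun] at hm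
  obtain ⟨c, hc⟩ := hm
  exact ⟨c, hc.symm⟩

/-- The action of an element of the algebra as a linear map. -/
def act (a : Cherednik P n) : Verma P lam →ₗ[F] Verma P lam := Algebra.lsmul F F (Verma P lam) a

theorem act_apply (a : Cherednik P n) (m : Verma P lam) : act a m = a • m := rfl

theorem degProj_x_smul_eq_zero (k : Fin n) (m : Verma P lam) :
    summandProj (deg_isInternal (P := P) (lam := lam)) 0 ((Cherednik.x k : Cherednik P n) • m) = 0 := by
  induction m using isInternal_induction (deg_isInternal (P := P) (lam := lam)) with
  | mem d m hm =>
    exact summandProj_apply_of_mem_ne _ (Nat.succ_ne_zero d).symm (x_smul_mem_deg k hm)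
  | add a b ha hb => rw [smul_add, map_add, ha, hb, add_zero]
  | zero => rw [smul_zero, map_zero]

theorem degProj_xMon_smul_eq_zero {μ : Fin n → ℕ} (hμ : μ ≠ 0) (m : Verma P lam) :
    summandProj (deg_isInternal (P := P) (lam := lam)) 0
      ((Cherednik.xMon μ : Cherednik P n) • m) = 0 := by
  obtain ⟨k, hk⟩ := Function.ne_iff.mp hμ
  have : μ = (μ - Pi.single k 1) + Pi.single k 1 := by
    funext i
    simp only [Pi.add_apply, Pi.sub_apply]
    by_cases h : i = k
    · subst h
      have : μ i ≠ 0 := hk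
      simp only [Pi.single_eq_same]
      omega
    · simp [h]
  rw [this, ← Cherednik.x_mul_xMon, mul_smul, degProj_x_smul_eq_zero]

theorem jm_smul_mem_deg (i : Fin n) {d : ℕ} {m : Verma P lam} (hm : m ∈ Verma.deg P lam d) :
    Cherednik.jm P i • m ∈ Verma.deg P lam d := by
  unfold Cherednik.jm
  rw [Finset.sum_smul]
  refine Submodule.sum_mem _ fun j _ => ?_
  rw [Finset.sum_smul]
  exact Submodule.sum_mem _ fun l _ => t_smul_mem_deg _ hm

end Verma

/-! ### The period of a Verma module -/

section Period

variable {F : Type*} [Field F] [Algebra ℂ F] {r : ℕ} [NeZero r] {n p : ℕ} {lam : RPartition r n}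
  {P : ChParams F r} (hd : ∀ i : ZMod r, P.d (i + ((r / p : ℕ) : ZMod r)) = P.d i)

theorem Cherednik.jm_mem_fixedAlg (i : Fin n) : jm P i ∈ fixedAlg P n p hd :=
  Subalgebra.sum_mem _ fun _ _ => Subalgebra.sum_mem _ fun _ _ =>
    t_mem_fixedAlg_of_totalExpo hd (ReflGroup.totalExpo_refl _ _ _)

/-- An isomorphism with the twist need not respect the grading, so its composite with the projection
to degree zero is used. A nonzero image of `v_T` there is a simultaneous eigenvector, and any `v_U`
occurring in it has the weights of `T` with all components shifted by `k r / p`. -/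
theorem Verma.rotate_eq_of_twist_equiv {k : ℕ}
    (φ : TwistMod (Cherednik.alpha P n p hd ^ k) (Verma P lam) ≃ₗ[Cherednik P n] Verma P lam) :
    lam.rotate ((k * (r / p) : ℕ) : ZMod r) = lam := by
  classical
  have : Fintype (SYT lam) := Fintype.ofFinite _
  obtain ⟨g, hgs, hg⟩ : ∃ g : Verma P lam →ₗ[F] Verma P lam, Function.Surjective g ∧
      ∀ (a : Cherednik P n) (z : Verma P lam),
        g ((Cherednik.alpha P n p hd ^ k) a • z) = a • g z :=
    ⟨φ.toLinearMap.restrictScalars F, φ.surjective, fun a z => φ.map_smul a z⟩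
  have hv := youngFamily_v P (lam := lam)
  let π := summandProj (deg_isInternal (P := P) (lam := lam)) 0
  -- If the degree zero parts of all images vanished, the composite would be zero: each monomial
  -- `x^μ` with `μ ≠ 0` raises the degree. This contradicts surjectivity.
  obtain ⟨T, hT⟩ : ∃ T : SYT lam, π (g (v P T)) ≠ 0 := by
    by_contra! hcon
    have hzero : π ∘ₗ g = 0 := by
      refine (basis P lam).ext fun b => ?_
      rw [LinearMap.comp_apply, LinearMap.zero_apply, basis_apply,
        ← Cherednik.alpha_pow_apply_eq hd (Cherednik.xMon_mem_fixedAlg hd _) k, hg]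
      by_cases hb : b.1 = 0
      · rw [hb]
        change π ((Cherednik.xMon (0 : Fin n → ℕ) : Cherednik P n) • _) = 0
        rw [Cherednik.xMon_zero, one_smul, hcon]
      · exact degProj_xMon_smul_eq_zero (fun h => hb (DFunLike.coe_injective h)) _
    obtain ⟨T⟩ := (inferInstance : Nonempty (SYT lam))
    obtain ⟨z, hz⟩ := hgs (v P T)
    have h1 : π (v P T) = 0 := by rw [← hz]; exact LinearMap.congr_fun hzero z
    have h2 := summandProj_apply_of_mem (deg_isInternal (P := P) (lam := lam)) 0
      ⟨v P T, v_mem_deg T⟩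
    exact v_ne_zero P T (congrArg Subtype.val (h2.symm.trans h1))
  obtain ⟨c, hc⟩ := exists_eq_sum_of_mem_deg_zero (π (g (v P T))).2
  obtain ⟨U, hU⟩ : ∃ U, c U ≠ 0 := by
    by_contra! hcon
    apply hT
    apply Subtype.ext
    rw [hc]
    simp [hcon]
  have key : ∀ (a : Cherednik P n), (∀ d, ∀ m ∈ deg P lam d, a • m ∈ deg P lam d) →
      ∀ χ : SYT lam → F, (∀ S, a • v P S = χ S • v P S) → ∀ χ₀ : F,
      (Cherednik.alpha P n p hd ^ k) a • v P T = χ₀ • v P T → χ U = χ₀ := by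
    intro a ha χ hχ χ₀ h0
    refine eigenvalue_eq_of_coeff_ne_zero (linearIndependent_v P) (act a) hχ (c := c) ?_ hU
    have h1 := summandProj_map (deg_isInternal (P := P) (lam := lam))
      (act a).toAddMonoidHom ha 0 (g (v P T))
    change (π (a • g (v P T)) : Verma P lam) = act a (π (g (v P T))) at h1
    have h2 : a • g (v P T) = χ₀ • g (v P T) := by rw [← hg, h0]; exact g.map_smul _ _
    have h3 : (π (χ₀ • g (v P T)) : Verma P lam) = χ₀ • (π (g (v P T)) : Verma P lam) :=
      congrArg Subtype.val (π.map_smul χ₀ (g (v P T)))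
    rw [h2] at h1
    rw [← hc]
    exact h1.symm.trans h3
  have hr : (r : F) ≠ 0 := natCast_ne_zero_of_dvd F dvd_rfl
  have hchar : CharZero F := charZero_of_injective_algebraMap (algebraMap ℂ F).injective
  refine (SYT.exists_rotate_eq (T := T) (U := U) (fun i => ?_) (fun i => ?_)).1
  · have := key (Cherednik.t (ReflGroup.diagElt i 1)) (fun d m hm => t_smul_mem_deg _ hm)
      (fun S => zetaPow F r (S.beta i)) (fun S => hv.zeta S i)
      (zetaPow F r (T.beta i + ((k * (r / p) : ℕ) : ZMod r))) (by
        rw [Cherednik.alpha_pow_t, ReflGroup.totalExpo_diagElt, smul_assoc, hv.zeta, smul_smul,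
          ← zetaPow_add, mul_one, Nat.cast_mul, add_comm])
    exact zetaPow_injective F r this
  · have := key (Cherednik.jm P i) (fun d m hm => jm_smul_mem_deg i hm)
      (fun S => (r : F) * (S.ct i : F)) (fun S => hv.jm_smul S i) ((r : F) * (T.ct i : F)) (by
        rw [Cherednik.alpha_pow_apply_eq hd (Cherednik.jm_mem_fixedAlg hd i), hv.jm_smul])
    exact Int.cast_injective (mul_left_cancel₀ hr this)

theorem twistPeriod_isLeast (hp : p ∣ r) :
    IsLeast {j : ℕ | 0 < j ∧ lam.rotate ((j * (r / p) : ℕ) : ZMod r) = lam}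
      (twistPeriod P p hd lam) := by
  have hset : {k : ℕ | 0 < k ∧ Nonempty (TwistMod (Cherednik.alpha P n p hd ^ k) (Verma P lam)
      ≃ₗ[Cherednik P n] Verma P lam)} =
      {j : ℕ | 0 < j ∧ lam.rotate ((j * (r / p) : ℕ) : ZMod r) = lam} := by
    ext k
    exact and_congr_right fun _ => ⟨fun ⟨φ⟩ => Verma.rotate_eq_of_twist_equiv hd φ,
      Verma.nonempty_twist_equiv hd hp⟩
  have hp0 : 0 < p := Nat.pos_of_ne_zero fun h0 => NeZero.ne r (by
    rw [h0] at hp; exact Nat.eq_zero_of_zero_dvd hp)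
  -- The set contains `p`, so its infimum is attained and is not the default value `0`.
  have hne : {j : ℕ | 0 < j ∧ lam.rotate ((j * (r / p) : ℕ) : ZMod r) = lam}.Nonempty :=
    ⟨p, hp0, by rw [Nat.mul_div_cancel' hp, ZMod.natCast_self, RPartition.rotate_zero]⟩
  unfold twistPeriod
  rw [hset]
  exact ⟨Nat.sInf_mem hne, fun j hj => Nat.sInf_le hj⟩

theorem twistPeriod_pos (hp : p ∣ r) : 0 < twistPeriod P p hd lam := (twistPeriod_isLeast hd hp).1.1

theorem rotate_twistShift (hp : p ∣ r) : lam.rotate (twistShift P p hd lam) = lam :=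
  (twistPeriod_isLeast hd hp).1.2

theorem twistPeriod_dvd_of_rotate_eq (hp : p ∣ r) {j : ℕ}
    (h : lam.rotate ((j * (r / p) : ℕ) : ZMod r) = lam) : twistPeriod P p hd lam ∣ j := by
  set k := twistPeriod P p hd lam with hk
  by_contra hcon
  have h0 : 0 < j % k := Nat.pos_of_ne_zero fun h => hcon (Nat.dvd_of_mod_eq_zero h)
  have hlt : j % k < k := Nat.mod_lt _ (twistPeriod_pos hd hp)
  have h1 : lam.rotate ((j / k : ℕ) * ((k * (r / p) : ℕ) : ZMod r)) = lam :=
    RPartition.rotate_natCast_mul (rotate_twistShift hd hp) _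
  refine absurd ((twistPeriod_isLeast hd hp).2 ⟨h0, ?_⟩) (not_le.mpr hlt)
  conv_lhs => rw [← h1]
  rw [RPartition.rotate_rotate, ← Nat.cast_mul, ← Nat.cast_add, ← mul_assoc, ← add_mul,
    mul_comm (j / k), Nat.div_add_mod, h]

theorem twistPeriod_dvd (hp : p ∣ r) : twistPeriod P p hd lam ∣ p :=
  twistPeriod_dvd_of_rotate_eq hd hp (by
    rw [Nat.mul_div_cancel' hp, ZMod.natCast_self, RPartition.rotate_zero])

theorem natCast_mul_twistShift_eq_zero_iff (hp : p ∣ r) (l : ℕ) :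
    (l : ZMod r) * twistShift P p hd lam = 0 ↔ p / twistPeriod P p hd lam ∣ l := by
  unfold twistShift
  have hk := twistPeriod_pos (lam := lam) hd hp
  obtain ⟨q, hq⟩ := twistPeriod_dvd (lam := lam) hd hp
  set k := twistPeriod P p hd lam
  have h1 : (l : ZMod r) * ((k * (r / p) : ℕ) : ZMod r) = ((r / p : ℕ) : ZMod r) * ((l * k : ℕ) : ZMod r) := by
    push_cast; ring
  rw [h1, natCast_div_mul_eq_zero_iff hp, hq, Nat.mul_div_cancel_left _ hk, mul_comm l]
  exact Nat.mul_dvd_mul_iff_left hk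

theorem isPrimitiveRoot_zetaPow_twistShift (hp : p ∣ r) :
    IsPrimitiveRoot (zetaPow F r (twistShift P p hd lam)) (p / twistPeriod P p hd lam) := by
  constructor
  · rw [← zetaPow_nsmul, (natCast_mul_twistShift_eq_zero_iff hd hp _).mpr dvd_rfl, zetaPow_zero]
  · intro l hl
    rwa [← zetaPow_nsmul, zetaPow_eq_one_iff, natCast_mul_twistShift_eq_zero_iff hd hp] at hl

end Period

/-! ### The automorphism of a Verma module over `ℍ_p` -/

namespace Verma

variable {F : Type*} [Field F] [Algebra ℂ F] {r : ℕ} [NeZero r] {n p : ℕ} {lam : RPartition r n}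
  {P : ChParams F r} (hd : ∀ i : ZMod r, P.d (i + ((r / p : ℕ) : ZMod r)) = P.d i)

/-- Rotation as an automorphism over the fixed algebra. -/
def rotAut {m : ZMod r} (h : lam.rotate m = lam) {j : ℕ}
    (hj : (j : ZMod r) * ((r / p : ℕ) : ZMod r) + m = 0) :
    Verma P lam ≃ₗ[Cherednik.fixedAlg P n p hd] Verma P lam where
  toFun := rotEquiv P h
  invFun := (rotEquiv P h).symm
  left_inv := (rotEquiv P h).symm_apply_apply
  right_inv := (rotEquiv P h).apply_symm_apply
  map_add' := (rotEquiv P h).map_add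
  map_smul' b z := by
    have := rotEquiv_smul hd h hj (b : Cherednik P n) z
    rwa [Cherednik.alpha_pow_apply_eq hd b.2] at this

theorem rotAut_apply {m : ZMod r} (h : lam.rotate m = lam) {j : ℕ}
    (hj : (j : ZMod r) * ((r / p : ℕ) : ZMod r) + m = 0) (z : Verma P lam) :
    rotAut hd h hj z = rotEquiv P h z := rfl

/-- The scalar measures how far rotation is from being linear over the whole algebra. It is what
makes `t_{ζ_1}` move each eigenspace of `C^{kr/p}` to its neighbour. -/
theorem rotAut_smul {m : ZMod r} (h : lam.rotate m = lam) {j : ℕ}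
    (hj : (j : ZMod r) * ((r / p : ℕ) : ZMod r) + m = 0) (w : ReflGroup r n) (z : Verma P lam) :
    rotAut hd h hj ((Cherednik.t w : Cherednik P n) • z) =
      zetaPow F r (-(m * w.totalExpo)) • (Cherednik.t w : Cherednik P n) • rotAut hd h hj z := by
  rw [rotAut_apply, rotAut_apply, rotEquiv_smul hd h hj, Cherednik.alpha_pow_t, smul_assoc]
  congr 2
  linear_combination w.totalExpo * hj

theorem rotAut_pow_xMon_smul_v {m : ZMod r} (h : lam.rotate m = lam) {j : ℕ}
    (hj : (j : ZMod r) * ((r / p : ℕ) : ZMod r) + m = 0) (i : ℕ) (μ : Fin n → ℕ) (T : SYT lam) :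
    ((rotAut hd h hj).toLinearMap ^ i) ((Cherednik.xMon μ : Cherednik P n) • v P T) =
      (Cherednik.xMon μ : Cherednik P n) •
        v P (T.rotate (i * m) (RPartition.rotate_natCast_mul h i)) := by
  induction i with
  | zero =>
    rw [pow_zero, Module.End.one_apply]
    congr 2
    refine Subtype.ext (funext fun a => Prod.ext ?_ rfl)
    change _ = _ + _
    rw [Nat.cast_zero, zero_mul, add_zero]
  | succ i ih =>
    rw [pow_succ', Module.End.mul_apply, ih]
    refine (rotEquiv_xMon_smul_v h _ _).trans ?_
    congr 2
    refine Subtype.ext (funext fun a => Prod.ext ?_ rfl)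
    change _ + _ + _ = _ + _
    rw [Nat.cast_succ, add_mul, one_mul, add_assoc]

theorem rotAut_pow_eq_one {m : ZMod r} (h : lam.rotate m = lam) {j : ℕ}
    (hj : (j : ZMod r) * ((r / p : ℕ) : ZMod r) + m = 0) {N : ℕ} (hN : (N : ZMod r) * m = 0) :
    (rotAut (P := P) hd h hj).toLinearMap ^ N = 1 := by
  have e : (((rotAut (P := P) hd h hj).toLinearMap ^ N).restrictScalars F : Verma P lam →ₗ[F] _) =
      LinearMap.id := by
    refine (basis P lam).ext fun b => ?_
    rw [basis_apply]
    refine (rotAut_pow_xMon_smul_v hd h hj N _ _).trans ?_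
    rw [LinearMap.id_apply]
    congr 2
    refine Subtype.ext (funext fun a => Prod.ext ?_ rfl)
    change _ + _ = _
    rw [hN, add_zero]
  exact LinearMap.ext fun z => LinearMap.congr_fun e z

theorem rotAut_mem_deg {m : ZMod r} (h : lam.rotate m = lam) {j : ℕ}
    (hj : (j : ZMod r) * ((r / p : ℕ) : ZMod r) + m = 0) {d : ℕ} {z : Verma P lam}
    (hz : z ∈ deg P lam d) : rotAut hd h hj z ∈ deg P lam d := by
  rw [rotAut_apply]
  induction hz using Submodule.span_induction with
  | mem z hz =>
    obtain ⟨μ, T, rfl, rfl⟩ := hz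
    rw [rotEquiv_xMon_smul_v]
    exact xMon_smul_v_mem_deg _ _
  | zero => rw [map_zero]; exact Submodule.zero_mem _
  | add a b _ _ ha hb => rw [map_add]; exact Submodule.add_mem _ ha hb
  | smul c a _ ha => rw [map_smul]; exact Submodule.smul_mem _ c ha

end Verma

/-! ### The decomposition of the Verma module and of its head -/

theorem map_jacobson_equiv {A M : Type*} [Ring A] [AddCommGroup M] [Module A M] (e : M ≃ₗ[A] M) :
    (Module.jacobson A M).map e.toLinearMap = Module.jacobson A M := by
  refine le_antisymm (Module.map_jacobson_le e.toLinearMap) fun x hx => ?_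
  exact ⟨e.symm x, Module.map_jacobson_le e.symm.toLinearMap ⟨x, hx, rfl⟩, e.apply_symm_apply x⟩

/-- The exponent `(p - 1) k` stands for `-k`: rotation by `k r / p` is semilinear for `α^{-k}`. -/
theorem twistShift_relation {F : Type*} [Field F] [Algebra ℂ F] {r : ℕ} [NeZero r] {n p : ℕ}
    {P : ChParams F r} (hd : ∀ i : ZMod r, P.d (i + ((r / p : ℕ) : ZMod r)) = P.d i)
    (lam : RPartition r n) (hp : p ∣ r) :
    (((p - 1) * twistPeriod P p hd lam : ℕ) : ZMod r) * ((r / p : ℕ) : ZMod r) +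
      twistShift P p hd lam = 0 := by
  unfold twistShift
  rw [← Nat.cast_mul, ← Nat.cast_add]
  have hp0 : 0 < p := Nat.pos_of_ne_zero fun h0 => NeZero.ne r (by
    rw [h0] at hp; exact Nat.eq_zero_of_zero_dvd hp)
  set k := twistPeriod P p hd lam
  have : (p - 1) * k * (r / p) + k * (r / p) = k * r := by
    obtain ⟨q, rfl⟩ := Nat.exists_eq_add_of_lt hp0
    conv_rhs => rw [← Nat.mul_div_cancel' hp]
    simp only [zero_add, Nat.add_sub_cancel]
    ring
  rw [this, Nat.cast_mul, ZMod.natCast_self, mul_zero]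

section Decomposition

variable {F : Type*} [Field F] [Algebra ℂ F] {r : ℕ} [NeZero r] {n p : ℕ} {P : ChParams F r}
  (hd : ∀ i : ZMod r, P.d (i + ((r / p : ℕ) : ZMod r)) = P.d i) (lam : RPartition r n)
  (hp : p ∣ r) (hn : 0 < n)

/-- The automorphism `C ^ (k r / p)` of the Verma module. -/
def shiftAut : Verma P lam ≃ₗ[Cherednik.fixedAlg P n p hd] Verma P lam :=
  Verma.rotAut hd (rotate_twistShift hd hp) (twistShift_relation hd lam hp)

include hp in
theorem natCast_period_quot_ne_zero : ((p / twistPeriod P p hd lam : ℕ) : F) ≠ 0 :=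
  natCast_ne_zero_of_dvd F ((Nat.div_dvd_of_dvd (twistPeriod_dvd hd hp)).trans hp)

theorem shiftAut_pow : (shiftAut hd lam hp).toLinearMap ^ (p / twistPeriod P p hd lam) = 1 :=
  Verma.rotAut_pow_eq_one hd _ _ ((natCast_mul_twistShift_eq_zero_iff hd hp _).mpr dvd_rfl)

variable {lam} in
theorem vermaPart_natCast (C : Verma P lam →ₗ[Cherednik.fixedAlg P n p hd] Verma P lam) (q : ℕ) :
    vermaPart C q = eigenSub C (zetaPow F r (twistShift P p hd lam) ^ q) := by
  rw [vermaPart, Int.cast_natCast, zetaPow_nsmul]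

variable {lam} in
theorem headPart_natCast (D : VermaHead P lam →ₗ[Cherednik.fixedAlg P n p hd] VermaHead P lam)
    (q : ℕ) : headPart D q = eigenSub D (zetaPow F r (twistShift P p hd lam) ^ q) := by
  rw [headPart, Int.cast_natCast, zetaPow_nsmul]

theorem isInternal_vermaPart : DirectSum.IsInternal
    (fun q : Fin (p / twistPeriod P p hd lam) =>
      vermaPart (shiftAut hd lam hp).toLinearMap (q : ℕ)) := by
  simp only [vermaPart_natCast]
  exact eigenSub_isInternal (natCast_period_quot_ne_zero hd lam hp) (shiftAut_pow hd lam hp)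
    (isPrimitiveRoot_zetaPow_twistShift hd hp)

include hn in
-- Clifford theory enters here. The radical of `M(λ)` becomes intrinsic over `ℍ_p`, hence is
-- preserved by every `ℍ_p`-automorphism and compatible with `ℍ_p`-summands.
theorem vermaRad_eq_jacobson :
    vermaRad P p hd lam = Module.jacobson (Cherednik.fixedAlg P n p hd) (Verma P lam) :=
  (Cherednik.cyclicExtension_fixedAlg hd ⟨0, hn⟩).jacobson_eq

include hn in
theorem jacobson_vermaPart (q : Fin (p / twistPeriod P p hd lam)) :
    Module.jacobson (Cherednik.fixedAlg P n p hd)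
      (vermaPart (shiftAut hd lam hp).toLinearMap (q : ℕ)) =
      (vermaRad P p hd lam).map (summandProj (isInternal_vermaPart hd lam hp) q) := by
  rw [vermaRad_eq_jacobson hd lam hn]
  exact jacobson_summand _ (summandProj_apply_of_mem (isInternal_vermaPart hd lam hp) q)

include hn in
theorem map_shiftAut_vermaRad :
    (vermaRad P p hd lam).map (shiftAut hd lam hp).toLinearMap = vermaRad P p hd lam := by
  rw [vermaRad_eq_jacobson hd lam hn]
  exact map_jacobson_equiv _

/-- The automorphism of the head induced by `C ^ (k r / p)`. -/
def headAut : VermaHead P lam ≃ₗ[Cherednik.fixedAlg P n p hd] VermaHead P lam :=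
  (Submodule.Quotient.restrictScalarsEquiv (Cherednik.fixedAlg P n p hd)
      (Module.jacobson (Cherednik P n) (Verma P lam))).symm ≪≫ₗ
    Submodule.Quotient.equiv (vermaRad P p hd lam) (vermaRad P p hd lam) (shiftAut hd lam hp)
      (map_shiftAut_vermaRad hd lam hp hn) ≪≫ₗ
    Submodule.Quotient.restrictScalarsEquiv (Cherednik.fixedAlg P n p hd)
      (Module.jacobson (Cherednik P n) (Verma P lam))

theorem headAut_mk (m : Verma P lam) :
    headAut hd lam hp hn (VermaHead.mk P lam m) = VermaHead.mk P lam (shiftAut hd lam hp m) := rfl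

variable {lam} in
theorem VermaHead.mk_surjective : Function.Surjective (VermaHead.mk P lam) :=
  Submodule.mkQ_surjective _

theorem headAut_pow_mk (i : ℕ) (m : Verma P lam) :
    ((headAut hd lam hp hn).toLinearMap ^ i) (VermaHead.mk P lam m) =
      VermaHead.mk P lam (((shiftAut hd lam hp).toLinearMap ^ i) m) := by
  induction i with
  | zero => rfl
  | succ i ih => rw [pow_succ', Module.End.mul_apply, ih, pow_succ', Module.End.mul_apply]; rfl

theorem headAut_pow : (headAut hd lam hp hn).toLinearMap ^ (p / twistPeriod P p hd lam) = 1 := by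
  refine LinearMap.ext fun l => ?_
  obtain ⟨m, rfl⟩ := VermaHead.mk_surjective l
  rw [headAut_pow_mk, shiftAut_pow]
  rfl

theorem isInternal_headPart : DirectSum.IsInternal
    (fun q : Fin (p / twistPeriod P p hd lam) =>
      headPart (headAut hd lam hp hn).toLinearMap (q : ℕ)) := by
  simp only [headPart_natCast]
  exact eigenSub_isInternal (natCast_period_quot_ne_zero hd lam hp) (headAut_pow hd lam hp hn)
    (isPrimitiveRoot_zetaPow_twistShift hd hp)

theorem mk_mem_headPart {q : ℤ} {m : Verma P lam}
    (hm : m ∈ vermaPart (shiftAut hd lam hp).toLinearMap q) :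
    VermaHead.mk P lam m ∈ headPart (headAut hd lam hp hn).toLinearMap q := by
  have hm' : shiftAut hd lam hp m = _ • m := hm
  change headAut hd lam hp hn (VermaHead.mk P lam m) = _ • _
  rw [headAut_mk, hm', LinearMap.map_smul_of_tower]

theorem shiftAut_t_smul (w : ReflGroup r n) (m : Verma P lam) :
    shiftAut hd lam hp ((Cherednik.t w : Cherednik P n) • m) =
      zetaPow F r (-(twistShift P p hd lam * w.totalExpo)) •
        (Cherednik.t w : Cherednik P n) • shiftAut hd lam hp m :=
  Verma.rotAut_smul hd _ _ w m

theorem headAut_t_smul (w : ReflGroup r n) (l : VermaHead P lam) :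
    headAut hd lam hp hn ((Cherednik.t w : Cherednik P n) • l) =
      zetaPow F r (-(twistShift P p hd lam * w.totalExpo)) •
        (Cherednik.t w : Cherednik P n) • headAut hd lam hp hn l := by
  obtain ⟨m, rfl⟩ := VermaHead.mk_surjective l
  rw [← map_smul, headAut_mk, headAut_mk, shiftAut_t_smul, LinearMap.map_smul_of_tower, map_smul]

omit [Algebra ℂ F] in
theorem smul_comm_base {A M : Type*} [Ring A] [Algebra F A] [AddCommGroup M] [Module F M]
    [Module A M] [IsScalarTower F A M] (a : A) (c : F) (m : M) : a • c • m = c • a • m := by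
  rw [← algebraMap_smul A c, ← algebraMap_smul A c (a • m), smul_smul, smul_smul, Algebra.commutes]

theorem t_smul_mem_vermaPart (i : Fin n) (l : ℤ) {q : ℤ} {m : Verma P lam}
    (hm : m ∈ vermaPart (shiftAut hd lam hp).toLinearMap q) :
    (Cherednik.t (ReflGroup.diagElt i (l : ZMod r)) : Cherednik P n) • m ∈
      vermaPart (shiftAut hd lam hp).toLinearMap (q - l) := by
  have hm' : shiftAut hd lam hp m = _ • m := hm
  change shiftAut hd lam hp _ = _ • _
  rw [shiftAut_t_smul, hm', smul_comm_base, smul_smul, ← zetaPow_add, ReflGroup.totalExpo_diagElt,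
    Int.cast_sub]
  congr 2
  ring

theorem t_smul_mem_headPart (i : Fin n) (l : ℤ) {q : ℤ} {m : VermaHead P lam}
    (hm : m ∈ headPart (headAut hd lam hp hn).toLinearMap q) :
    (Cherednik.t (ReflGroup.diagElt i (l : ZMod r)) : Cherednik P n) • m ∈
      headPart (headAut hd lam hp hn).toLinearMap (q - l) := by
  have hm' : headAut hd lam hp hn m = _ • m := hm
  change headAut hd lam hp hn _ = _ • _
  rw [headAut_t_smul, hm', smul_comm_base, smul_smul, ← zetaPow_add, ReflGroup.totalExpo_diagElt,
    Int.cast_sub]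
  congr 2
  ring

theorem bijOn_headPart (i : Fin n) (q : ℤ) : Set.BijOn
    (fun l : VermaHead P lam => (Cherednik.t (ReflGroup.diagElt i 1) : Cherednik P n) • l)
    (headPart (headAut hd lam hp hn).toLinearMap q)
    (headPart (headAut hd lam hp hn).toLinearMap (q - 1)) := by
  refine ⟨fun l hl => ?_, fun l _ l' _ h => ?_, fun l hl => ?_⟩
  · have := t_smul_mem_headPart hd lam hp hn i 1 hl
    rwa [Int.cast_one] at this
  · have h1 := congrArg
      (fun m : VermaHead P lam => (Cherednik.t (ReflGroup.diagElt i (-1)) : Cherednik P n) • m) h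
    simpa only [← mul_smul, Cherednik.t_diagElt_neg_mul, one_smul] using h1
  · have := t_smul_mem_headPart hd lam hp hn i (-1) hl
    rw [Int.cast_neg, Int.cast_one, sub_neg_eq_add, sub_add_cancel] at this
    refine ⟨_, this, ?_⟩
    simp only [← mul_smul, Cherednik.t_diagElt_mul_neg, one_smul]

theorem mk_eigProj (c : F) (N : ℕ) (m : Verma P lam) :
    VermaHead.mk P lam (eigProj (shiftAut hd lam hp).toLinearMap N c m) =
      eigProj (headAut hd lam hp hn).toLinearMap N c (VermaHead.mk P lam m) := by
  simp only [eigProj_apply, LinearMap.map_smul_of_tower, map_sum, headAut_pow_mk]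

theorem eigProj_mem_vermaPart (q : ℕ) (m : Verma P lam) :
    eigProj (shiftAut hd lam hp).toLinearMap (p / twistPeriod P p hd lam)
      (zetaPow F r (twistShift P p hd lam) ^ q) m ∈
        vermaPart (shiftAut hd lam hp).toLinearMap q := by
  rw [vermaPart_natCast]
  refine eigProj_mem (shiftAut_pow hd lam hp) ?_ m
  rw [← pow_mul, mul_comm, pow_mul, (isPrimitiveRoot_zetaPow_twistShift hd hp).pow_eq_one, one_pow]

theorem eigProj_of_mem_headPart {q : ℕ} {l : VermaHead P lam}
    (hl : l ∈ headPart (headAut hd lam hp hn).toLinearMap q) :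
    eigProj (headAut hd lam hp hn).toLinearMap (p / twistPeriod P p hd lam)
      (zetaPow F r (twistShift P p hd lam) ^ q) l = l := by
  rw [headPart_natCast] at hl
  exact eigProj_of_mem (natCast_period_quot_ne_zero hd lam hp)
    (pow_ne_zero _ (zetaPow_ne_zero F r _)) hl

/-- The quotient map commutes with the averaging projections, so an arbitrary preimage can be
projected to the eigenspace. -/
theorem exists_mk_eq_of_mem_headPart {q : ℕ} {l : VermaHead P lam}
    (hl : l ∈ headPart (headAut hd lam hp hn).toLinearMap q) :
    ∃ m ∈ vermaPart (shiftAut hd lam hp).toLinearMap q, VermaHead.mk P lam m = l := by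
  obtain ⟨m, rfl⟩ := VermaHead.mk_surjective l
  refine ⟨_, eigProj_mem_vermaPart hd lam hp q m, ?_⟩
  rw [mk_eigProj hd lam hp hn, eigProj_of_mem_headPart hd lam hp hn hl]

/-- The kernel of `M(λ,q) → L(λ,q)` is the intersection of `M(λ,q)` with the radical of `M(λ)`. As
`π_q` is the identity on `M(λ,q)`, this is the radical of the summand. -/
theorem exists_vermaPart_quot_equiv (q : Fin (p / twistPeriod P p hd lam)) :
    ∃ e : (vermaPart (shiftAut hd lam hp).toLinearMap (q : ℕ) ⧸
        Module.jacobson (Cherednik.fixedAlg P n p hd)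
          (vermaPart (shiftAut hd lam hp).toLinearMap (q : ℕ))) ≃ₗ[Cherednik.fixedAlg P n p hd]
          headPart (headAut hd lam hp hn).toLinearMap (q : ℕ),
        ∀ m : vermaPart (shiftAut hd lam hp).toLinearMap (q : ℕ),
          (e (Submodule.Quotient.mk m) : VermaHead P lam) = VermaHead.mk P lam m := by
  let f : vermaPart (shiftAut hd lam hp).toLinearMap (q : ℕ) →ₗ[Cherednik.fixedAlg P n p hd]
      headPart (headAut hd lam hp hn).toLinearMap (q : ℕ) :=
    { toFun := fun m => ⟨VermaHead.mk P lam m, mk_mem_headPart hd lam hp hn m.2⟩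
      map_add' := fun a b => rfl
      map_smul' := fun a b => rfl }
  have hf : Function.Surjective f := fun l => by
    obtain ⟨m, hm, e⟩ := exists_mk_eq_of_mem_headPart hd lam hp hn l.2
    exact ⟨⟨m, hm⟩, Subtype.ext e⟩
  have hker : Module.jacobson (Cherednik.fixedAlg P n p hd)
      (vermaPart (shiftAut hd lam hp).toLinearMap (q : ℕ)) = LinearMap.ker f := by
    ext m
    have h1 : m ∈ LinearMap.ker f ↔ (m : Verma P lam) ∈ vermaRad P p hd lam := by
      rw [LinearMap.mem_ker, Subtype.ext_iff]
      exact Submodule.Quotient.mk_eq_zero _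
    rw [h1]
    constructor
    · intro hm
      rw [vermaRad_eq_jacobson hd lam hn]
      exact Module.map_jacobson_le (Submodule.subtype _) ⟨m, hm, rfl⟩
    · intro hm
      rw [jacobson_vermaPart hd lam hp hn]
      exact ⟨m, hm, summandProj_apply_of_mem (isInternal_vermaPart hd lam hp) q m⟩
  exact ⟨Submodule.quotEquivOfEq _ _ hker ≪≫ₗ f.quotKerEquivOfSurjective hf, fun m => rfl⟩

end Decomposition

/-! ### Homogeneous subspaces -/

section Homogeneous

variable {F M ι : Type*} [Field F] [AddCommGroup M] [Module F M] [DecidableEq ι]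
  {N : ι → Submodule F M} (hN : DirectSum.IsInternal N)

include hN

theorem exists_sum_summandProj (m : M) :
    ∃ s : Finset ι, ∀ s', s ⊆ s' → ∑ q ∈ s', (summandProj hN q m : M) = m := by
  induction m using isInternal_induction hN with
  | mem q m hm =>
    refine ⟨{q}, fun s' hs' => ?_⟩
    rw [Finset.sum_eq_single q]
    · exact congrArg Subtype.val (summandProj_apply_of_mem hN q ⟨m, hm⟩)
    · intro q' _ hq'
      rw [summandProj_apply_of_mem_ne hN hq' hm, Submodule.coe_zero]
    · exact fun hq => absurd (hs' (Finset.mem_singleton_self q)) hq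
  | add a b ha hb =>
    obtain ⟨s, hs⟩ := ha
    obtain ⟨s₁, hs₁⟩ := hb
    refine ⟨s ∪ s₁, fun s' hs' => ?_⟩
    simp only [map_add, Submodule.coe_add, Finset.sum_add_distrib]
    rw [hs s' (Finset.union_subset_left hs'), hs₁ s' (Finset.union_subset_right hs')]
  | zero => exact ⟨∅, fun s' _ => by simp⟩

/-- A subspace stable under an operator that acts on the graded pieces by distinct scalars is
homogeneous. -/
theorem summandProj_mem_of_stable (W : Submodule F M) (A : M →ₗ[F] M) (hW : ∀ m ∈ W, A m ∈ W)
    (χ : ι → F) (hχ : Function.Injective χ) (hA : ∀ q, ∀ m ∈ N q, A m = χ q • m) (q : ι) {m : M}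
    (hm : m ∈ W) : (summandProj hN q m : M) ∈ W := by
  obtain ⟨s, hs⟩ := exists_sum_summandProj hN m
  have h1 := hs (insert q s) (Finset.subset_insert q s)
  have h2 := sum_filter_mem_of_stable W (fun _ : Unit => A) (fun _ => hW) (fun _ => χ) (insert q s)
    (fun q => (summandProj hN q m : M)) (fun i _ _ => hA i _ (summandProj hN i m).2)
    (by rw [h1]; exact hm) q
  rw [Finset.sum_eq_single q] at h2
  · exact h2
  · intro i hi hne
    simp only [Finset.mem_filter] at hi
    exact absurd (hχ (hi.2 ())) hne
  · exact fun hq => (hq (by simp)).elim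

/-- The condition `hker` says that the kernel is homogeneous, which is what a grading needs in order
to pass to a quotient. -/
theorem isInternal_map {M' : Type*} [AddCommGroup M'] [Module F M'] (f : M →ₗ[F] M')
    (hf : Function.Surjective f) (hker : ∀ m, f m = 0 → ∀ q, f (summandProj hN q m) = 0) :
    DirectSum.IsInternal (fun q => (N q).map f) := by
  refine DirectSum.isInternal_submodule_of_iSupIndep_of_iSup_eq_top ?_ ?_
  · rw [iSupIndep_def]
    intro q
    rw [Submodule.disjoint_def]
    rintro _ ⟨a, ha, rfl⟩ hz
    simp only [← Submodule.map_iSup] at hz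
    obtain ⟨b, hb, hab⟩ := hz
    have hb' : summandProj hN q b = 0 := by
      have hle : ⨆ j, ⨆ _ : j ≠ q, N j ≤ LinearMap.ker (summandProj hN q) :=
        iSup₂_le fun j hj m hm => summandProj_apply_of_mem_ne hN hj.symm hm
      exact hle hb
    have h1 := hker (a - b) (by rw [map_sub, hab, sub_self]) q
    rw [map_sub, hb', sub_zero] at h1
    have h2 := summandProj_apply_of_mem hN q ⟨a, ha⟩
    rw [← h1]
    exact congrArg (fun z : N q => f z) h2.symm
  · rw [← Submodule.map_iSup, hN.submodule_iSup_eq_top, Submodule.map_top, LinearMap.range_eq_top]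
    exact hf

end Homogeneous

/-- The dimension of a subspace is the sum of the dimensions of its intersections with the
eigenspaces of an endomorphism of finite order. -/
theorem finrank_eq_sum_eigen {F A V : Type*} [Field F] [Ring A] [Algebra F A] [AddCommGroup V]
    [Module F V] [Module A V] [IsScalarTower F A V] (D : V →ₗ[A] V) {N : ℕ} (hN : (N : F) ≠ 0)
    {ω : F} (hω : IsPrimitiveRoot ω N) (W : Submodule F V) [Module.Finite F W]
    (U : Fin N → Submodule F V) (hU : ∀ q, ∀ l ∈ U q, D l = ω ^ (q : ℕ) • l) (hUW : ∀ q, U q ≤ W)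
    (hW : ∀ q : Fin N, ∀ l ∈ W, eigProj D N (ω ^ (q : ℕ)) l ∈ U q) :
    Module.finrank F W = ∑ q, Module.finrank F (U q) := by
  have hpow : ∀ q : ℕ, (ω ^ q) ^ N = 1 := fun q => by
    rw [← pow_mul, mul_comm, pow_mul, hω.pow_eq_one, one_pow]
  have hne : ∀ q : ℕ, ω ^ q ≠ 0 := fun q => pow_ne_zero _ (hω.ne_zero fun h => hN (by
    rw [h, Nat.cast_zero]))
  have hfin : ∀ q, Module.Finite F (U q) := fun q => Submodule.finiteDimensional_of_le (hUW q)
  let g : (∀ q : Fin N, U q) →ₗ[F] W :=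
    { toFun := fun f => ⟨∑ q, (f q : V), Submodule.sum_mem _ fun q _ => hUW q (f q).2⟩
      map_add' := fun f f' => Subtype.ext (by
        simp only [Pi.add_apply, Submodule.coe_add, Finset.sum_add_distrib])
      map_smul' := fun c f => Subtype.ext (by
        simp only [Pi.smul_apply, Submodule.coe_smul, Finset.smul_sum, RingHom.id_apply]) }
  have hginj : Function.Injective g := by
    rw [injective_iff_map_eq_zero]
    intro f hf
    funext q
    have h1 : ∑ q, (f q : V) = 0 := congrArg Subtype.val hf
    have h2 := congrArg (eigProj D N (ω ^ (q : ℕ))) h1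
    rw [map_sum, map_zero, Finset.sum_eq_single q, eigProj_of_mem hN (hne q) (hU q _ (f q).2)] at h2
    · exact Subtype.ext h2
    · intro q' _ hq'
      refine eigProj_of_mem_ne (hpow q) (hpow q') (fun h => hq' (Fin.ext ?_)) (hU q' _ (f q').2)
      exact (hω.pow_inj q.2 q'.2 h).symm
    · simp
  have hgsurj : Function.Surjective g := fun l =>
    ⟨fun q => ⟨_, hW q l l.2⟩, Subtype.ext (sum_eigProj hN hω (l : V))⟩
  rw [← (LinearEquiv.ofBijective g ⟨hginj, hgsurj⟩).finrank_eq, Module.finrank_pi_fintype]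

/-! ### The grading of the radical -/

namespace Verma

variable {F : Type*} [Field F] [Algebra ℂ F] {r : ℕ} [NeZero r] {n : ℕ} {lam : RPartition r n}
  {P : ChParams F r}

/-- The operator that acts on the graded piece of degree `d` by `c ^ d`. -/
def scaleDeg (P : ChParams F r) (lam : RPartition r n) (c : F) : Verma P lam →ₗ[F] Verma P lam :=
  (basis P lam).constr F fun b => c ^ (∑ j, b.1 j) • basis P lam b

theorem scaleDeg_of_mem {c : F} {d : ℕ} {m : Verma P lam} (hm : m ∈ deg P lam d) :
    scaleDeg P lam c m = c ^ d • m := by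
  rw [deg_eq_span_basis] at hm
  induction hm using Submodule.span_induction with
  | mem m hm =>
    obtain ⟨b, hb, rfl⟩ := hm
    rw [scaleDeg, Module.Basis.constr_basis]
    congr 2
  | zero => rw [map_zero, smul_zero]
  | add a b _ _ ha hb => rw [map_add, ha, hb, smul_add]
  | smul e a _ ha => rw [map_smul, ha, smul_comm]

theorem scaleDeg_inv_apply {c : F} (hc : c ≠ 0) (m : Verma P lam) :
    scaleDeg P lam c⁻¹ (scaleDeg P lam c m) = m := by
  induction m using isInternal_induction (deg_isInternal (P := P) (lam := lam)) with
  | mem d m hm =>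
    rw [scaleDeg_of_mem hm, map_smul, scaleDeg_of_mem hm, smul_smul, ← mul_pow, mul_inv_cancel₀ hc,
      one_pow, one_smul]
  | add a b ha hb => rw [map_add, map_add, ha, hb]
  | zero => rw [map_zero, map_zero]

theorem scaleDeg_x_smul (c : F) (k : Fin n) (m : Verma P lam) :
    scaleDeg P lam c ((Cherednik.x k : Cherednik P n) • m) =
      c • (Cherednik.x k : Cherednik P n) • scaleDeg P lam c m := by
  induction m using isInternal_induction (deg_isInternal (P := P) (lam := lam)) with
  | mem d m hm =>
    rw [scaleDeg_of_mem hm, scaleDeg_of_mem (x_smul_mem_deg k hm), smul_comm_base, smul_smul,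
      pow_succ']
  | add a b ha hb => rw [smul_add, map_add, map_add, smul_add, smul_add, ha, hb]
  | zero => rw [smul_zero, map_zero, smul_zero, smul_zero]

theorem scaleDeg_t_smul (c : F) (w : ReflGroup r n) (m : Verma P lam) :
    scaleDeg P lam c ((Cherednik.t w : Cherednik P n) • m) =
      (Cherednik.t w : Cherednik P n) • scaleDeg P lam c m := by
  induction m using isInternal_induction (deg_isInternal (P := P) (lam := lam)) with
  | mem d m hm =>
    rw [scaleDeg_of_mem hm, scaleDeg_of_mem (t_smul_mem_deg w hm), smul_comm_base]
  | add a b ha hb => rw [smul_add, map_add, map_add, smul_add, ha, hb]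
  | zero => rw [smul_zero, map_zero, smul_zero]

theorem scaleDeg_y_smul {c : F} (hc : c ≠ 0) (k : Fin n) (m : Verma P lam) :
    scaleDeg P lam c ((Cherednik.y k : Cherednik P n) • m) =
      c⁻¹ • (Cherednik.y k : Cherednik P n) • scaleDeg P lam c m := by
  induction m using isInternal_induction (deg_isInternal (P := P) (lam := lam)) with
  | mem d m hm =>
    cases d with
    | zero => rw [y_smul_eq_zero k hm, map_zero, scaleDeg_of_mem hm, smul_comm_base,
        y_smul_eq_zero k hm, smul_zero, smul_zero]
    | succ d =>
      rw [scaleDeg_of_mem hm, scaleDeg_of_mem (y_smul_mem_deg k hm), smul_comm_base, smul_smul,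
        pow_succ', inv_mul_cancel_left₀ hc]
  | add a b ha hb => rw [smul_add, map_add, map_add, smul_add, smul_add, ha, hb]
  | zero => rw [smul_zero, map_zero, smul_zero, smul_zero]

/-- The preimage of a submodule under `scaleDeg c`. -/
def scaledSub {c : F} (hc : c ≠ 0) (W : Submodule (Cherednik P n) (Verma P lam)) :
    Submodule (Cherednik P n) (Verma P lam) where
  __ := ((W.restrictScalars F).comap (scaleDeg P lam c)).toAddSubmonoid
  smul_mem' a m hm := by
    refine Cherednik.smul_mem_of_stable ((W.restrictScalars F).comap (scaleDeg P lam c))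
      (fun k m hm => ?_) (fun k m hm => ?_) (fun w m hm => ?_) a m hm
    · rw [Submodule.mem_comap, scaleDeg_x_smul]
      exact Submodule.smul_mem _ _ (W.smul_mem _ hm)
    · rw [Submodule.mem_comap, scaleDeg_y_smul hc]
      exact Submodule.smul_mem _ _ (W.smul_mem _ hm)
    · rw [Submodule.mem_comap, scaleDeg_t_smul]
      exact W.smul_mem _ hm

theorem mem_scaledSub {c : F} {hc : c ≠ 0} {W : Submodule (Cherednik P n) (Verma P lam)}
    {m : Verma P lam} : m ∈ scaledSub hc W ↔ scaleDeg P lam c m ∈ W := Iff.rfl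

theorem scaledSub_scaledSub {c e : F} (hc : c ≠ 0) (he : e ≠ 0) (hec : e = c⁻¹)
    (W : Submodule (Cherednik P n) (Verma P lam)) : scaledSub hc (scaledSub he W) = W := by
  subst hec
  ext m
  rw [mem_scaledSub, mem_scaledSub, scaleDeg_inv_apply hc]

/-- Rescaling degree `d` by `c^d` turns the action of `x_k` into `c x_k` and that of `y_k` into `c⁻¹
y_k`, and commutes with the group. It therefore permutes the submodules of `M(λ)`. -/
theorem isCoatom_scaledSub {c : F} (hc : c ≠ 0) {W : Submodule (Cherednik P n) (Verma P lam)}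
    (hW : IsCoatom W) : IsCoatom (scaledSub hc W) := by
  have hc' : c⁻¹ ≠ 0 := inv_ne_zero hc
  have hle : ∀ {e : F} (he : e ≠ 0) (W W' : Submodule (Cherednik P n) (Verma P lam)), W ≤ W' →
      scaledSub he W ≤ scaledSub he W' := fun _ W W' h m hm => mem_scaledSub.mpr (h hm)
  let e : Submodule (Cherednik P n) (Verma P lam) ≃o Submodule (Cherednik P n) (Verma P lam) :=
    { toFun := scaledSub hc
      invFun := scaledSub hc'
      left_inv := scaledSub_scaledSub hc' hc (inv_inv c).symm
      right_inv := scaledSub_scaledSub hc hc' rfl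
      map_rel_iff' := fun {W W'} => ⟨fun hh => by
        have := hle hc' _ _ hh
        simpa only [Equiv.coe_fn_mk, scaledSub_scaledSub hc' hc (inv_inv c).symm] using this,
        fun hh => hle hc _ _ hh⟩ }
  exact (e.isCoatom_iff W).mpr hW

theorem scaleDeg_mem_jacobson {c : F} (hc : c ≠ 0) {m : Verma P lam}
    (hm : m ∈ Module.jacobson (Cherednik P n) (Verma P lam)) :
    scaleDeg P lam c m ∈ Module.jacobson (Cherednik P n) (Verma P lam) := by
  rw [Module.jacobson, Submodule.mem_sInf] at *
  exact fun W hW => hm (scaledSub hc W) (isCoatom_scaledSub hc hW)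

/-- The radical is stable under the rescaling with `c = 2`, whose eigenvalues `2^d` on the graded
pieces are distinct in characteristic zero. Homogeneity thus holds for every `κ`, including `κ = 0`,
where the Euler element does not separate degrees. -/
theorem degProj_mem_jacobson (d : ℕ) {m : Verma P lam}
    (hm : m ∈ Module.jacobson (Cherednik P n) (Verma P lam)) :
    (summandProj (deg_isInternal (P := P) (lam := lam)) d m : Verma P lam) ∈
      Module.jacobson (Cherednik P n) (Verma P lam) := by
  have hchar : CharZero F := charZero_of_injective_algebraMap (algebraMap ℂ F).injective
  refine summandProj_mem_of_stable (deg_isInternal (P := P) (lam := lam))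
    ((Module.jacobson (Cherednik P n) (Verma P lam)).restrictScalars F) (scaleDeg P lam 2)
    (fun m hm => scaleDeg_mem_jacobson two_ne_zero hm) (fun d => (2 : F) ^ d) (fun a b hab => ?_)
    (fun d m hm => scaleDeg_of_mem hm) d hm
  have : ((2 ^ a : ℕ) : F) = ((2 ^ b : ℕ) : F) := by push_cast; exact hab
  exact Nat.pow_right_injective le_rfl (Nat.cast_injective this)

end Verma

/-! ### The grading of the head -/

section Head

variable {F : Type*} [Field F] [Algebra ℂ F] {r : ℕ} [NeZero r] {n p : ℕ} {P : ChParams F r}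
  (lam : RPartition r n)

variable (P) in
theorem VermaHead.deg_isInternal : DirectSum.IsInternal (VermaHead.deg P lam) := by
  refine isInternal_map Verma.deg_isInternal ((VermaHead.mk P lam).restrictScalars F)
    VermaHead.mk_surjective fun m hm d => ?_
  exact (Submodule.Quotient.mk_eq_zero _).mpr
    (Verma.degProj_mem_jacobson d ((Submodule.Quotient.mk_eq_zero _).mp hm))

instance VermaHead.finite_deg (i : ℕ) : Module.Finite F (VermaHead.deg P lam i) := by
  have := Verma.finite_deg (P := P) (lam := lam) i
  unfold VermaHead.deg
  infer_instance

theorem VermaHead.t_smul_mem_deg (w : ReflGroup r n) {i : ℕ} {l : VermaHead P lam}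
    (hl : l ∈ VermaHead.deg P lam i) : (Cherednik.t w : Cherednik P n) • l ∈ VermaHead.deg P lam i := by
  obtain ⟨m, hm, rfl⟩ := hl
  exact ⟨_, Verma.t_smul_mem_deg w hm, map_smul (VermaHead.mk P lam) _ _⟩

variable (hd : ∀ i : ZMod r, P.d (i + ((r / p : ℕ) : ZMod r)) = P.d i)
  (hp : p ∣ r) (hn : 0 < n)

theorem headAut_mem_deg {i : ℕ} {l : VermaHead P lam} (hl : l ∈ VermaHead.deg P lam i) :
    headAut hd lam hp hn l ∈ VermaHead.deg P lam i := by
  obtain ⟨m, hm, rfl⟩ := hl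
  exact ⟨shiftAut hd lam hp m, Verma.rotAut_mem_deg hd _ (twistShift_relation hd lam hp) hm, rfl⟩

/-- The induced automorphism preserves degrees and so commutes with the homogeneous projections; the
components of an eigenvector are again eigenvectors. -/
theorem iSup_headPartDeg (q : ℤ) : ⨆ i, headPartDeg (headAut hd lam hp hn).toLinearMap q i =
    (headPart (headAut hd lam hp hn).toLinearMap q).restrictScalars F := by
  refine le_antisymm (iSup_le fun i => inf_le_left) fun l hl => ?_
  have hl' : headAut hd lam hp hn l = zetaPow F r _ • l := hl
  have hproj : ∀ i, (summandProj (VermaHead.deg_isInternal P lam) i l : VermaHead P lam) ∈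
      headPartDeg (headAut hd lam hp hn).toLinearMap q i := fun i => by
    refine ⟨?_, (summandProj (VermaHead.deg_isInternal P lam) i l).2⟩
    have h1 := summandProj_map (VermaHead.deg_isInternal P lam)
      (headAut hd lam hp hn).toLinearMap.toAddMonoidHom
      (fun i m hm => headAut_mem_deg lam hd hp hn hm) i l
    have h2 : headAut hd lam hp hn (summandProj (VermaHead.deg_isInternal P lam) i l) =
        summandProj (VermaHead.deg_isInternal P lam) i (headAut hd lam hp hn l) := h1.symm
    rw [hl'] at h2
    refine h2.trans ?_
    exact congrArg Subtype.val
      ((summandProj (VermaHead.deg_isInternal P lam) i).map_smul (zetaPow F r _) l)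
  obtain ⟨s, hs⟩ := exists_sum_summandProj (VermaHead.deg_isInternal P lam) l
  rw [← hs s subset_rfl]
  exact Submodule.sum_mem _ fun i _ => Submodule.mem_iSup_of_mem i (hproj i)

/-- Multiplication by `t_{ζ_1^l}` is injective, preserves degrees and moves the eigenspace by `l`.
As `l` ranges over all integers, inequalities in both directions follow. -/
theorem finrank_headPartDeg_le (i : ℕ) (q l : ℤ) :
    Module.finrank F (headPartDeg (headAut hd lam hp hn).toLinearMap q i) ≤
      Module.finrank F (headPartDeg (headAut hd lam hp hn).toLinearMap (q - l) i) := by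
  have hfin : Module.Finite F (headPartDeg (headAut hd lam hp hn).toLinearMap (q - l) i) :=
    Submodule.finiteDimensional_inf_right _ _
  let τ : VermaHead P lam →ₗ[F] VermaHead P lam := Algebra.lsmul F F (VermaHead P lam)
    (Cherednik.t (ReflGroup.diagElt ⟨0, hn⟩ (l : ZMod r)) : Cherednik P n)
  have hτ : ∀ m ∈ headPartDeg (headAut hd lam hp hn).toLinearMap q i,
      τ m ∈ headPartDeg (headAut hd lam hp hn).toLinearMap (q - l) i := fun m hm =>
    ⟨t_smul_mem_headPart hd lam hp hn _ l hm.1, VermaHead.t_smul_mem_deg lam _ hm.2⟩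
  refine LinearMap.finrank_le_finrank_of_injective (f := τ.restrict hτ) fun a b hab => ?_
  have h1 := congrArg (fun m : VermaHead P lam =>
    (Cherednik.t (ReflGroup.diagElt ⟨0, hn⟩ (-(l : ZMod r))) : Cherednik P n) • m)
    (congrArg Subtype.val hab)
  change (Cherednik.t (ReflGroup.diagElt ⟨0, hn⟩ (-(l : ZMod r))) : Cherednik P n) •
    (Cherednik.t (ReflGroup.diagElt ⟨0, hn⟩ (l : ZMod r)) : Cherednik P n) • (a : VermaHead P lam) =
    (Cherednik.t (ReflGroup.diagElt ⟨0, hn⟩ (-(l : ZMod r))) : Cherednik P n) •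
    (Cherednik.t (ReflGroup.diagElt ⟨0, hn⟩ (l : ZMod r)) : Cherednik P n) •
      (b : VermaHead P lam) at h1
  simp only [← mul_smul, Cherednik.t_diagElt_neg_mul, one_smul] at h1
  exact Subtype.ext h1

theorem finrank_headPartDeg_eq (i : ℕ) (q q' : ℤ) :
    Module.finrank F (headPartDeg (headAut hd lam hp hn).toLinearMap q i) =
      Module.finrank F (headPartDeg (headAut hd lam hp hn).toLinearMap q' i) := by
  refine le_antisymm ?_ ?_
  · have := finrank_headPartDeg_le lam hd hp hn i q (q - q')
    rwa [sub_sub_cancel] at this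
  · have := finrank_headPartDeg_le lam hd hp hn i q' (q' - q)
    rwa [sub_sub_cancel] at this

theorem eigProj_headAut_mem_headPartDeg (q : ℕ) {i : ℕ} {l : VermaHead P lam}
    (hl : l ∈ VermaHead.deg P lam i) :
    eigProj (headAut hd lam hp hn).toLinearMap (p / twistPeriod P p hd lam)
      (zetaPow F r (twistShift P p hd lam) ^ q) l ∈
        headPartDeg (headAut hd lam hp hn).toLinearMap q i := by
  obtain ⟨m, hm, rfl⟩ := hl
  refine ⟨?_, ?_⟩
  · change eigProj _ _ _ (VermaHead.mk P lam m) ∈ headPart _ _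
    rw [← mk_eigProj]
    exact mk_mem_headPart hd lam hp hn (eigProj_mem_vermaPart hd lam hp q m)
  · change eigProj _ _ _ (VermaHead.mk P lam m) ∈ _
    rw [eigProj_apply]
    refine Submodule.smul_mem _ _ (Submodule.sum_mem _ fun j hj => Submodule.smul_mem _ _ ?_)
    clear hj
    induction j with
    | zero => exact ⟨m, hm, rfl⟩
    | succ j ih =>
      rw [pow_succ', Module.End.mul_apply]
      exact headAut_mem_deg lam hd hp hn ih

theorem finrank_deg_eq (i : ℕ) : Module.finrank F (VermaHead.deg P lam i) =
    (p / twistPeriod P p hd lam) *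
      Module.finrank F (headPartDeg (headAut hd lam hp hn).toLinearMap 0 i) := by
  have h := finrank_eq_sum_eigen (headAut hd lam hp hn).toLinearMap
    (natCast_period_quot_ne_zero hd lam hp) (isPrimitiveRoot_zetaPow_twistShift hd hp)
    (VermaHead.deg P lam i)
    (fun q => headPartDeg (headAut hd lam hp hn).toLinearMap ((q : ℕ) : ℤ) i)
    (fun q l hl => by
      have h1 : l ∈ headPart (headAut hd lam hp hn).toLinearMap ((q : ℕ) : ℤ) := hl.1
      rw [headPart_natCast] at h1
      exact h1)
    (fun q => inf_le_right)
    (fun q l hl => eigProj_headAut_mem_headPartDeg lam hd hp hn q hl)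
  rw [h, Finset.sum_congr rfl fun q _ => finrank_headPartDeg_eq lam hd hp hn i _ 0,
    Finset.sum_const, Finset.card_univ, Fintype.card_fin, smul_eq_mul]

theorem finrank_headPartDeg (q : ℤ) (i : ℕ) :
    (Module.finrank F (headPartDeg (headAut hd lam hp hn).toLinearMap q i) : ℚ) =
      (twistPeriod P p hd lam : ℚ) / (p : ℚ) * (Module.finrank F (VermaHead.deg P lam i) : ℚ) := by
  rw [finrank_deg_eq lam hd hp hn i, finrank_headPartDeg_eq lam hd hp hn i q 0]
  have hk := twistPeriod_pos (lam := lam) hd hp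
  have hdvd := twistPeriod_dvd (lam := lam) hd hp
  have hp0 : (p : ℚ) ≠ 0 := Nat.cast_ne_zero.mpr fun h0 => NeZero.ne r (by
    rw [h0] at hp; exact Nat.eq_zero_of_zero_dvd hp)
  have hk0 : (twistPeriod P p hd lam : ℚ) ≠ 0 := Nat.cast_ne_zero.mpr hk.ne'
  rw [Nat.cast_mul, Nat.cast_div hdvd hk0]
  field_simp

end Head

/-! ### The Euler element -/

namespace Cherednik

variable {F : Type*} [Field F] [Algebra ℂ F] {r : ℕ} [NeZero r] {P : ChParams F r} {n : ℕ}

variable (P) in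
/-- The element `∑_j d_j e_{ij}`. -/
def idemSum (i : Fin n) : Cherednik P n :=
  ∑ j : ZMod r, P.d j •
    ((r : F)⁻¹ • ∑ l : ZMod r, zetaPow F r (-(l * j)) • t (ReflGroup.diagElt i l))

variable (P) in
/-- The sum of the reflections `ζ_i ^ l s_{ij} ζ_i ^ {-l}`. -/
def reflSum (i j : Fin n) : Cherednik P n := ∑ l : ZMod r, t (ReflGroup.refl i j l)

variable (P) in
/-- The sum of the reflections `ζ_i ^ l s_{ij} ζ_i ^ {-l}`, weighted by `ζ ^ {-l}`. -/
def reflWeightedSum (i j : Fin n) : Cherednik P n :=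
  ∑ l : ZMod r, zetaPow F r (-l) • t (ReflGroup.refl i j l)

variable (P n) in
/-- The Euler element. -/
def euler : Cherednik P n := ∑ i, x i * y i - ∑ i, idemSum P i - P.c0 • ∑ i, jm P i

theorem diagElt_mul_x (i k : Fin n) (l : ZMod r) : (t (ReflGroup.diagElt i l) : Cherednik P n) * x k =
    (if k = i then zetaPow F r (-l) else 1) • (x k * t (ReflGroup.diagElt i l)) := by
  have h := t_mul_x (P := P) (ReflGroup.diagElt i l) k
  rw [ReflGroup.right_diagElt, Equiv.Perm.one_apply, ReflGroup.expo_diagElt] at h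
  refine h.trans ?_
  split_ifs
  · rfl
  · rw [neg_zero, zetaPow_zero]; rfl

theorem idemSum_mul_x_of_ne {i k : Fin n} (h : i ≠ k) :
    idemSum P i * x k = x k * idemSum P i := by
  simp only [idemSum, Finset.sum_mul, Finset.mul_sum, smul_mul_assoc, mul_smul_comm, diagElt_mul_x,
    if_neg h.symm, one_smul]

/-- Moving `x_k` across turns `e_{kj}` into `e_{k,j+1}`; after reindexing, `d_j` is replaced by
`d_{j-1}`, and the difference is `dTerm`. -/
theorem idemSum_mul_x_self (k : Fin n) :
    idemSum P k * x k = x k * idemSum P k - x k * dTerm P (tHom P) k := by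
  have h1 : idemSum P k - dTerm P (tHom P) k = ∑ j : ZMod r, P.d (j - 1) •
      ((r : F)⁻¹ • ∑ l : ZMod r, zetaPow F r (-(l * j)) • t (ReflGroup.diagElt k l)) := by
    rw [idemSum, dTerm, ← Finset.sum_sub_distrib]
    refine Finset.sum_congr rfl fun j _ => ?_
    change _ - _ • ((r : F)⁻¹ • ∑ l : ZMod r, zetaPow F r (-(l * j)) •
      (t (ReflGroup.diagElt k l) : Cherednik P n)) = _
    rw [← sub_smul, sub_sub_cancel]
  rw [← mul_sub, h1, ← Equiv.sum_comp (Equiv.addRight (1 : ZMod r)), idemSum]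
  simp only [Finset.sum_mul, Finset.mul_sum, smul_mul_assoc, mul_smul_comm, diagElt_mul_x,
    if_true, Equiv.coe_addRight, add_sub_cancel_right, smul_smul, ← zetaPow_add, mul_add, mul_one,
    neg_add]

theorem reflSum_symm {i j : Fin n} (h : i ≠ j) : reflSum P j i = reflSum P i j := by
  unfold reflSum
  rw [← Equiv.sum_comp (Equiv.neg (ZMod r))]
  refine Finset.sum_congr rfl fun l _ => ?_
  rw [Equiv.neg_apply, ReflGroup.refl_symm h, neg_neg]

theorem reflSum_mul_x_left {k j : Fin n} (h : k ≠ j) :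
    reflSum P k j * x k = x j * reflWeightedSum P j k := by
  unfold reflSum reflWeightedSum
  rw [← Equiv.sum_comp (Equiv.neg (ZMod r)), Finset.sum_mul, Finset.mul_sum]
  refine Finset.sum_congr rfl fun l _ => ?_
  have h1 := t_mul_x (P := P) (ReflGroup.refl k j (-l)) k
  rw [ReflGroup.right_refl, Equiv.swap_apply_left, ReflGroup.expo_refl h, if_neg h.symm, if_pos rfl,
    neg_neg] at h1
  rw [Equiv.neg_apply, mul_smul_comm, ReflGroup.refl_symm h]
  exact h1

theorem reflSum_mul_x_of_ne {i j k : Fin n} (h : i ≠ j) (hi : k ≠ i) (hj : k ≠ j) :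
    reflSum P i j * x k = x k * reflSum P i j := by
  unfold reflSum
  rw [Finset.sum_mul, Finset.mul_sum]
  refine Finset.sum_congr rfl fun l _ => ?_
  have h1 := t_mul_x (P := P) (ReflGroup.refl i j l) k
  rw [ReflGroup.right_refl, Equiv.swap_apply_of_ne_of_ne hi hj, ReflGroup.expo_refl h, if_neg hi,
    if_neg hj, neg_zero, zetaPow_zero, one_smul] at h1
  exact h1

/-- The Jucys-Murphy elements together run once over each unordered pair of indices, and only the
reflections that involve `k` fail to commute with `x_k`. The case distinction in the proof treats
`k` as the larger or the smaller index of the pair. -/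
theorem sum_jm_mul_x (k : Fin n) : (∑ i, jm P i) * x k = x k * ∑ i, jm P i +
    ∑ j ∈ Finset.univ.erase k, (x j * reflWeightedSum P j k - x k * reflSum P k j) := by
  let c : Fin n → Cherednik P n := fun j => x j * reflWeightedSum P j k - x k * reflSum P k j
  have hc : ∀ i j : Fin n, j < i → reflSum P j i * x k - x k * reflSum P j i =
      (if i = k then c j else 0) + if j = k then c i else 0 := by
    intro i j hij
    by_cases hi : i = k
    · subst hi
      rw [if_pos rfl, if_neg hij.ne, add_zero, reflSum_symm hij.ne', reflSum_mul_x_left hij.ne']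
    · by_cases hj : j = k
      · subst hj
        rw [if_neg hi, if_pos rfl, zero_add, reflSum_mul_x_left hij.ne]
      · rw [if_neg hi, if_neg hj, reflSum_mul_x_of_ne hij.ne (Ne.symm hj) (Ne.symm hi), sub_self,
          add_zero]
  rw [← sub_eq_iff_eq_add', Finset.sum_mul, Finset.mul_sum, ← Finset.sum_sub_distrib]
  have h1 : ∀ i, jm P i * x k - x k * jm P i = (if i = k then ∑ j with j < k, c j else 0) +
      if k < i then c i else 0 := by
    intro i
    change (∑ j : Fin n with j < i, reflSum P j i) * x k -
      x k * (∑ j : Fin n with j < i, reflSum P j i) = _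
    rw [Finset.sum_mul, Finset.mul_sum, ← Finset.sum_sub_distrib,
      Finset.sum_congr rfl fun j hj => hc i j (Finset.mem_filter.mp hj).2, Finset.sum_add_distrib,
      Finset.sum_ite_eq']
    congr 1
    · split_ifs with h
      · rw [h]
      · simp
    · simp
  rw [Finset.sum_congr rfl fun i _ => h1 i, Finset.sum_add_distrib, Finset.sum_ite_eq',
    if_pos (Finset.mem_univ k), ← Finset.sum_filter, ← Finset.sum_union]
  · refine Finset.sum_congr ?_ fun _ _ => rfl
    ext j
    simp only [Finset.mem_union, Finset.mem_filter, Finset.mem_univ, true_and, Finset.mem_erase,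
      and_true]
    exact lt_or_lt_iff_ne
  · rw [Finset.disjoint_filter]
    exact fun j _ h h' => lt_asymm h h'

/-- The commutator of `∑ x_i y_i` with `x_k` is `κ x_k` plus terms in diagonal elements and
reflections. The two correction terms in `euler` are chosen so that their commutators cancel these.
-/
theorem euler_mul_x (k : Fin n) : euler P n * x k = x k * euler P n + P.kappa • x k := by
  have h1 : (∑ i, x i * y i) * x k = x k * (∑ i, x i * y i : Cherednik P n) +
      ∑ i, x i * commElt P (tHom P) i k := by
    rw [Finset.sum_mul, Finset.mul_sum, ← Finset.sum_add_distrib]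
    refine Finset.sum_congr rfl fun i _ => ?_
    rw [mul_assoc, y_mul_x, mul_add, ← mul_assoc, x_comm i k, mul_assoc]
  have h2 : (∑ i, idemSum P i) * x k = x k * (∑ i, idemSum P i : Cherednik P n) -
      x k * dTerm P (tHom P) k := by
    rw [← Finset.add_sum_erase _ _ (Finset.mem_univ k), add_mul, mul_add, idemSum_mul_x_self,
      Finset.sum_mul, Finset.mul_sum, Finset.sum_congr rfl fun i hi =>
        idemSum_mul_x_of_ne (Finset.ne_of_mem_erase hi)]
    abel
  have h3 : ∑ i, x i * commElt P (tHom P) i k = P.kappa • x k - x k * dTerm P (tHom P) k +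
      P.c0 • ∑ j ∈ Finset.univ.erase k, (x j * reflWeightedSum P j k - x k * reflSum P k j) := by
    have e1 : commElt P (tHom P) k k = algebraMap F _ P.kappa - dTerm P (tHom P) k -
        P.c0 • ∑ j ∈ Finset.univ.erase k, reflSum P k j := if_pos rfl
    have e2 : ∀ j ∈ Finset.univ.erase k, x j * commElt P (tHom P) j k =
        P.c0 • (x j * reflWeightedSum P j k) := fun j hj => by
      have : commElt P (tHom P) j k = P.c0 • reflWeightedSum P j k :=
        if_neg (Finset.ne_of_mem_erase hj)
      rw [this, mul_smul_comm]
    rw [← Finset.add_sum_erase _ _ (Finset.mem_univ k), Finset.sum_congr rfl e2, e1, mul_sub,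
      mul_sub, ← Algebra.commutes, ← Algebra.smul_def, mul_smul_comm, Finset.mul_sum,
      Finset.sum_sub_distrib, smul_sub, Finset.smul_sum (s := Finset.univ.erase k)
        (f := fun j => x j * reflWeightedSum P j k)]
    abel
  unfold euler
  rw [sub_mul, sub_mul, smul_mul_assoc, h1, h2, h3, sum_jm_mul_x, mul_sub, mul_sub, mul_smul_comm,
    smul_add]
  abel

/-- The automorphism `α` shifts the index `j` of the idempotents by `r/p`, a period of the
parameters `d_j`. -/
theorem idemSum_mem_fixedAlg {p : ℕ} (hd : ∀ i : ZMod r, P.d (i + ((r / p : ℕ) : ZMod r)) = P.d i)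
    (i : Fin n) : idemSum P i ∈ fixedAlg P n p hd := by
  rw [mem_fixedAlg]
  unfold idemSum
  simp only [map_sum, map_smul, alpha_t, ReflGroup.totalExpo_diagElt]
  refine (Equiv.sum_comp (Equiv.addRight ((r / p : ℕ) : ZMod r)) _).symm.trans ?_
  refine Finset.sum_congr rfl fun j _ => ?_
  simp only [Equiv.coe_addRight, hd, smul_smul]
  congr 1
  refine Finset.sum_congr rfl fun l _ => ?_
  rw [← zetaPow_add]
  congr 2
  ring

theorem euler_mem_fixedAlg {p : ℕ} (hd : ∀ i : ZMod r, P.d (i + ((r / p : ℕ) : ZMod r)) = P.d i) :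
    euler P n ∈ fixedAlg P n p hd :=
  sub_mem (sub_mem (sum_mem fun i _ => mul_mem (x_mem_fixedAlg hd i) (y_mem_fixedAlg hd i))
    (sum_mem fun i _ => idemSum_mem_fixedAlg hd i))
    (Subalgebra.smul_mem _ (sum_mem fun i _ => jm_mem_fixedAlg hd i) _)

end Cherednik

/-! ### Eigenvalues of the Euler element on the graded pieces -/

namespace Verma

variable {F : Type*} [Field F] [Algebra ℂ F] {r : ℕ} [NeZero r] {P : ChParams F r} {n : ℕ}
  {lam : RPartition r n}

theorem idemSum_smul_v (i : Fin n) (T : SYT lam) :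
    Cherednik.idemSum P i • v P T = P.d (T.beta i) • v P T := by
  have hr : (r : F) ≠ 0 := natCast_ne_zero_of_dvd F dvd_rfl
  unfold Cherednik.idemSum
  simp only [Finset.sum_smul, smul_assoc, (youngFamily_v P).diag, smul_smul, ← zetaPow_add]
  have h1 : ∀ j : ZMod r, ∑ l : ZMod r, zetaPow F r (-(l * j) + l * T.beta i) =
      if T.beta i - j = 0 then (r : F) else 0 := fun j => by
    rw [← zetaPow_sum_mul]
    refine Finset.sum_congr rfl fun l _ => ?_
    congr 1
    ring
  simp only [← Finset.sum_smul, h1]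
  rw [Finset.sum_eq_single (T.beta i)]
  · rw [sub_self, if_pos rfl, smul_smul, mul_assoc, inv_mul_cancel₀ hr, mul_one]
  · intro j _ hj
    rw [if_neg (sub_ne_zero.mpr hj.symm), zero_smul, smul_zero]
  · simp

/-- The eigenvalue of the Euler element on the degree zero part of the Verma module. -/
theorem exists_euler_smul_v : ∃ e : F, ∀ T : SYT lam, Cherednik.euler P n • v P T = e • v P T := by
  let g : ZMod r × ℕ × ℕ → F := fun b => -P.d b.1 - P.c0 * ((r : F) * (boxCt b : F))
  obtain ⟨T₀⟩ := (inferInstance : Nonempty (SYT lam))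
  refine ⟨∑ i, g (T₀.1 i), fun T => ?_⟩
  -- The eigenvalue on `v_T` is a sum over the boxes of the shape, hence independent of the filling.
  rw [T₀.2.sum_eq T.2 g]
  unfold Cherednik.euler
  simp only [sub_smul, Finset.sum_smul, mul_smul, (youngFamily_v P).y, smul_zero,
    Finset.sum_const_zero, idemSum_smul_v, smul_assoc, (youngFamily_v P).jm_smul, zero_sub, g,
    Finset.smul_sum]
  rw [← Finset.sum_neg_distrib, ← Finset.sum_sub_distrib]
  refine Finset.sum_congr rfl fun i _ => ?_
  rw [neg_smul]
  rfl

theorem exists_euler_smul : ∃ e : F, ∀ (d : ℕ), ∀ m ∈ deg P lam d,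
    Cherednik.euler P n • m = (e + d * P.kappa) • m := by
  obtain ⟨e, he⟩ := exists_euler_smul_v (P := P) (lam := lam)
  refine ⟨e, fun d => ?_⟩
  induction d with
  | zero =>
    intro m hm
    rw [deg_zero] at hm
    rw [Nat.cast_zero, zero_mul, add_zero]
    induction hm using Submodule.span_induction with
    | mem m hm => obtain ⟨T, rfl⟩ := hm; exact he T
    | zero => rw [smul_zero, smul_zero]
    | add a b _ _ ha hb => rw [smul_add, smul_add, ha, hb]
    | smul c a _ ha => rw [smul_comm_base, ha, smul_comm]
  | succ d ih =>
    let W : Submodule F (Verma P lam) := LinearMap.ker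
      (act (Cherednik.euler P n) - (e + ((d + 1 : ℕ) : F) * P.kappa) • LinearMap.id :
        Verma P lam →ₗ[F] Verma P lam)
    have hW : ∀ m, m ∈ W ↔ Cherednik.euler P n • m = (e + ((d + 1 : ℕ) : F) * P.kappa) • m :=
      fun m => by
        rw [LinearMap.mem_ker, LinearMap.sub_apply, sub_eq_zero]
        rfl
    have hle : deg P lam (d + 1) ≤ W := deg_succ_le fun k m hm => by
      rw [hW, ← mul_smul, Cherednik.euler_mul_x, add_smul, mul_smul, ih m hm, smul_comm_base,
        smul_assoc, ← add_smul, Nat.cast_succ]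
      congr 1
      ring
    exact fun m hm => (hW m).mp (hle hm)

/-- If `κ ≠ 0`, then a subspace stable under the Euler element is homogeneous. -/
theorem degProj_mem_of_euler_stable (hκ : P.kappa ≠ 0) (W : Submodule F (Verma P lam))
    (hW : ∀ m ∈ W, Cherednik.euler P n • m ∈ W) (d : ℕ) {m : Verma P lam} (hm : m ∈ W) :
    (summandProj (deg_isInternal (P := P) (lam := lam)) d m : Verma P lam) ∈ W := by
  have hchar : CharZero F := charZero_of_injective_algebraMap (algebraMap ℂ F).injective
  obtain ⟨e, he⟩ := exists_euler_smul (P := P) (lam := lam)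
  refine summandProj_mem_of_stable (deg_isInternal (P := P) (lam := lam)) W
    (act (Cherednik.euler P n)) hW (fun d => e + (d : F) * P.kappa) (fun a b hab => ?_) he d hm
  exact Nat.cast_injective (mul_right_cancel₀ hκ (add_left_cancel hab))

end Verma

/-! ### Irreducibility of the heads -/

/-- If all proper submodules lie in a proper additive subgroup, then the radical is the greatest
proper submodule. -/
theorem isCoatom_jacobson_of_le {A X : Type*} [Ring A] [AddCommGroup X] [Module A X]
    (U : AddSubgroup X) (hU : ∃ x, x ∉ U) (h : ∀ Q : Submodule A X, Q ≠ ⊤ → ∀ m ∈ Q, m ∈ U) :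
    IsCoatom (Module.jacobson A X) := by
  -- The largest submodule contained in `U`. It contains every proper submodule and is itself
  -- proper, so it is the only maximal one.
  let K : Submodule A X :=
    { carrier := {m | ∀ a : A, a • m ∈ U}
      zero_mem' := fun a => by rw [smul_zero]; exact U.zero_mem
      add_mem' := fun hx hy a => by rw [smul_add]; exact U.add_mem (hx a) (hy a)
      smul_mem' := fun c m hm a => by rw [← mul_smul]; exact hm (a * c) }
  have hK : ∀ m ∈ K, m ∈ U := fun m hm => by
    have h1 : (1 : A) • m ∈ U := hm 1
    rwa [one_smul] at h1
  have hle : ∀ Q : Submodule A X, Q ≠ ⊤ → Q ≤ K := fun Q hQ m hm a => h Q hQ _ (Q.smul_mem a hm)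
  have hcoatom : IsCoatom K := by
    refine ⟨fun e => ?_, fun Q hQ => ?_⟩
    · obtain ⟨x, hx⟩ := hU
      exact hx (hK x (by rw [e]; trivial))
    · by_contra hcon
      exact absurd (hle Q hcon) (not_le_of_gt hQ)
  have : Module.jacobson A X = K := by
    refine le_antisymm (sInf_le hcoatom) (le_sInf fun Q hQ => ?_)
    have h1 := hle Q hQ.1
    rcases h1.lt_or_eq with h2 | h2
    · exact absurd (hQ.2 K h2) hcoatom.1
    · exact h2.ge
  rw [this]
  exact hcoatom

section Eigen

variable {F A M : Type*} [Field F] [Ring A] [Algebra F A] [AddCommGroup M] [Module F M]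
    [Module A M] [IsScalarTower F A M] {C : M →ₗ[A] M} {N : ℕ}

theorem eigProj_smul_base (c e : F) (m : M) : eigProj C N c (e • m) = e • eigProj C N c m := by
  rw [← algebraMap_smul A e, eigProj_smul, algebraMap_smul]

theorem eigProj_pow_apply (hC : C ^ N = 1) {c : F} (hc : c ^ N = 1) (i : ℕ) (m : M) :
    eigProj C N c ((C ^ i) m) = c ^ i • eigProj C N c m := by
  induction i with
  | zero => simp
  | succ i ih =>
    have h1 : ∀ m, eigProj C N c (C m) = C (eigProj C N c m) := fun m => by
      rw [eigProj_apply, eigProj_apply, LinearMap.map_smul_of_tower, map_sum]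
      congr 1
      refine Finset.sum_congr rfl fun j _ => ?_
      rw [LinearMap.map_smul_of_tower, ← Module.End.mul_apply, ← Module.End.mul_apply, ← pow_succ,
        pow_succ']
    rw [pow_succ', Module.End.mul_apply, h1, ih, LinearMap.map_smul_of_tower, eigProj_mem hC hc,
      smul_smul, pow_succ]

end Eigen

/-! ### Submodules of `M(λ,q)` over `ℍ_p` -/

section Simple

variable {F : Type*} [Field F] [Algebra ℂ F] {r : ℕ} [NeZero r] {n p : ℕ} {P : ChParams F r}
  (hd : ∀ i : ZMod r, P.d (i + ((r / p : ℕ) : ZMod r)) = P.d i) (lam : RPartition r n)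
  (hp : p ∣ r) (hn : 0 < n)

theorem exists_natCast_mul_div_eq (hp : p ∣ r) {m : ZMod r} (hm : (p : ZMod r) * m = 0) :
    ∃ j : ℕ, m = ((j * (r / p) : ℕ) : ZMod r) := by
  obtain ⟨l, rfl⟩ := ZMod.natCast_zmod_surjective m
  rw [← Nat.cast_mul, ZMod.natCast_eq_zero_iff] at hm
  have hp0 : 0 < p := Nat.pos_of_ne_zero fun h0 => NeZero.ne r (by
    rw [h0] at hp; exact Nat.eq_zero_of_zero_dvd hp)
  obtain ⟨j, hj⟩ : r / p ∣ l := by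
    rw [← Nat.mul_dvd_mul_iff_left hp0, Nat.mul_div_cancel' hp]
    exact hm
  exact ⟨j, by rw [hj, mul_comm]⟩

variable {lam}

/-- Tableaux with the same weights over the fixed algebra differ by a power of the rotation. -/
theorem exists_pow_shiftAut_v {T T' : SYT lam} (hct : ∀ i, T'.ct i = T.ct i)
    (hβ : ∀ i j, T'.beta i - T'.beta j = T.beta i - T.beta j)
    (hpβ : ∀ i, (p : ZMod r) * T'.beta i = p * T.beta i) :
    ∃ e : ℕ, Verma.v P T' = ((shiftAut hd lam hp).toLinearMap ^ e) (Verma.v P T) := by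
  rcases Nat.eq_zero_or_pos n with hn | hn
  · subst hn
    exact ⟨0, congrArg (Verma.v P) (Subtype.ext (funext fun i => i.elim0))⟩
  -- Equality after multiplication by `p` makes the shift of the first label a multiple of `r/p`;
  -- equality of the label differences then gives the same shift at all entries.
  obtain ⟨j, hj⟩ := exists_natCast_mul_div_eq (m := T'.beta ⟨0, hn⟩ - T.beta ⟨0, hn⟩) hp (by
    rw [mul_sub, hpβ, sub_self])
  obtain ⟨h, rfl⟩ := SYT.exists_rotate_eq (T := T) (U := T') (m := ((j * (r / p) : ℕ) : ZMod r))
    (fun i => by rw [← hj]; linear_combination hβ i ⟨0, hn⟩) hct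
  obtain ⟨e, rfl⟩ := twistPeriod_dvd_of_rotate_eq hd hp h
  refine ⟨e, ?_⟩
  have h1 := Verma.rotAut_pow_xMon_smul_v hd (rotate_twistShift hd hp)
    (twistShift_relation hd lam hp) e 0 T
  rw [Cherednik.xMon_zero, one_smul, one_smul] at h1
  refine Eq.trans ?_ h1.symm
  congr 1
  refine Subtype.ext (funext fun a => Prod.ext ?_ rfl)
  change _ + _ = _ + _
  congr 1
  unfold twistShift
  push_cast
  ring

variable (lam) in
/-- The projection onto `M(λ,q)`. -/
def partProj (q : ℕ) : Verma P lam →+ Verma P lam :=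
  eigProj (shiftAut hd lam hp).toLinearMap (p / twistPeriod P p hd lam)
    (zetaPow F r (twistShift P p hd lam) ^ q)

theorem partProj_smul (q : ℕ) {b : Cherednik P n} (hb : b ∈ Cherednik.fixedAlg P n p hd)
    (m : Verma P lam) : partProj hd lam hp q (b • m) = b • partProj hd lam hp q m :=
  eigProj_smul (shiftAut hd lam hp).toLinearMap _ _ (⟨b, hb⟩ : Cherednik.fixedAlg P n p hd) m

theorem partProj_smul_base (q : ℕ) (c : F) (m : Verma P lam) :
    partProj hd lam hp q (c • m) = c • partProj hd lam hp q m := eigProj_smul_base _ _ _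

theorem partProj_mem (q : ℕ) (m : Verma P lam) :
    partProj hd lam hp q m ∈ vermaPart (shiftAut hd lam hp).toLinearMap q :=
  eigProj_mem_vermaPart hd lam hp q m

theorem partProj_of_mem {q : ℕ} {m : Verma P lam}
    (hm : m ∈ vermaPart (shiftAut hd lam hp).toLinearMap q) : partProj hd lam hp q m = m := by
  rw [vermaPart_natCast] at hm
  exact eigProj_of_mem (natCast_period_quot_ne_zero hd lam hp)
    (pow_ne_zero _ (zetaPow_ne_zero F r _)) hm

theorem partProj_pow_shiftAut (q e : ℕ) (m : Verma P lam) :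
    partProj hd lam hp q (((shiftAut hd lam hp).toLinearMap ^ e) m) =
      (zetaPow F r (twistShift P p hd lam) ^ q) ^ e • partProj hd lam hp q m := by
  refine eigProj_pow_apply (shiftAut_pow hd lam hp) ?_ e m
  rw [← pow_mul, mul_comm, pow_mul, (isPrimitiveRoot_zetaPow_twistShift hd hp).pow_eq_one, one_pow]

theorem partProj_mem_of_forall_v {q : ℕ}
    (N : Submodule (Cherednik.fixedAlg P n p hd) (Verma P lam))
    (h : ∀ T, partProj hd lam hp q (Verma.v P T) ∈ N) (m : Verma P lam) :
    partProj hd lam hp q m ∈ N := by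
  have hm : m ∈ Submodule.span F (Set.range fun b : (Fin n →₀ ℕ) × SYT lam =>
      (Cherednik.xMon b.1 : Cherednik P n) • Verma.v P b.2) := by
    rw [Verma.span_monomials]; trivial
  induction hm using Submodule.span_induction with
  | mem m hm =>
    obtain ⟨b, rfl⟩ := hm
    change partProj hd lam hp q ((Cherednik.xMon b.1 : Cherednik P n) • Verma.v P b.2) ∈ N
    rw [partProj_smul hd hp q (Cherednik.xMon_mem_fixedAlg hd _)]
    exact N.smul_mem (⟨_, Cherednik.xMon_mem_fixedAlg hd _⟩ : Cherednik.fixedAlg P n p hd) (h b.2)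
  | zero => rw [map_zero]; exact N.zero_mem
  | add a b _ _ ha hb => rw [map_add]; exact N.add_mem ha hb
  | smul c a _ ha => rw [partProj_smul_base]; exact N.smul_of_tower_mem c ha

/-- The elements of the fixed algebra whose joint eigenvalues separate tableaux up to rotation. -/
def weightElt : Fin n ⊕ (Fin n × Fin n) ⊕ Fin n → Cherednik P n
  | .inl i => Cherednik.jm P i
  | .inr (.inl (i, j)) => Cherednik.t (ReflGroup.diagElt i 1 * ReflGroup.diagElt j (-1))
  | .inr (.inr i) => Cherednik.t (ReflGroup.diagElt i (p : ZMod r))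

variable (F p) in
/-- The eigenvalues of `weightElt`. -/
def weightVal : Fin n ⊕ (Fin n × Fin n) ⊕ Fin n → SYT lam → F
  | .inl i, T => (r : F) * (T.ct i : F)
  | .inr (.inl (i, j)), T => zetaPow F r (T.beta i - T.beta j)
  | .inr (.inr i), T => zetaPow F r (p * T.beta i)

include hp in
theorem weightElt_mem_fixedAlg (a : Fin n ⊕ (Fin n × Fin n) ⊕ Fin n) :
    weightElt (P := P) (p := p) a ∈ Cherednik.fixedAlg P n p hd := by
  rcases a with i | ⟨i, j⟩ | i
  · exact Cherednik.jm_mem_fixedAlg hd i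
  · refine Cherednik.t_mem_fixedAlg_of_totalExpo hd ?_
    rw [ReflGroup.totalExpo_mul, ReflGroup.totalExpo_diagElt, ReflGroup.totalExpo_diagElt,
      add_neg_cancel]
  · refine Cherednik.t_mem_fixedAlg hd ?_
    change _ * _ = _
    rw [ReflGroup.totalExpo_diagElt, natCast_div_mul_eq_zero_iff hp]

theorem weightElt_smul_v (a : Fin n ⊕ (Fin n × Fin n) ⊕ Fin n) (T : SYT lam) :
    weightElt (P := P) (p := p) a • Verma.v P T = weightVal F p a T • Verma.v P T := by
  have hv := Verma.youngFamily_v P (lam := lam)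
  rcases a with i | ⟨i, j⟩ | i
  · exact hv.jm_smul T i
  · change Cherednik.t _ • _ = zetaPow F r _ • _
    rw [Cherednik.t_mul, mul_smul, hv.diag, smul_comm_base, hv.diag, smul_smul, ← zetaPow_add]
    congr 2
    ring
  · exact hv.diag T i p

theorem exists_pow_of_weightVal_eq {T T' : SYT lam}
    (h : ∀ a, weightVal F p a T' = weightVal F p a T) :
    ∃ e : ℕ, Verma.v P T' = ((shiftAut hd lam hp).toLinearMap ^ e) (Verma.v P T) := by
  have hr : (r : F) ≠ 0 := natCast_ne_zero_of_dvd F dvd_rfl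
  have hchar : CharZero F := charZero_of_injective_algebraMap (algebraMap ℂ F).injective
  exact exists_pow_shiftAut_v hd hp
    (fun i => Int.cast_injective (mul_left_cancel₀ hr (h (.inl i))))
    (fun i j => zetaPow_injective F r (h (.inr (.inl (i, j)))))
    (fun i => zetaPow_injective F r (h (.inr (.inr i))))

/-- A submodule of `M(λ,q)` with a nonzero element of degree zero contains some
`π_q(v_T) ≠ 0`. -/
theorem exists_partProj_v_mem {q : ℕ} {N : Submodule (Cherednik.fixedAlg P n p hd) (Verma P lam)}
    (hN : N ≤ vermaPart (shiftAut hd lam hp).toLinearMap q) {u : Verma P lam} (hu : u ∈ N)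
    (hu0 : u ∈ Verma.deg P lam 0) (hne : u ≠ 0) :
    ∃ T, partProj hd lam hp q (Verma.v P T) ∈ N := by
  classical
  have : Fintype (SYT lam) := Fintype.ofFinite _
  obtain ⟨c, rfl⟩ := Verma.exists_eq_sum_of_mem_deg_zero hu0
  obtain ⟨T, hT⟩ : ∃ T, c T ≠ 0 := by
    by_contra! hcon
    exact hne (by simp [hcon])
  -- The part of `u` supported on tableaux with the same weights as `T` still belongs to `N`,
  -- because the weight elements lie in `ℍ_p`.
  have htrunc := sum_filter_mem_of_stable (N.restrictScalars F)
    (fun a : Fin n ⊕ (Fin n × Fin n) ⊕ Fin n =>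
      (Verma.act (weightElt (P := P) (p := p) a) : Verma P lam →ₗ[F] Verma P lam))
    (fun a m hm => N.smul_mem (⟨_, weightElt_mem_fixedAlg hd hp a⟩ : Cherednik.fixedAlg P n p hd) hm)
    (weightVal F p) Finset.univ (fun T => c T • Verma.v P T)
    (fun T _ a => by rw [map_smul, Verma.act_apply, weightElt_smul_v, smul_comm]) hu T
  obtain ⟨s, hs, hz⟩ : ∃ s : Finset (SYT lam),
      (∀ i, i ∈ s ↔ ∀ a, weightVal F p a i = weightVal F p a T) ∧
        ∑ i ∈ s, c i • Verma.v P i ∈ N :=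
    ⟨_, fun i => by simp only [Finset.mem_filter, Finset.mem_univ, true_and], htrunc⟩
  set z := ∑ i ∈ s, c i • Verma.v P i with hzdef
  have hz0 : z ≠ 0 := fun h0 => hT
    (linearIndependent_iff'.mp (Verma.linearIndependent_v P) s c h0 T ((hs T).mpr fun _ => rfl))
  choose! e he using fun (T' : SYT lam) (h : ∀ a, weightVal F p a T' = weightVal F p a T) =>
    exists_pow_of_weightVal_eq hd hp h
  -- All tableaux left are rotations of `T`, so their images under `π_q` are multiples of
  -- `π_q(v_T)`. Since `z` lies in `M(λ,q)` it equals its own projection and is a multiple of that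
  -- single vector.
  have h1 : z = (∑ i ∈ s, c i * (zetaPow F r (twistShift P p hd lam) ^ q) ^ e i) •
      partProj hd lam hp q (Verma.v P T) := by
    refine (partProj_of_mem hd hp (hN hz)).symm.trans ?_
    rw [hzdef, map_sum, Finset.sum_smul]
    refine Finset.sum_congr rfl fun i hi => ?_
    rw [partProj_smul_base, he i ((hs i).mp hi), partProj_pow_shiftAut, smul_smul]
  set γ := ∑ i ∈ s, c i * (zetaPow F r (twistShift P p hd lam) ^ q) ^ e i
  have hγ : γ ≠ 0 := fun h0 => hz0 (by rw [h1, h0, zero_smul])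
  refine ⟨T, ?_⟩
  have h2 : partProj hd lam hp q (Verma.v P T) = γ⁻¹ • z := by
    rw [h1, smul_smul, inv_mul_cancel₀ hγ, one_smul]
  rw [h2]
  exact N.smul_of_tower_mem _ hz

/-- From one `π_q(v_T)` in `N` the others are reached by adjacent exchanges between standard
tableaux: these lie in `ℍ_p`, and their off-diagonal coefficients are nonzero. The vectors
`π_q(v_U)` then generate `M(λ,q)` over `ℍ_p`. -/
theorem eq_vermaPart_of_mem_deg_zero {q : ℕ}
    {N : Submodule (Cherednik.fixedAlg P n p hd) (Verma P lam)}
    (hN : N ≤ vermaPart (shiftAut hd lam hp).toLinearMap q) {u : Verma P lam} (hu : u ∈ N)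
    (hu0 : u ∈ Verma.deg P lam 0) (hne : u ≠ 0) :
    N = vermaPart (shiftAut hd lam hp).toLinearMap q := by
  obtain ⟨T, hT⟩ := exists_partProj_v_mem hd hp hN hu hu0 hne
  have hall : ∀ U, partProj hd lam hp q (Verma.v P U) ∈ N := fun U => by
    refine SYT.induction_swap (Q := fun U => partProj hd lam hp q (Verma.v P U) ∈ N)
      (fun T i hi h hT => ?_) hT
    have hb : boxB F (T.1 ⟨i, by omega⟩) (T.1 ⟨i + 1, hi⟩) ≠ 0 := fun h0 =>
      T.2.boxCoeff_sq_ne_one_of_swap hi h ((boxB_eq_zero_iff F _ _).mp h0)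
    have hs := congrArg (partProj hd lam hp q) ((Verma.youngFamily_v P).swap T i hi)
    have hmem : Cherednik.t (ReflGroup.permElt (adjSwap n i)) ∈ Cherednik.fixedAlg P n p hd :=
      Cherednik.t_mem_fixedAlg_of_totalExpo hd (ReflGroup.totalExpo_permElt _)
    rw [fillVec_of_isSYT _ h, map_add, partProj_smul_base, partProj_smul_base,
      partProj_smul hd hp q hmem, ← sub_eq_iff_eq_add'] at hs
    have h2 := N.smul_of_tower_mem (boxB F (T.1 ⟨i, by omega⟩) (T.1 ⟨i + 1, hi⟩))⁻¹
      (N.sub_mem (N.smul_mem (⟨_, hmem⟩ : Cherednik.fixedAlg P n p hd) hT)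
        (N.smul_of_tower_mem (boxA F (T.1 ⟨i, by omega⟩) (T.1 ⟨i + 1, hi⟩)) hT))
    change _ • ((Cherednik.t (ReflGroup.permElt (adjSwap n i)) : Cherednik P n) •
      partProj hd lam hp q (Verma.v P T) - _) ∈ N at h2
    rwa [hs, smul_smul, inv_mul_cancel₀ hb, one_smul] at h2
  refine le_antisymm hN fun m hm => ?_
  rw [← partProj_of_mem hd hp hm]
  exact partProj_mem_of_forall_v hd hp N hall m

include hn in
-- Otherwise `M(λ,q)` would be zero, and with it every other eigenspace, since powers of `t_{ζ_1}`
-- move all of them into this one injectively. But `v_T` is the sum of its projections and is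
-- nonzero.
theorem exists_partProj_v_ne_zero (q : ℕ) : ∃ T : SYT lam, partProj hd lam hp q (Verma.v P T) ≠ 0 := by
  by_contra! hcon
  have h0 : ∀ m ∈ vermaPart (shiftAut hd lam hp).toLinearMap (q : ℤ), m = 0 := fun m hm => by
    have := partProj_mem_of_forall_v hd hp (q := q) ⊥ (fun T => by rw [hcon T]; exact zero_mem _) m
    rwa [partProj_of_mem hd hp hm, Submodule.mem_bot] at this
  have h1 : ∀ q' : ℤ, ∀ m ∈ vermaPart (shiftAut hd lam hp).toLinearMap q', m = 0 := by
    intro q' m hm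
    have h2 := t_smul_mem_vermaPart hd lam hp ⟨0, hn⟩ (q' - q) hm
    rw [sub_sub_cancel] at h2
    have h3 := congrArg (fun m => (Cherednik.t (ReflGroup.diagElt ⟨0, hn⟩
      (-((q' - q : ℤ) : ZMod r))) : Cherednik P n) • m) (h0 _ h2)
    simpa only [← mul_smul, Cherednik.t_diagElt_neg_mul, one_smul, smul_zero] using h3
  obtain ⟨T⟩ := (inferInstance : Nonempty (SYT lam))
  refine Verma.v_ne_zero P T ?_
  rw [← sum_eigProj (C := (shiftAut hd lam hp).toLinearMap)
    (natCast_period_quot_ne_zero hd lam hp) (isPrimitiveRoot_zetaPow_twistShift hd hp)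
    (Verma.v P T)]
  exact Finset.sum_eq_zero fun q' _ => h1 (q' : ℕ) _ (eigProj_mem_vermaPart hd lam hp q' _)

theorem partProj_mem_deg (q : ℕ) {d : ℕ} {m : Verma P lam} (hm : m ∈ Verma.deg P lam d) :
    partProj hd lam hp q m ∈ Verma.deg P lam d := by
  unfold partProj
  rw [eigProj_apply]
  refine Submodule.smul_mem _ _ (Submodule.sum_mem _ fun j hj => Submodule.smul_mem _ _ ?_)
  clear hj
  induction j with
  | zero => exact hm
  | succ j ih =>
    rw [pow_succ', Module.End.mul_apply]
    exact Verma.rotAut_mem_deg hd _ (twistShift_relation hd lam hp) ih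

include hn in
-- The Euler element makes submodules homogeneous, so one containing an element with nonzero degree
-- zero component also contains that component and is everything. Proper submodules thus lie in the
-- kernel of the projection to degree zero, which is not all of `M(λ,q)`.
theorem isCoatom_jacobson_vermaPart (hκ : P.kappa ≠ 0) (q : ℕ) :
    IsCoatom (Module.jacobson (Cherednik.fixedAlg P n p hd)
      (vermaPart (shiftAut hd lam hp).toLinearMap (q : ℤ))) := by
  let X := vermaPart (shiftAut hd lam hp).toLinearMap (q : ℤ)
  let g : X →+ Verma.deg P lam 0 :=
    (summandProj (Verma.deg_isInternal (P := P) (lam := lam)) 0).toAddMonoidHom.comp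
      X.subtype.toAddMonoidHom
  refine isCoatom_jacobson_of_le g.ker ?_ fun Q hQ m hm => ?_
  · obtain ⟨T, hT⟩ := exists_partProj_v_ne_zero (P := P) (lam := lam) hd hp hn q
    refine ⟨⟨_, partProj_mem hd hp q (Verma.v P T)⟩, fun h => hT ?_⟩
    have h1 : summandProj (Verma.deg_isInternal (P := P) (lam := lam)) 0
      (partProj hd lam hp q (Verma.v P T)) = 0 := h
    have h2 := summandProj_apply_of_mem (Verma.deg_isInternal (P := P) (lam := lam)) 0
      ⟨_, partProj_mem_deg hd hp q (Verma.v_mem_deg T)⟩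
    exact congrArg Subtype.val (h2.symm.trans h1)
  · by_contra hcon
    refine hQ ?_
    have hmem := Verma.degProj_mem_of_euler_stable hκ ((Q.map X.subtype).restrictScalars F)
      (fun m hm => (Q.map X.subtype).smul_mem
        (⟨_, Cherednik.euler_mem_fixedAlg hd⟩ : Cherednik.fixedAlg P n p hd) hm) 0
      (m := (m : Verma P lam)) ⟨m, hm, rfl⟩
    have heq := eq_vermaPart_of_mem_deg_zero hd hp (N := Q.map X.subtype)
      (Submodule.map_subtype_le X Q) hmem
      (summandProj (Verma.deg_isInternal (P := P) (lam := lam)) 0 (m : Verma P lam)).2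
      (fun h => hcon (Subtype.ext h))
    rw [eq_top_iff]
    rintro ⟨x, hx⟩ -
    have hx' : x ∈ Q.map X.subtype := by rw [heq]; exact hx
    obtain ⟨y, hy, rfl⟩ := hx'
    exact hy

end Simple

end

/-! ### Assembly of the theorem -/

theorem theorem9 {F : Type*} [Field F] [Algebra ℂ F] {r p n : ℕ} [NeZero r] (hp : p ∣ r)
    (hn : 0 < n) (P : ChParams F r)
    (hd : ∀ i : ZMod r, P.d (i + ((r / p : ℕ) : ZMod r)) = P.d i) (lam : RPartition r n) :
    -- `ℍ_p` is generated by the `x_i`, the `y_i` and the `t_w` with `w` in `G(r,p,n)`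
    Cherednik.fixedAlg P n p hd = Algebra.adjoin F (Set.range Cherednik.x ∪
      Set.range Cherednik.y ∪ Cherednik.t '' ReflGroup.subgroupP r p n) ∧
    -- `k` is also the period of `λ` under `C ^ (r/p)`
    twistPeriod P p hd lam ∣ p ∧
    IsLeast {j : ℕ | 0 < j ∧ lam.rotate ((j * (r / p) : ℕ) : ZMod r) = lam}
      (twistPeriod P p hd lam) ∧
    ∃ hs : lam.rotate (twistShift P p hd lam) = lam,
    -- the `ℍ_p`-module automorphism `C ^ (k r / p)` of `M(λ)`
    ∃ C : Verma P lam ≃ₗ[Cherednik.fixedAlg P n p hd] Verma P lam,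
    (∀ (μ : Fin n → ℕ) (T : SYT lam),
      C ((Cherednik.xMon μ : Cherednik P n) • Verma.v P T) =
        (Cherednik.xMon μ : Cherednik P n) • Verma.v P (T.rotate (twistShift P p hd lam) hs)) ∧
    -- the decomposition of `M(λ)` into the `M(λ,q)`
    ∃ hM : DirectSum.IsInternal
      (fun q : Fin (p / twistPeriod P p hd lam) => vermaPart C.toLinearMap (q : ℕ)),
    -- the radical of `M(λ,q)` is `π_q (rad M(λ))`
    (∀ q : Fin (p / twistPeriod P p hd lam),
      Module.jacobson (Cherednik.fixedAlg P n p hd) (vermaPart C.toLinearMap (q : ℕ)) =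
        (vermaRad P p hd lam).map (summandProj hM q)) ∧
    -- `rad M(λ)` is stable under `C ^ (k r / p)`
    (vermaRad P p hd lam).map C.toLinearMap = vermaRad P p hd lam ∧
    -- the automorphism that `C ^ (k r / p)` induces on `L(λ)`
    ∃ D : VermaHead P lam ≃ₗ[Cherednik.fixedAlg P n p hd] VermaHead P lam,
    (∀ m : Verma P lam, D (VermaHead.mk P lam m) = VermaHead.mk P lam (C m)) ∧
    -- the decomposition of `L(λ)` into the eigenspaces `L(λ,q)`
    DirectSum.IsInternal
      (fun q : Fin (p / twistPeriod P p hd lam) => headPart D.toLinearMap (q : ℕ)) ∧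
    -- `L(λ,q)` is the head of `M(λ,q)`
    (∀ q : Fin (p / twistPeriod P p hd lam),
      ∃ e : (vermaPart C.toLinearMap (q : ℕ) ⧸ Module.jacobson (Cherednik.fixedAlg P n p hd)
          (vermaPart C.toLinearMap (q : ℕ))) ≃ₗ[Cherednik.fixedAlg P n p hd]
          headPart D.toLinearMap (q : ℕ),
        ∀ m : vermaPart C.toLinearMap (q : ℕ),
          (e (Submodule.Quotient.mk m) : VermaHead P lam) = VermaHead.mk P lam m) ∧
    -- `L(λ,q)` is irreducible
    (P.kappa ≠ 0 → ∀ q : Fin (p / twistPeriod P p hd lam),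
      IsSimpleModule (Cherednik.fixedAlg P n p hd) (headPart D.toLinearMap (q : ℕ))) ∧
    -- the action of `t_{ζ_1}`
    (∀ q : ℤ, ∀ m ∈ vermaPart C.toLinearMap q,
      (Cherednik.t (ReflGroup.diagElt ⟨0, hn⟩ 1) : Cherednik P n) • m ∈
        vermaPart C.toLinearMap (q - 1)) ∧
    (∀ q : ℤ, Set.BijOn
      (fun l : VermaHead P lam =>
        (Cherednik.t (ReflGroup.diagElt ⟨0, hn⟩ 1) : Cherednik P n) • l)
      (headPart D.toLinearMap q) (headPart D.toLinearMap (q - 1))) ∧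
    -- gradings and graded dimensions
    DirectSum.IsInternal (VermaHead.deg P lam) ∧
    (∀ q : ℤ, ⨆ i, headPartDeg D.toLinearMap q i = (headPart D.toLinearMap q).restrictScalars F) ∧
    (∀ i : ℕ, Module.Finite F (VermaHead.deg P lam i)) ∧
    ∀ (q : ℤ) (i : ℕ), (Module.finrank F (headPartDeg D.toLinearMap q i) : ℚ) =
      (twistPeriod P p hd lam : ℚ) / (p : ℚ) * (Module.finrank F (VermaHead.deg P lam i) : ℚ) := by
  refine ⟨Cherednik.fixedAlg_eq_genAlg hd hp hn, twistPeriod_dvd hd hp, twistPeriod_isLeast hd hp,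
    rotate_twistShift hd hp, shiftAut hd lam hp, Verma.rotEquiv_xMon_smul_v _,
    isInternal_vermaPart hd lam hp, jacobson_vermaPart hd lam hp hn,
    map_shiftAut_vermaRad hd lam hp hn, headAut hd lam hp hn, headAut_mk hd lam hp hn,
    isInternal_headPart hd lam hp hn, exists_vermaPart_quot_equiv hd lam hp hn, fun hκ q => ?_,
    fun q m hm => ?_, bijOn_headPart hd lam hp hn _, VermaHead.deg_isInternal P lam,
    iSup_headPartDeg lam hd hp hn, VermaHead.finite_deg lam, finrank_headPartDeg lam hd hp hn⟩
  · obtain ⟨e, -⟩ := exists_vermaPart_quot_equiv hd lam hp hn q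
    have := isSimpleModule_iff_isCoatom.mpr (isCoatom_jacobson_vermaPart (lam := lam) hd hp hn hκ q)
    exact IsSimpleModule.congr e.symm
  · have := t_smul_mem_vermaPart hd lam hp ⟨0, hn⟩ 1 hm
    rwa [Int.cast_one] at this
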